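/- Let $q\ge 2$ be an integer and let $\mathrm{BS}(1,q)=\langle a,t\mid tat^{-1}=a^q\rangle$. A subset $R\subseteq \mathrm{BS}(1,q)$ is called rational if there are a finite set $\Sigma$ generating $\mathrm{BS}(1,q)$ as a monoid and a nondeterministic finite automaton with edges labelled by elements of $\Sigma$, one initial state and one final state, such that $R$ is the set of all products $s_1s_2\cdots s_m$ ($m\ge 0$) of the labels along runs from the initial to the final state. Then for every fixed rational subset $R\subseteq\mathrm{BS}(1,q)$, membership in $R$ is decidable in deterministic logarithmic space: there is a deterministic Turing machine with a read-only two-way input tape and finitely many read-write work tapes which, given a word $w$ of length $n$ over the alphabet $\{a,a^{-1},t,t^{-1}\}$, always halts, uses $O(\log n)$ work tape cells (that is, at most $C(1+\log_2 n)$ for $n\ge 1$ and at most $C$ for $n=0$, with $C$ depending only on $q$ and $R$), and accepts if and only if the element of $\mathrm{BS}(1,q)$ represented by $w$ belongs to $R$. -/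

import Mathlib

/-! ### Rational subsets of a monoid -/

/-- A (nondeterministic) finite automaton over a monoid `M` whose edges are labelled by elements
of the set `S`. When `S` is finite, the set of edges is automatically finite. -/
structure MonoidAutomaton (M : Type*) (S : Set M) where
  State : Type
  finite_state : Finite State
  edges : Set (State × S × State)
  start : State
  final : State

namespace MonoidAutomaton

variable {M : Type*} {S : Set M}

/-- `A.IsRun p ρ p'`: the sequence of edges `ρ` is a run of `A` from state `p` to state `p'`. -/
def IsRun (A : MonoidAutomaton M S) (p : A.State) :
    List (A.State × S × A.State) → A.State → Prop
  | [], p' => p = p'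
  | e :: ρ, p' => e ∈ A.edges ∧ e.1 = p ∧ A.IsRun e.2.2 ρ p'

/-- The production of a run: the product in `M` of the labels of its edges. -/
def production [Monoid M] (A : MonoidAutomaton M S) (ρ : List (A.State × S × A.State)) : M :=
  (ρ.map fun e => (e.2.1 : M)).prod

/-- The subset of `M` accepted by `A`: the productions of the accepting runs. -/
def accepted [Monoid M] (A : MonoidAutomaton M S) : Set M :=
  {m | ∃ ρ, A.IsRun A.start ρ A.final ∧ A.production ρ = m}

end MonoidAutomaton

/-- A subset of a monoid `M` is rational if it is accepted by an automaton over some finite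
generating set of `M`. -/
def IsRationalSubset {M : Type*} [Monoid M] (R : Set M) : Prop :=
  ∃ S : Set M, S.Finite ∧ Submonoid.closure S = ⊤ ∧
    ∃ A : MonoidAutomaton M S, A.accepted = R

/-! ### Baumslag-Solitar groups -/

/-- The two generators. -/
inductive BSGen
  | a
  | t

/-- The defining relator of `⟨a, t ∣ t a ^ p t⁻¹ = a ^ q⟩`. -/
def bsRelator (p q : ℕ) : FreeGroup BSGen :=
  FreeGroup.of BSGen.t * FreeGroup.of BSGen.a ^ p * (FreeGroup.of BSGen.t)⁻¹ *
    (FreeGroup.of BSGen.a ^ q)⁻¹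

/-- The Baumslag-Solitar group `BS(p, q) = ⟨a, t ∣ t a ^ p t⁻¹ = a ^ q⟩`. -/
abbrev BS (p q : ℕ) : Type := PresentedGroup ({bsRelator p q} : Set (FreeGroup BSGen))

/-- The input alphabet `{a, a⁻¹, t, t⁻¹}`, as formal symbols. -/
inductive BSLetter
  | a
  | aInv
  | t
  | tInv

/-- The element of `BS(p, q)` denoted by a letter. -/
def BSLetter.toGroup (p q : ℕ) : BSLetter → BS p q
  | .a => PresentedGroup.of BSGen.a
  | .aInv => (PresentedGroup.of BSGen.a)⁻¹
  | .t => PresentedGroup.of BSGen.t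
  | .tInv => (PresentedGroup.of BSGen.t)⁻¹

/-- The element of `BS(p, q)` denoted by a word over `{a, a⁻¹, t, t⁻¹}`. -/
def BS.ofWord (p q : ℕ) (w : List BSLetter) : BS p q :=
  (w.map (BSLetter.toGroup p q)).prod

/-! ### Space-bounded deterministic Turing machines -/

/-- What the input head can see: an input letter or one of the two end markers. -/
inductive InputCell (α : Type)
  | leftEnd
  | letter (x : α)
  | rightEnd

/-- A head movement. -/
inductive HeadMove
  | left
  | stay
  | right

/-- A deterministic Turing machine with a read-only two-way input tape over the alphabet `α`,
delimited by end markers, and finitely many one-way infinite read-write work tapes.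
A state `s` with `verdict s = some b` is halting, accepting if `b = true` and rejecting if
`b = false`. In a state that is not halting, `next` gives, from the state and the scanned symbols,
the new state, the move of the input head, and for every work tape the symbol to be written and the
move of its head. -/
structure OfflineTM (α : Type) where
  State : Type
  finite_state : Finite State
  Work : Type
  finite_work : Finite Work
  blank : Work
  tapes : ℕ
  start : State
  verdict : State → Option Bool
  next : State → InputCell α → (Fin tapes → Work) →
    State × HeadMove × (Fin tapes → Work × HeadMove)

namespace OfflineTM

variable {α : Type}

/-- A configuration. Cell `0` of the input tape holds the left end marker, the input occupies the
cells `1, …, n`, and cell `n + 1` holds the right end marker. -/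
structure Config (M : OfflineTM α) where
  state : M.State
  inputHead : ℕ
  work : Fin M.tapes → ℕ → M.Work
  workHead : Fin M.tapes → ℕ

/-- The content of a cell of the input tape. -/
def inputCell (w : List α) : ℕ → InputCell α
  | 0 => .leftEnd
  | i + 1 => match w[i]? with
    | some x => .letter x
    | none => .rightEnd

/-- The input head never leaves the cells `0, …, n + 1`. -/
def moveInput (n : ℕ) (h : ℕ) : HeadMove → ℕ
  | .left => h - 1
  | .stay => h
  | .right => min (h + 1) (n + 1)

/-- A work head on cell `0` that is told to move left stays there. -/
def moveWork (h : ℕ) : HeadMove → ℕ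
  | .left => h - 1
  | .stay => h
  | .right => h + 1

/-- The initial configuration: blank work tapes, all heads on cell `0`. -/
def init (M : OfflineTM α) : M.Config where
  state := M.start
  inputHead := 0
  work := fun _ _ => M.blank
  workHead := fun _ => 0

/-- One computation step on the input `w`; halting configurations do not change. -/
def step (M : OfflineTM α) (w : List α) (c : M.Config) : M.Config :=
  match M.verdict c.state with
  | some _ => c
  | none =>
    let r := M.next c.state (inputCell w c.inputHead) fun i => c.work i (c.workHead i)
    { state := r.1
      inputHead := moveInput w.length c.inputHead r.2.1
      work := fun i => Function.update (c.work i) (c.workHead i) (r.2.2 i).1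
      workHead := fun i => moveWork (c.workHead i) (r.2.2 i).2 }

/-- The configuration after `k` steps on the input `w`. -/
def configAfter (M : OfflineTM α) (w : List α) (k : ℕ) : M.Config :=
  (M.step w)^[k] M.init

/-- `M` halts on every input, and accepts exactly the words in `L`. -/
def Decides (M : OfflineTM α) (L : Set (List α)) : Prop :=
  ∀ w : List α, ∃ (k : ℕ) (b : Bool),
    M.verdict (M.configAfter w k).state = some b ∧ (b = true ↔ w ∈ L)

/-- On every input of length `n`, every work head of `M` only ever visits the first `s n` cells of
its tape. -/
def RunsInSpace (M : OfflineTM α) (s : ℕ → ℕ) : Prop :=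
  ∀ (w : List α) (k : ℕ) (i : Fin M.tapes), (M.configAfter w k).workHead i < s w.length

end OfflineTM

/-- The language `L` is decidable in (deterministic) logarithmic space. -/
def InLogSpace {α : Type} (L : Set (List α)) : Prop :=
  ∃ (M : OfflineTM α) (c : ℕ), M.Decides L ∧ M.RunsInSpace fun n => c * (Nat.log 2 n + 1)

/-! The group acts faithfully on the rationals, `a` as x ↦ x + 1 and `t` as x ↦ qx, so an element is
determined by the exponent m of its factor q^m and by its translation part. For a word of length n
these are `wordHeight` and `wordVal`, the latter a sum of terms ±q^i with |i| ≤ n. When the labels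
of the automaton for R are spelled out as words, its runs become walks in a graph on pairs (state,
height), and membership says that some walk from (s, 0) to (f, m) has the prescribed value
(`IsRationalSubset.exists_levelNet`).

The heart is `LevelNet.exists_automaton`: a finite automaton that reads base q digits from the
lowest level upwards, and is told which levels are 0 and m, recognizes the values of these walks.
Its states describe the segments into which the walk falls when it is cut at a level, together with
a carry. For arbitrary walks the number of segments is unbounded. Only the value matters, however,
so closed subwalks may be cut out (`LevelNet.Walk.exists_skeleton`) and inserted elsewhere. A closed
walk based at a lowest vertex, on level l, has value z q^l with z an integer, and q^i copies of it
have the value of one copy on level l + i. The possible z at a state form a submonoid of ℤ, which is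
finitely generated, so its elements have base q expansions with digits from a finite part of the
submonoid (`AddSubmonoid.exists_bounded_expansion`). Hence the automaton only has to remember which
states have been visited, and bounded insertions on each level suffice to keep the carries bounded.

The digits themselves are never stored. The coefficient of q^i in `wordVal` is found in one scan of
the word, and both it and the carry are at most n in absolute value; every digit is passed on to the
finite automaton at once (`inLogSpace_digitRun`). Counters that are linear in n fit in binary into
O(log n) cells (`CounterMachine.inLogSpace`). -/

/-! ### Iteration with an invariant -/

/-- Iterating `f` leads from `a` to `b`, and `P` holds at all points on the way, ends included. -/
inductive ReachVia {σ : Type*} (f : σ → σ) (P : σ → Prop) : σ → σ → Prop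
  | refl {a : σ} : P a → ReachVia f P a a
  | step {a b : σ} : P a → ReachVia f P (f a) b → ReachVia f P a b

namespace ReachVia

variable {σ : Type*} {f : σ → σ} {P P' : σ → Prop} {a b c : σ}

theorem trans (h : ReachVia f P a b) (h' : ReachVia f P b c) : ReachVia f P a c := by
  induction h with
  | refl _ => exact h'
  | step ha _ ih => exact .step ha (ih h')

theorem mono (h : ReachVia f P a b) (hP : ∀ x, P x → P' x) : ReachVia f P' a b := by
  induction h with
  | refl ha => exact .refl (hP _ ha)
  | step ha _ ih => exact .step (hP _ ha) ih

theorem single (ha : P a) (hab : f a = b) (hb : P b) : ReachVia f P a b :=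
  .step ha (by rw [hab]; exact .refl hb)

theorem exists_iterate (h : ReachVia f P a b) :
    ∃ k, f^[k] a = b ∧ ∀ j ≤ k, P (f^[j] a) := by
  induction h with
  | refl ha => exact ⟨0, rfl, fun j hj => by rw [Nat.le_zero.mp hj]; exact ha⟩
  | step ha _ ih =>
    obtain ⟨k, hk, hP⟩ := ih
    refine ⟨k + 1, hk, fun j hj => ?_⟩
    cases j with
    | zero => exact ha
    | succ j => exact hP j (by omega)

/-- From the arrival at the fixed point on, the orbit is constant, so a finite trace controls all
times. This yields space bounds from runs that end in a halting configuration. -/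
theorem forall_iterate (h : ReachVia f P a b) (hb : f b = b) (j : ℕ) : P (f^[j] a) := by
  obtain ⟨k, hk, hP⟩ := h.exists_iterate
  rcases le_total j k with hj | hj
  · exact hP j hj
  · obtain ⟨i, rfl⟩ := Nat.exists_eq_add_of_le' hj
    rw [Function.iterate_add_apply, hk, Function.iterate_fixed hb, ← hk]
    exact hP k le_rfl

end ReachVia

/-! ### From linearly bounded counters to logarithmic space. -/

/-! ### Counter machines -/

/-- A deterministic machine with a two-way read-only input head and integer counters indexed by
`κ`. It sees the signs of its counters and changes each of them by at most one in a step. -/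
structure CounterMachine (α κ : Type) where
  State : Type
  finite_state : Finite State
  start : State
  verdict : State → Option Bool
  next : State → InputCell α → (κ → SignType) → State × HeadMove × (κ → SignType)

namespace CounterMachine

variable {α κ : Type}

/-- A configuration of a counter machine. -/
structure Config (M : CounterMachine α κ) where
  state : M.State
  inputHead : ℕ
  counter : κ → ℤ

/-- The initial configuration. -/
def init (M : CounterMachine α κ) : M.Config := ⟨M.start, 0, 0⟩

/-- One computation step; halting configurations do not change. -/
noncomputable def step (M : CounterMachine α κ) (w : List α) (c : M.Config) : M.Config :=
  match M.verdict c.state with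
  | some _ => c
  | none =>
    let r := M.next c.state (OfflineTM.inputCell w c.inputHead) fun i => SignType.sign (c.counter i)
    { state := r.1
      inputHead := OfflineTM.moveInput w.length c.inputHead r.2.1
      counter := fun i => c.counter i + (r.2.2 i : ℤ) }

/-! ### Simulation of counters by binary numbers on a work tape -/

/-- The control states of the simulating Turing machine. -/
inductive Control (S κ : Type)
  | main (s : S) (sg : κ → SignType)
  -- During a pass `nz` records the tracks on which a nonzero bit has been written; on the others
  -- the sign in `sg` is replaced by zero at the end.
  | pass (s : S) (carry sg : κ → SignType) (nz : κ → Bool)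
  | back (s : S) (sg : κ → SignType)

theorem Control.finite (S κ : Type) [Finite S] [Finite κ] : Finite (Control S κ) := by
  let F : (S × (κ → SignType)) ⊕ (S × (κ → SignType) × (κ → SignType) × (κ → Bool)) ⊕
      (S × (κ → SignType)) → Control S κ
    | .inl (s, sg) => .main s sg
    | .inr (.inl (s, c, sg, nz)) => .pass s c sg nz
    | .inr (.inr (s, sg)) => .back s sg
  refine Finite.of_surjective F fun x => ?_
  cases x with
  | main s sg => exact ⟨.inl (s, sg), rfl⟩
  | pass s c sg nz => exact ⟨.inr (.inl (s, c, sg, nz)), rfl⟩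
  | back s sg => exact ⟨.inr (.inr (s, sg)), rfl⟩

/-- The new bit when `c` is added to the bit `b`. -/
def sumBit (c : SignType) (b : Bool) : Bool := if c = 0 then b else !b

/-- The carry when `c` is added to the bit `b`. -/
def sumCarry (c : SignType) (b : Bool) : SignType :=
  if c = 1 then (if b then 1 else 0) else if c = -1 then (if b then 0 else -1) else 0

theorem sumBit_add_sumCarry (c : SignType) (b : Bool) :
    ((sumBit c b).toNat : ℤ) + 2 * (sumCarry c b : ℤ) = (b.toNat : ℤ) + (c : ℤ) := by
  cases c <;> cases b <;> decide

/-- The bits in a cell; a blank counts as zero. -/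
def cellBits (x : Option (Option (κ → Bool))) : κ → Bool := (x.getD none).getD fun _ => false

/-- The sign of a counter after a change by `d`, unless the new value is zero. -/
def newSign (s d : SignType) : SignType := if s = 0 then d else s

open Classical in
/-- A Turing machine with one work tape that stores the absolute values of all counters in binary,
least significant bits first, to the right of a marker in cell `0`, and their signs in its
control. -/
noncomputable def toOfflineTM [Finite κ] (M : CounterMachine α κ) : OfflineTM α where
  State := Control M.State κ
  finite_state := by
    have := M.finite_state
    exact Control.finite _ _
  Work := Option (Option (κ → Bool))
  finite_work := inferInstance
  blank := none
  tapes := 1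
  start := .main M.start 0
  verdict
    | .main s _ => M.verdict s
    | _ => none
  next st cell x := match st with
    | .main s sg =>
      let r := M.next s cell sg
      -- An absolute value changes by the sign of the counter times the increment; at zero the
      -- increment itself becomes the sign. The marker is rewritten each time, which also installs
      -- it in the first step.
      (.pass r.1 (fun i => newSign (sg i) (r.2.2 i) * r.2.2 i)
        (fun i => newSign (sg i) (r.2.2 i)) (fun _ => false), r.2.1, fun _ => (some none, .right))
    | .pass s c sg nz =>
      -- A blank does not end the pass while a carry is pending: it is read as a zero digit and the
      -- number grows.
      if x 0 = none ∧ c = 0 then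
        (.back s (fun i => if nz i then sg i else 0), .stay, fun _ => (none, .left))
      else
        (.pass s (fun i => sumCarry (c i) (cellBits (x 0) i)) sg
          (fun i => nz i || sumBit (c i) (cellBits (x 0) i)), .stay,
          fun _ => (some (some fun i => sumBit (c i) (cellBits (x 0) i)), .right))
    | .back s sg =>
      if x 0 = some none then (.main s sg, .stay, fun _ => (x 0, .stay))
      else (.back s sg, .stay, fun _ => (x 0, .left))

/-- The number whose bits, least significant first, are those of track `i` of `l`. -/
def magnitude : List (κ → Bool) → κ → ℕ
  | [], _ => 0
  | d :: l, i => (d i).toNat + 2 * magnitude l i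

section Simulation

variable [Finite κ] (M : CounterMachine α κ)

/-- A configuration of the simulating machine with tape content `l` and head position `h`. -/
def tmConfig (st : Control M.State κ) (ih : ℕ) (l : List (Option (κ → Bool))) (h : ℕ) :
    M.toOfflineTM.Config :=
  ⟨st, ih, fun _ i => l[i]?, fun _ => h⟩

variable {M}

theorem update_getElem?_append_cons {β : Type*} (P : List β) (x y : β) (l : List β) :
    Function.update (fun i => (P ++ x :: l)[i]?) P.length (some y) =
      fun i => (P ++ y :: l)[i]? := by
  funext i
  by_cases h : i = P.length
  · subst h; simp
  · rw [Function.update_of_ne h]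
    rcases lt_or_gt_of_ne h with h | h
    · simp [List.getElem?_append_left h]
    · obtain ⟨j, rfl⟩ := Nat.exists_eq_add_of_lt h
      rw [List.getElem?_append_right (by omega), List.getElem?_append_right (by omega),
        show P.length + j + 1 - P.length = j + 1 by omega]
      rfl

theorem update_getElem?_length {β : Type*} (P : List β) (y : β) :
    Function.update (fun i => P[i]?) P.length (some y) = fun i => (P ++ [y])[i]? := by
  funext i
  by_cases h : i = P.length
  · subst h; simp
  · rw [Function.update_of_ne h]
    rcases lt_or_gt_of_ne h with h | h
    · simp [List.getElem?_append_left h]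
    · rw [List.getElem?_eq_none (by omega), List.getElem?_eq_none (by simp; omega)]

theorem step_pass_cons (w : List α) (s : M.State) (c sg : κ → SignType) (nz : κ → Bool) (ih : ℕ)
    (P : List (Option (κ → Bool))) (d : κ → Bool) (l : List (Option (κ → Bool))) :
    M.toOfflineTM.step w (M.tmConfig (.pass s c sg nz) ih (P ++ some d :: l) P.length) =
      M.tmConfig (.pass s (fun i => sumCarry (c i) (d i)) sg (fun i => nz i || sumBit (c i) (d i)))
        ih ((P ++ [some fun i => sumBit (c i) (d i)]) ++ l) (P.length + 1) := by
  simp [OfflineTM.step, tmConfig, toOfflineTM, cellBits, OfflineTM.moveInput, OfflineTM.moveWork,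
    update_getElem?_append_cons]

theorem step_pass_end (w : List α) (s : M.State) (c sg : κ → SignType) (nz : κ → Bool) (ih : ℕ)
    (P : List (Option (κ → Bool))) (hc : c ≠ 0) :
    M.toOfflineTM.step w (M.tmConfig (.pass s c sg nz) ih P P.length) =
      M.tmConfig (.pass s (fun i => sumCarry (c i) false) sg
        (fun i => nz i || sumBit (c i) false))
        ih (P ++ [some fun i => sumBit (c i) false]) (P.length + 1) := by
  simp [OfflineTM.step, tmConfig, toOfflineTM, cellBits, OfflineTM.moveInput, OfflineTM.moveWork,
    hc, update_getElem?_length]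

theorem step_pass_turn (w : List α) (s : M.State) (sg : κ → SignType) (nz : κ → Bool) (ih : ℕ)
    (P : List (Option (κ → Bool))) :
    M.toOfflineTM.step w (M.tmConfig (.pass s 0 sg nz) ih P P.length) =
      M.tmConfig (.back s fun i => if nz i then sg i else 0) ih P (P.length - 1) := by
  have : Function.update (fun i => P[i]?) P.length none = fun i => P[i]? := by
    funext i
    by_cases h : i = P.length
    · subst h; simp
    · rw [Function.update_of_ne h]
  simp [OfflineTM.step, tmConfig, toOfflineTM, OfflineTM.moveInput, OfflineTM.moveWork, this]

theorem step_back (w : List α) (s : M.State) (sg : κ → SignType) (ih h : ℕ)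
    (P : List (Option (κ → Bool))) (hP : P[h]? ≠ some none) :
    M.toOfflineTM.step w (M.tmConfig (.back s sg) ih P h) =
      M.tmConfig (.back s sg) ih P (h - 1) := by
  simp [OfflineTM.step, tmConfig, toOfflineTM, OfflineTM.moveInput, OfflineTM.moveWork, hP]

theorem step_back_marker (w : List α) (s : M.State) (sg : κ → SignType) (ih h : ℕ)
    (P : List (Option (κ → Bool))) (hP : P[h]? = some none) :
    M.toOfflineTM.step w (M.tmConfig (.back s sg) ih P h) =
      M.tmConfig (.main s sg) ih P h := by
  have : Function.update (fun i => P[i]?) h (some none) = fun i => P[i]? := by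
    rw [← hP]; exact Function.update_eq_self _ _
  simp [OfflineTM.step, tmConfig, toOfflineTM, OfflineTM.moveInput, OfflineTM.moveWork, hP, this]

/-- The pass over the digits adds the carries to the stored numbers. -/
theorem reachVia_pass (w : List α) (s : M.State) (sg : κ → SignType) (ih : ℕ) (l : List (κ → Bool)) :
    ∀ (P : List (Option (κ → Bool))) (c : κ → SignType) (nz : κ → Bool),
      (∀ i, 0 ≤ (magnitude l i : ℤ) + c i) → ∃ l' : List (κ → Bool),
        (∀ i, (magnitude l' i : ℤ) = magnitude l i + c i) ∧
        (l'.length ≤ l.length ∨ ∃ i, 2 ^ (l'.length - 1) ≤ magnitude l' i) ∧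
        ReachVia (M.toOfflineTM.step w)
          (fun x => ∀ i, x.workHead i ≤ P.length + l'.length)
          (M.tmConfig (.pass s c sg nz) ih (P ++ l.map some) P.length)
          (M.tmConfig (.pass s 0 sg fun i => nz i || decide (magnitude l' i ≠ 0)) ih
            (P ++ l'.map some) (P.length + l'.length)) := by
  induction l with
  | nil =>
    intro P c nz hc
    by_cases hc0 : c = 0
    · subst hc0
      refine ⟨[], by simp [magnitude], by simp, ?_⟩
      simpa [magnitude] using ReachVia.refl (fun i => le_rfl)
    · obtain ⟨i₀, hi₀⟩ : ∃ i, c i ≠ 0 := by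
        by_contra! h; exact hc0 (funext h)
      -- Beyond the last digit the value that remains is the carry alone; it is nonnegative, so one
      -- more digit absorbs it.
      have hc' : ∀ i, c i = 0 ∨ c i = 1 := fun i => by
        have h := hc i
        revert h
        simp only [magnitude]
        cases c i <;> simp
      refine ⟨[fun i => sumBit (c i) false], fun i => ?_, .inr ⟨i₀, ?_⟩, ?_⟩
      · rcases hc' i with h | h <;> simp [magnitude, sumBit, h]
      · simp [magnitude, sumBit, hi₀]
      · have h1 : (fun i => sumCarry (c i) false) = 0 := funext fun i => by
          rcases hc' i with h | h <;> simp [sumCarry, h]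
        have h2 : (fun i => nz i || decide (magnitude [fun i => sumBit (c i) false] i ≠ 0)) =
            fun i => nz i || sumBit (c i) false := funext fun i => by
          cases h : sumBit (c i) false <;> simp [magnitude, h]
        refine ReachVia.single (fun i => ?_) ?_ (fun i => ?_)
        · simp [tmConfig]
        · simp only [List.map_nil, List.append_nil]
          rw [step_pass_end _ _ _ _ _ _ _ hc0, h1, h2]
          rfl
        · simp [tmConfig]
  | cons d l IH =>
    intro P c nz hc
    have key := fun i => sumBit_add_sumCarry (c i) (d i)
    have hbit : ∀ b : Bool, (b.toNat : ℤ) ≤ 1 := fun b => by cases b <;> simp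
    obtain ⟨l', h1, h2, h3⟩ := IH (P ++ [some fun i => sumBit (c i) (d i)])
      (fun i => sumCarry (c i) (d i)) (fun i => nz i || sumBit (c i) (d i)) (fun i => by
        have h := hc i
        have h' := key i
        have h'' := hbit (sumBit (c i) (d i))
        simp only [magnitude] at h
        push_cast at h
        omega)
    refine ⟨(fun i => sumBit (c i) (d i)) :: l', fun i => ?_, ?_, ?_⟩
    · have h' := key i
      have h'' := h1 i
      simp only [magnitude]
      push_cast
      omega
    -- Leading zeros are never removed, but a digit is appended only if it is 1 on some track. The
    -- length is then bounded by the logarithm of the number on that track.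
    · rcases h2 with h2 | ⟨i, hi⟩
      · left; simpa using h2
      · rcases Nat.eq_zero_or_pos l'.length with h0 | h0
        · left; simp [h0]
        · right
          refine ⟨i, ?_⟩
          have : l'.length = (l'.length - 1) + 1 := by omega
          simp only [List.length_cons, Nat.add_sub_cancel, magnitude]
          rw [this, pow_succ]
          omega
    · refine ReachVia.step (fun i => by simp [tmConfig]) ?_
      rw [List.map_cons, step_pass_cons]
      have h4 : (fun i => nz i || decide (magnitude ((fun i => sumBit (c i) (d i)) :: l') i ≠ 0)) =
          fun i => (nz i || sumBit (c i) (d i)) || decide (magnitude l' i ≠ 0) := funext fun i => by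
        cases h : sumBit (c i) (d i) <;> simp [magnitude, h]
      rw [h4]
      have h5 : P.length + ((fun i => sumBit (c i) (d i)) :: l').length =
        (P ++ [some fun i => sumBit (c i) (d i)]).length + l'.length := by simp; omega
      rw [h5]
      simpa using h3

theorem reachVia_back (w : List α) (s : M.State) (sg : κ → SignType) (ih : ℕ)
    (l : List (κ → Bool)) (h : ℕ) (hl : h ≤ l.length) :
    ReachVia (M.toOfflineTM.step w) (fun x => ∀ i, x.workHead i ≤ l.length)
      (M.tmConfig (.back s sg) ih (none :: l.map some) h)
      (M.tmConfig (.main s sg) ih (none :: l.map some) 0) := by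
  induction h with
  | zero =>
    exact .single (fun i => by simp [tmConfig]) (step_back_marker _ _ _ _ _ _ rfl)
      (fun i => by simp [tmConfig])
  | succ h IH =>
    refine .step (fun i => by simpa [tmConfig] using hl) ?_
    rw [step_back]
    · exact IH (by omega)
    · simp

/-- The tape content `l` stores the counters `x`. -/
def Stores (l : List (κ → Bool)) (x : κ → ℤ) : Prop := ∀ i, magnitude l i = (x i).natAbs

/-- The sign is claimed only for a nonzero new value, since a zero is discovered during the pass. -/
theorem newSign_mul_add (x : ℤ) (d : SignType) :
    (0 : ℤ) ≤ x.natAbs + (newSign (SignType.sign x) d * d : SignType) ∧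
    ((x + d).natAbs : ℤ) = x.natAbs + (newSign (SignType.sign x) d * d : SignType) ∧
    (x + d ≠ 0 → SignType.sign (x + d) = newSign (SignType.sign x) d) := by
  rcases lt_trichotomy x 0 with hx | rfl | hx
  · rw [sign_neg hx]
    have h : newSign (-1) d = -1 := by simp [newSign]
    rw [h]
    refine ⟨?_, ?_, fun h0 => ?_⟩
    · cases d <;> simp [-Nat.cast_natAbs] <;> omega
    · cases d <;> simp [-Nat.cast_natAbs] <;> omega
    · rw [sign_neg]
      revert h0
      cases d <;> simp <;> omega
  · rw [sign_zero]
    have h : newSign 0 d = d := by simp [newSign]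
    rw [h]
    cases d <;> simp
  · rw [sign_pos hx]
    have h : newSign 1 d = 1 := by simp [newSign]
    rw [h]
    refine ⟨?_, ?_, fun h0 => ?_⟩
    · cases d <;> simp [-Nat.cast_natAbs] <;> omega
    · cases d <;> simp [-Nat.cast_natAbs] <;> omega
    · rw [sign_pos]
      revert h0
      cases d <;> simp <;> omega

/-- The configuration of the Turing machine that stands for a configuration of the counter
machine. -/
def Represents (c : M.Config) (b : ℕ) (x : M.toOfflineTM.Config) : Prop :=
  ∃ (l : List (κ → Bool)) (P : List (Option (κ → Bool))), Stores l c.counter ∧ l.length ≤ b ∧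
    -- The second alternative is the blank tape at the start, before the marker is written.
    (P = none :: l.map some ∨ (P = [] ∧ l = [])) ∧
    x = M.tmConfig (.main c.state fun i => SignType.sign (c.counter i)) c.inputHead P 0

/-- A step is simulated by writing the marker, a pass to the right, a turn and the way back. The
tape does not outgrow `b`, because a new leading digit 1 bounds the length by `Nat.log 2 B + 1`. -/
theorem represents_step (w : List α) (c : M.Config) (b B : ℕ) (x : M.toOfflineTM.Config)
    (hb : Nat.log 2 B + 1 ≤ b)
    (hB : ∀ i, ((M.step w c).counter i).natAbs ≤ B) (hx : Represents c b x) :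
    ∃ y, Represents (M.step w c) b y ∧
      ReachVia (M.toOfflineTM.step w) (fun z => ∀ i, z.workHead i ≤ b + 1) x y := by
  obtain ⟨l, P, hl, hlb, hP, rfl⟩ := hx
  cases hv : M.verdict c.state with
  | some v =>
    have : M.step w c = c := by simp [step, hv]
    rw [this]
    exact ⟨_, ⟨l, P, hl, hlb, hP, rfl⟩, .refl fun i => by simp [tmConfig]⟩
  | none =>
    set sg : κ → SignType := fun i => SignType.sign (c.counter i) with hsg
    set r := M.next c.state (OfflineTM.inputCell w c.inputHead) sg with hr
    have hstep : M.step w c = ⟨r.1, OfflineTM.moveInput w.length c.inputHead r.2.1,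
        fun i => c.counter i + (r.2.2 i : ℤ)⟩ := by
      simp [step, hv, hr, hsg]
    have htm : M.toOfflineTM.step w (M.tmConfig (.main c.state sg) c.inputHead P 0) =
        M.tmConfig (.pass r.1 (fun i => newSign (sg i) (r.2.2 i) * r.2.2 i)
          (fun i => newSign (sg i) (r.2.2 i)) fun _ => false)
          (OfflineTM.moveInput w.length c.inputHead r.2.1) ([none] ++ l.map some)
          [none (α := κ → Bool)].length := by
      have hup : Function.update (fun i : ℕ => P[i]?) 0 (some none) =
          fun i : ℕ => ([none] ++ l.map some)[i]? := by
        rcases hP with rfl | ⟨rfl, rfl⟩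
        · exact update_getElem?_append_cons [] none none (l.map some)
        · exact update_getElem?_length [] none
      simp only [List.length_singleton]
      simp [OfflineTM.step, tmConfig, toOfflineTM, hv, ← hr, OfflineTM.moveWork]
      simpa using congrArg (fun f (_ : Fin 1) => f) hup
    have hkey := fun i => newSign_mul_add (c.counter i) (r.2.2 i)
    obtain ⟨l', h1, h2, h3⟩ := reachVia_pass (M := M) w r.1 (fun i => newSign (sg i) (r.2.2 i))
      (OfflineTM.moveInput w.length c.inputHead r.2.1) l [none]
      (fun i => newSign (sg i) (r.2.2 i) * r.2.2 i) (fun _ => false) (fun i => by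
        rw [hl i]; exact (hkey i).1)
    have hst : Stores l' (M.step w c).counter := fun i => by
      have h4 := h1 i
      rw [hl i, ← (hkey i).2.1] at h4
      rw [hstep]
      exact_mod_cast h4
    have hlen : l'.length ≤ b := by
      rcases h2 with h2 | ⟨i, hi⟩
      · omega
      · have h5 : 2 ^ (l'.length - 1) ≤ B := hi.trans ((hst i).le.trans (hB i))
        have h6 := Nat.le_log_of_pow_le (by norm_num) h5
        omega
    have hsign : (fun i => if (false || decide (magnitude l' i ≠ 0)) then
        newSign (sg i) (r.2.2 i) else 0) = fun i => SignType.sign ((M.step w c).counter i) := by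
      funext i
      have h7 := hst i
      by_cases h0 : (M.step w c).counter i = 0
      · simp [h7, h0]
      · simp only [Bool.false_or, h7, ne_eq, Int.natAbs_eq_zero, h0, not_false_eq_true,
          decide_true, if_true]
        rw [hstep] at h0 ⊢
        exact ((hkey i).2.2 h0).symm
    refine ⟨M.tmConfig (.main (M.step w c).state fun i => SignType.sign ((M.step w c).counter i))
      (M.step w c).inputHead (none :: l'.map some) 0,
      ⟨l', _, hst, hlen, .inl rfl, rfl⟩, ?_⟩
    refine .step (fun i => by simp [tmConfig]) ?_
    rw [htm]
    refine (h3.mono fun z hz i => (hz i).trans ?_).trans ?_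
    · simp; omega
    refine .step (fun i => by simp [tmConfig]; omega) ?_
    have h8 : [none (α := κ → Bool)].length + l'.length = ([none] ++ l'.map some).length := by
      simp [add_comm]
    rw [h8, step_pass_turn]
    rw [hsign, hstep]
    exact (reachVia_back (M := M) w r.1 _ _ l' _ (by simp)).mono
      fun z hz i => (hz i).trans (by omega)

theorem represents_iterate (w : List α) (b B : ℕ) (hb : Nat.log 2 B + 1 ≤ b)
    (hB : ∀ k i, (((M.step w)^[k] M.init).counter i).natAbs ≤ B) (k : ℕ) :
    ∃ y, Represents ((M.step w)^[k] M.init) b y ∧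
      ReachVia (M.toOfflineTM.step w) (fun z => ∀ i, z.workHead i ≤ b + 1) M.toOfflineTM.init y := by
  induction k with
  | zero =>
    refine ⟨_, ⟨[], [], fun i => by simp [init, magnitude], by simp, .inr ⟨rfl, rfl⟩,
      rfl⟩, ?_⟩
    have : M.toOfflineTM.init = M.tmConfig (.main ((M.step w)^[0] M.init).state
        fun i => SignType.sign (((M.step w)^[0] M.init).counter i))
        ((M.step w)^[0] M.init).inputHead [] 0 := by
      simp only [OfflineTM.init, tmConfig, init, toOfflineTM, Function.iterate_zero, id]
      congr 1
    rw [this]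
    exact .refl fun i => by simp [tmConfig]
  | succ k IH =>
    obtain ⟨y, hy, hreach⟩ := IH
    have hs : (M.step w)^[k + 1] M.init = M.step w ((M.step w)^[k] M.init) :=
      Function.iterate_succ_apply' _ _ _
    obtain ⟨y', hy', hreach'⟩ := represents_step w _ b B y hb (fun i => hs ▸ hB (k + 1) i) hy
    rw [hs]
    exact ⟨y', hy', hreach.trans hreach'⟩

end Simulation

/-- A language decided by a counter machine with linearly bounded counters is decidable in
logarithmic space. -/
theorem inLogSpace [Finite κ] (M : CounterMachine α κ) (L : Set (List α)) (C : ℕ)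
    (hM : ∀ w : List α, ∃ (c : M.Config) (b : Bool),
      ReachVia (M.step w) (fun x => ∀ i, (x.counter i).natAbs ≤ C * (w.length + 1)) M.init c ∧
      M.verdict c.state = some b ∧ (b = true ↔ w ∈ L)) :
    InLogSpace L := by
  have main : ∀ w : List α, ∃ (y : M.toOfflineTM.Config) (b : Bool),
      ReachVia (M.toOfflineTM.step w)
        (fun z => ∀ i, z.workHead i < (C + 5) * (Nat.log 2 w.length + 1)) M.toOfflineTM.init y ∧
      M.toOfflineTM.verdict y.state = some b ∧ (b = true ↔ w ∈ L) := by
    intro w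
    obtain ⟨c, v, hreach, hv, hL⟩ := hM w
    have hfix : M.step w c = c := by simp [step, hv]
    have hB := fun k i => hreach.forall_iterate hfix k i
    obtain ⟨k, hk, -⟩ := hreach.exists_iterate
    obtain ⟨y, ⟨l, P, -, -, -, rfl⟩, hy⟩ := represents_iterate (M := M) w _ _ le_rfl hB k
    refine ⟨_, v, hy.mono fun z hz i => (hz i).trans_lt ?_, ?_, hL⟩
    -- The head stays within `Nat.log 2 (C * (n + 1)) + 2`, and this logarithm is at most `C +
    -- Nat.log 2 n + 1`, where `n` is the length of `w`.
    · have h1 : w.length + 1 ≤ 2 ^ (Nat.log 2 w.length + 1) :=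
        Nat.lt_pow_succ_log_self (by norm_num) _
      have h2 : C * (w.length + 1) ≤ 2 ^ (C + (Nat.log 2 w.length + 1)) := by
        rw [pow_add]
        exact Nat.mul_le_mul (Nat.lt_two_pow_self).le h1
      have h3 : Nat.log 2 (C * (w.length + 1)) ≤ C + (Nat.log 2 w.length + 1) := by
        calc _ ≤ Nat.log 2 (2 ^ (C + (Nat.log 2 w.length + 1))) := Nat.log_mono_right h2
          _ = _ := Nat.log_pow (by norm_num) _
      nlinarith [Nat.zero_le (Nat.log 2 w.length), Nat.zero_le (C * Nat.log 2 w.length)]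
    · rw [hk]
      exact hv
  refine ⟨M.toOfflineTM, C + 5, fun w => ?_, fun w k i => ?_⟩
  · obtain ⟨y, b, hreach, hb, hL⟩ := main w
    obtain ⟨k, hk, -⟩ := hreach.exists_iterate
    exact ⟨k, b, by rw [OfflineTM.configAfter, hk, hb], hL⟩
  · obtain ⟨y, b, hreach, hb, hL⟩ := main w
    exact hreach.forall_iterate (by simp [OfflineTM.step, hb]) k i

end CounterMachine

/-! ### Computing the digits of a word with linearly bounded counters. -/

/-! ### Heights and coefficients of words -/

namespace BSLetter

/-- The exponent of `t` in a letter. -/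
def rise : BSLetter → SignType
  | .t => 1
  | .tInv => -1
  | _ => 0

/-- The exponent of `a` in a letter. -/
def shift : BSLetter → SignType
  | .a => 1
  | .aInv => -1
  | _ => 0

end BSLetter

/-- The exponent sum of `t` in a word. -/
def wordHeight : List BSLetter → ℤ
  | [] => 0
  | l :: w => (l.rise : ℤ) + wordHeight w

/-- The exponent sum of the letters `a` in a word read at height `0`, when the word is started at
height `x`. -/
def wordCoeff : ℤ → List BSLetter → ℤ
  | _, [] => 0
  | x, l :: w => (if x = 0 then (l.shift : ℤ) else 0) + wordCoeff (x + l.rise) w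

theorem SignType.natAbs_coe_le (s : SignType) : (s : ℤ).natAbs ≤ 1 := by cases s <;> decide

theorem natAbs_wordHeight_le (w : List BSLetter) : (wordHeight w).natAbs ≤ w.length := by
  induction w with
  | nil => simp [wordHeight]
  | cons l w ih =>
    have := SignType.natAbs_coe_le l.rise
    simp only [wordHeight, List.length_cons]
    omega

theorem natAbs_wordCoeff_le (w : List BSLetter) (x : ℤ) : (wordCoeff x w).natAbs ≤ w.length := by
  induction w generalizing x with
  | nil => simp [wordCoeff]
  | cons l w ih =>
    have := SignType.natAbs_coe_le l.shift
    have := ih (x + l.rise)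
    simp only [wordCoeff, List.length_cons]
    split <;> omega

/-- Heights change by at most one per letter, so a word started too far from height 0 never gets
there. -/
theorem wordCoeff_eq_zero (w : List BSLetter) (x : ℤ) (hx : w.length < x.natAbs) :
    wordCoeff x w = 0 := by
  induction w generalizing x with
  | nil => rfl
  | cons l w ih =>
    have := SignType.natAbs_coe_le l.rise
    simp only [List.length_cons] at hx
    rw [wordCoeff, ih _ (by omega), if_neg (by omega), add_zero]

/-! ### A counter machine that feeds the base `q` expansion of a word to a finite automaton -/

/-- The states of an automaton `δ`, together with the carries, when it is fed with the digits of
the number with coefficients `wordCoeff`, from level `-n` upwards, where `n` is the length of the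
word. Two flags tell it which levels are `0` and the height of the word. -/
def digitRun {D : Type*} (q : ℕ) (δ : D → ℕ → Bool → Bool → D) (d₀ : D) (w : List BSLetter) :
    ℕ → D × ℤ
  | 0 => (d₀, 0)
  | j + 1 =>
    let r := digitRun q δ d₀ w j
    -- `x` is minus the level, so a prefix of height h ends on the level exactly when x + h = 0,
    -- which is what `wordCoeff` tests.
    let x : ℤ := w.length - j
    let c : ℤ := r.2 + wordCoeff x w
    (δ r.1 (c % q).toNat (decide (x = 0)) (decide (x + wordHeight w = 0)), c / q)

namespace DigitMachine

open CounterMachine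

/-- The control states of the machine. -/
inductive Phase (D : Type) (q : ℕ)
  | start
  | count (i : Fin 3)
  | rewind
  | level (d : D)
  | transfer (d : D) (r : Fin q)
  | forward (d : D) (r : Fin q) (b : Bool)
  | backward (d : D)
  | move (d : D)
  | halt (b : Bool)

theorem Phase.finite (D : Type) (q : ℕ) [Finite D] : Finite (Phase D q) := by
  let F : Fin 3 ⊕ Unit ⊕ Unit ⊕ D ⊕ (D × Fin q) ⊕ (D × Fin q × Bool) ⊕ D ⊕ D ⊕ Bool → Phase D q
    | .inl i => .count i
    | .inr (.inl _) => .start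
    | .inr (.inr (.inl _)) => .rewind
    | .inr (.inr (.inr (.inl d))) => .level d
    | .inr (.inr (.inr (.inr (.inl (d, r))))) => .transfer d r
    | .inr (.inr (.inr (.inr (.inr (.inl (d, r, b)))))) => .forward d r b
    | .inr (.inr (.inr (.inr (.inr (.inr (.inl d)))))) => .backward d
    | .inr (.inr (.inr (.inr (.inr (.inr (.inr (.inl d))))))) => .move d
    | .inr (.inr (.inr (.inr (.inr (.inr (.inr (.inr b))))))) => .halt b
  refine Finite.of_surjective F fun x => ?_
  cases x with
  | start => exact ⟨.inr (.inl ()), rfl⟩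
  | count i => exact ⟨.inl i, rfl⟩
  | rewind => exact ⟨.inr (.inr (.inl ())), rfl⟩
  | level d => exact ⟨.inr (.inr (.inr (.inl d))), rfl⟩
  | transfer d r => exact ⟨.inr (.inr (.inr (.inr (.inl (d, r))))), rfl⟩
  | forward d r b => exact ⟨.inr (.inr (.inr (.inr (.inr (.inl (d, r, b)))))), rfl⟩
  | backward d => exact ⟨.inr (.inr (.inr (.inr (.inr (.inr (.inl d)))))), rfl⟩
  | move d => exact ⟨.inr (.inr (.inr (.inr (.inr (.inr (.inr (.inl d))))))), rfl⟩
  | halt b => exact ⟨.inr (.inr (.inr (.inr (.inr (.inr (.inr (.inr b))))))), rfl⟩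

variable {D : Type} {q : ℕ}

/-- The residue of an integer modulo `q`. -/
def residue (hq : 2 ≤ q) (V : ℤ) : Fin q :=
  ⟨(V % q).toNat, by
    have h1 := Int.emod_lt_of_pos V (show (0 : ℤ) < q by omega)
    omega⟩

/-- The change of `V / q` when `s` is added to a number `V` with residue `r`. -/
noncomputable def quotChange (r : Fin q) (s : SignType) : SignType :=
  SignType.sign (((r : ℤ) + s) / q)

theorem residue_val (hq : 2 ≤ q) (V : ℤ) : ((residue hq V : ℕ) : ℤ) = V % q :=
  Int.toNat_of_nonneg (Int.emod_nonneg _ (by omega))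

theorem residue_add (hq : 2 ≤ q) (V : ℤ) (s : SignType) :
    residue hq ((residue hq V : ℤ) + s) = residue hq (V + s) := by
  apply Fin.ext
  simp only [residue_val]
  simp [residue]

/-- The residue lies in [0, q) and |s| ≤ 1, so the quotient of their sum is -1, 0 or 1 and equals
its own sign. Thus the change is one that a counter can make in a single step. -/
theorem ediv_add_quotChange (hq : 2 ≤ q) (V : ℤ) (s : SignType) :
    V / q + (quotChange (residue hq V) s : ℤ) = (V + s) / q := by
  have hq' : (0 : ℤ) < q := by omega
  have h1 := residue_val hq V
  have h2 := Int.emod_lt_of_pos V hq'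
  have h3 := Int.emod_nonneg V hq'.ne'
  have h4 : V + s = (V % q + s) + q * (V / q) := by
    have := Int.emod_add_mul_ediv V q
    omega
  rw [h4, Int.add_mul_ediv_left _ _ hq'.ne', add_comm]
  congr 1
  rw [quotChange, h1]
  have h5 := SignType.natAbs_coe_le s
  have h6 : -1 ≤ (V % q + s) / q := by
    rw [Int.le_ediv_iff_mul_le hq']; omega
  have h7 : (V % q + s) / q ≤ 1 := by
    rw [← Int.lt_add_one_iff, Int.ediv_lt_iff_lt_mul hq']; omega
  obtain h | h | h : (V % q + s) / q = -1 ∨ (V % q + s) / q = 0 ∨ (V % q + s) / q = 1 := by omega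
  all_goals rw [h]; simp

theorem natAbs_ediv_le (hq : 2 ≤ q) (V : ℤ) : (V / q).natAbs ≤ V.natAbs := by
  have hq' : (0 : ℤ) < q := by omega
  rcases le_total 0 V with h | h
  · have h1 := Int.ediv_nonneg h hq'.le
    have h2 := Int.ediv_le_self (q : ℤ) h
    omega
  · have h1 : V ≤ V / q := by
      rw [Int.le_ediv_iff_mul_le hq']; nlinarith
    have h2 : V / q ≤ 0 := Int.ediv_nonpos_of_nonpos_of_neg h hq'
    omega

/-- The counters are: minus the current level plus the current height, the incoming carry, the
outgoing carry, and the number of levels that are left. -/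
noncomputable def machine [Finite D] (hq : 2 ≤ q) (δ : D → ℕ → Bool → Bool → D) (d₀ : D)
    (acc : D → Bool → Bool) : CounterMachine BSLetter (Fin 4) where
  State := Phase D q
  finite_state := Phase.finite D q
  start := .start
  verdict
    | .halt b => some b
    | _ => none
  next st cell sg := match st with
    | .start => (.count 0, .right, ![0, 0, 0, 1])
    | .count i => match cell with
      | .letter _ =>
        -- Three steps per letter, since a counter changes by at most one in a step: counter 0 ends
        -- at n and counter 3 at 3n + 1, the number of levels.
        if i = 0 then (.count 1, .stay, ![1, 0, 0, 1])
        else if i = 1 then (.count 2, .stay, ![0, 0, 0, 1])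
        else (.count 0, .right, ![0, 0, 0, 1])
      | _ => (.rewind, .left, ![0, 0, 0, 0])
    | .rewind => match cell with
      | .leftEnd => (.level d₀, .stay, ![0, 0, 0, 0])
      | _ => (.rewind, .left, ![0, 0, 0, 0])
    | .level d =>
      if sg 3 = 0 then (.halt (acc d (decide (sg 1 = -1))), .stay, ![0, 0, 0, 0])
      else (.transfer d (residue hq 0), .stay, ![0, 0, 0, 0])
    | .transfer d r =>
      -- The sum V of carry and coefficient is never stored: the control holds its residue modulo q
      -- and counter 2 holds V / q. The flag kept in `forward` says that the level is 0.
      if sg 1 = 0 then (.forward d r (decide (sg 0 = 0)), .right, ![0, 0, 0, 0])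
      else (.transfer d (residue hq ((r : ℤ) + sg 1)), .stay, ![0, -sg 1, quotChange r (sg 1), 0])
    | .forward d r b => match cell with
      | .letter l =>
        let s : SignType := if sg 0 = 0 then l.shift else 0
        (.forward d (residue hq ((r : ℤ) + s)) b, .right, ![l.rise, 0, quotChange r s, 0])
      -- At the right end counter 0 vanishes exactly when the level is the height of the word. The
      -- way back undoes the changes of this counter.
      | _ => (.backward (δ d r b (decide (sg 0 = 0))), .left, ![0, 0, 0, 0])
    | .backward d => match cell with
      | .letter l => (.backward d, .left, ![-l.rise, 0, 0, 0])
      | _ => (.move d, .stay, ![0, 0, 0, 0])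
    | .move d =>
      if sg 2 = 0 then (.level d, .stay, ![-1, 0, 0, -1])
      else (.move d, .stay, ![0, sg 2, -sg 2, 0])
    | .halt b => (.halt b, .stay, ![0, 0, 0, 0])

section

variable [Finite D] (hq : 2 ≤ q) (δ : D → ℕ → Bool → Bool → D) (d₀ : D) (acc : D → Bool → Bool)

/-- A configuration of the machine. -/
def snapshot (st : Phase D q) (h : ℕ) (x y u z : ℤ) : (machine hq δ d₀ acc).Config :=
  ⟨st, h, ![x, y, u, z]⟩

/-- All counters are at most `B`. -/
def Bounded (B : ℕ) (c : (machine hq δ d₀ acc).Config) : Prop := ∀ i, (c.counter i).natAbs ≤ B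

variable {hq δ d₀ acc}

theorem bounded_config {B : ℕ} {st : Phase D q} {h : ℕ} {x y u z : ℤ} (hx : x.natAbs ≤ B)
    (hy : y.natAbs ≤ B) (hu : u.natAbs ≤ B) (hz : z.natAbs ≤ B) :
    Bounded hq δ d₀ acc B (snapshot hq δ d₀ acc st h x y u z) := by
  intro i
  fin_cases i <;> simpa [snapshot]

theorem step_config (w : List BSLetter) {st st' : Phase D q} {h : ℕ} {x y u z : ℤ} {mv : HeadMove}
    {a b c d : SignType} (hv : (machine hq δ d₀ acc).verdict st = none)
    (hn : (machine hq δ d₀ acc).next st (OfflineTM.inputCell w h)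
      ![SignType.sign x, SignType.sign y, SignType.sign u, SignType.sign z] =
      (st', mv, ![a, b, c, d])) :
    (machine hq δ d₀ acc).step w (snapshot hq δ d₀ acc st h x y u z) =
      snapshot hq δ d₀ acc st' (OfflineTM.moveInput w.length h mv) (x + a) (y + b) (u + c)
        (z + d) := by
  have hsg : (fun i => SignType.sign (![x, y, u, z] i)) =
      ![SignType.sign x, SignType.sign y, SignType.sign u, SignType.sign z] := by
    funext i; fin_cases i <;> rfl
  have hc : (fun i => (![x, y, u, z] i : ℤ) + ((![a, b, c, d] i : SignType) : ℤ)) =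
      ![x + a, y + b, u + c, z + d] := by
    funext i; fin_cases i <;> rfl
  simp only [CounterMachine.step, snapshot, hv, hsg, hn, hc]

theorem inputCell_append_cons (pre suf : List BSLetter) (l : BSLetter) :
    OfflineTM.inputCell (pre ++ l :: suf) (pre.length + 1) = .letter l := by
  simp [OfflineTM.inputCell]

theorem inputCell_end (w : List BSLetter) :
    OfflineTM.inputCell w (w.length + 1) = .rightEnd := by
  simp [OfflineTM.inputCell]

/-- While units are moved out of `y`, the control and the third counter hold residue and quotient of
the amount `V` collected so far; |y| + |V| does not grow. -/
theorem reachVia_transfer (w : List BSLetter) (d : D) (x z : ℤ) (h B k : ℕ) (hx : x.natAbs ≤ B)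
    (hz : z.natAbs ≤ B) :
    ∀ y V : ℤ, y.natAbs = k → y.natAbs + V.natAbs ≤ B →
      ReachVia ((machine hq δ d₀ acc).step w) (Bounded hq δ d₀ acc B)
        (snapshot hq δ d₀ acc (.transfer d (residue hq V)) h x y (V / q) z)
        (snapshot hq δ d₀ acc (.transfer d (residue hq (V + y))) h x 0 ((V + y) / q) z) := by
  induction k with
  | zero =>
    intro y V hy hB
    obtain rfl : y = 0 := by omega
    rw [add_zero]
    have := natAbs_ediv_le hq V
    exact .refl (bounded_config hx (by omega) (by omega) hz)
  | succ k ih =>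
    intro y V hy hB
    have hy0 : y ≠ 0 := by omega
    have h1 := natAbs_ediv_le hq V
    refine .step (bounded_config hx (by omega) (by omega) hz) ?_
    rw [step_config (st' := .transfer d (residue hq (V + SignType.sign y))) (mv := .stay)
      (a := 0) (b := -SignType.sign y) (c := quotChange (residue hq V) (SignType.sign y)) (d := 0)
      w rfl]
    · rw [ediv_add_quotChange]
      have h2 : ((SignType.sign y : SignType) : ℤ) = y.sign := by
        rcases lt_trichotomy y 0 with h | h | h
        · simp [sign_neg h, Int.sign_eq_neg_one_of_neg h]
        · omega
        · simp [sign_pos h, Int.sign_eq_one_of_pos h]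
      have h3 : y.natAbs = (y + (-SignType.sign y : SignType)).natAbs + 1 ∧
          (V + SignType.sign y).natAbs ≤ V.natAbs + 1 := by
        rcases lt_or_gt_of_ne hy0 with h | h
        · simp [sign_neg h]; omega
        · simp [sign_pos h]; omega
      have h4 := ih (y + (-SignType.sign y : SignType)) (V + SignType.sign y) (by omega) (by omega)
      have h5 : V + (SignType.sign y : ℤ) + (y + ((-SignType.sign y : SignType) : ℤ)) = V + y := by
        cases SignType.sign y <;> simp <;> ring
      rw [h5] at h4
      simpa [OfflineTM.moveInput] using h4
    · simp [machine, hy0, residue_add]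

theorem reachVia_move (w : List BSLetter) (d : D) (x z : ℤ) (h B k : ℕ) (hx : x.natAbs ≤ B)
    (hz : z.natAbs ≤ B) :
    ∀ y u : ℤ, u.natAbs = k → y.natAbs + u.natAbs ≤ B →
      ReachVia ((machine hq δ d₀ acc).step w) (Bounded hq δ d₀ acc B)
        (snapshot hq δ d₀ acc (.move d) h x y u z)
        (snapshot hq δ d₀ acc (.move d) h x (y + u) 0 z) := by
  induction k with
  | zero =>
    intro y u hy hB
    obtain rfl : u = 0 := by omega
    rw [add_zero]
    exact .refl (bounded_config hx (by omega) (by omega) hz)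
  | succ k ih =>
    intro y u hu hB
    have hu0 : u ≠ 0 := by omega
    refine .step (bounded_config hx (by omega) (by omega) hz) ?_
    rw [step_config (st' := .move d) (mv := .stay)
      (a := 0) (b := SignType.sign u) (c := -SignType.sign u) (d := 0) w rfl]
    · have h3 : u.natAbs = (u + (-SignType.sign u : SignType)).natAbs + 1 ∧
          (y + SignType.sign u).natAbs ≤ y.natAbs + 1 := by
        rcases lt_or_gt_of_ne hu0 with h | h
        · simp [sign_neg h]; omega
        · simp [sign_pos h]; omega
      have h4 := ih (y + SignType.sign u) (u + (-SignType.sign u : SignType)) (by omega) (by omega)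
      have h5 : y + (SignType.sign u : ℤ) + (u + ((-SignType.sign u : SignType) : ℤ)) = y + u := by
        cases SignType.sign u <;> simp <;> ring
      rw [h5] at h4
      simpa [OfflineTM.moveInput] using h4
    · simp [machine, hu0]

theorem reachVia_forward (d : D) (b : Bool) (y z : ℤ) (B : ℕ) (hy : y.natAbs ≤ B)
    (hz : z.natAbs ≤ B) (suf : List BSLetter) :
    ∀ (pre : List BSLetter) (x V : ℤ), x.natAbs + suf.length ≤ B → V.natAbs + suf.length ≤ B →
      ReachVia ((machine hq δ d₀ acc).step (pre ++ suf)) (Bounded hq δ d₀ acc B)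
        (snapshot hq δ d₀ acc (.forward d (residue hq V) b) (pre.length + 1) x y (V / q) z)
        (snapshot hq δ d₀ acc (.forward d (residue hq (V + wordCoeff x suf)) b)
          ((pre ++ suf).length + 1) (x + wordHeight suf) y ((V + wordCoeff x suf) / q) z) := by
  induction suf with
  | nil =>
    intro pre x V hx hV
    have := natAbs_ediv_le hq V
    simp only [wordCoeff, wordHeight, add_zero, List.append_nil, List.length_nil] at *
    exact .refl (bounded_config hx hy (by omega) hz)
  | cons l suf ih =>
    intro pre x V hx hV
    simp only [List.length_cons] at hx hV
    have h1 := natAbs_ediv_le hq V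
    refine .step (bounded_config (by omega) hy (by omega) hz) ?_
    set s : SignType := if x = 0 then l.shift else 0 with hs
    rw [step_config (st' := .forward d (residue hq (V + s)) b) (mv := .right)
      (a := l.rise) (b := 0) (c := quotChange (residue hq V) s) (d := 0) _ rfl]
    · rw [ediv_add_quotChange]
      have h2 := SignType.natAbs_coe_le l.rise
      have h3 := SignType.natAbs_coe_le s
      have h4 := ih (pre ++ [l]) (x + l.rise) (V + s) (by omega) (by omega)
      have h5 : V + (s : ℤ) + wordCoeff (x + l.rise) suf = V + wordCoeff x (l :: suf) := by
        rw [wordCoeff, hs]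
        split_ifs <;> simp [add_assoc]
      have h6 : x + (l.rise : ℤ) + wordHeight suf = x + wordHeight (l :: suf) := by
        rw [wordHeight]; ring
      rw [h5, h6] at h4
      have h7 : OfflineTM.moveInput (pre ++ l :: suf).length (pre.length + 1) .right =
          (pre ++ [l]).length + 1 := by
        simp [OfflineTM.moveInput]
      rw [h7]
      simpa using h4
    · rw [inputCell_append_cons]
      simp [machine, residue_add, hs]

theorem reachVia_backward (d : D) (y u z : ℤ) (B : ℕ) (hy : y.natAbs ≤ B) (hu : u.natAbs ≤ B)
    (hz : z.natAbs ≤ B) (pre : List BSLetter) :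
    ∀ (suf : List BSLetter) (x : ℤ), x.natAbs + pre.length ≤ B →
      ReachVia ((machine hq δ d₀ acc).step (pre ++ suf)) (Bounded hq δ d₀ acc B)
        (snapshot hq δ d₀ acc (.backward d) pre.length x y u z)
        (snapshot hq δ d₀ acc (.backward d) 0 (x - wordHeight pre) y u z) := by
  induction pre using List.reverseRecOn with
  | nil =>
    intro suf x hx
    simp only [wordHeight, sub_zero, List.length_nil, add_zero] at *
    exact .refl (bounded_config hx hy hu hz)
  | append_singleton pre l ih =>
    intro suf x hx
    simp only [List.length_append, List.length_singleton] at hx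
    refine .step (bounded_config (by omega) hy hu hz) ?_
    rw [step_config (st' := .backward d) (mv := .left) (a := -l.rise) (b := 0) (c := 0) (d := 0) _
      rfl]
    · have h2 := SignType.natAbs_coe_le (-l.rise)
      have h4 := ih (l :: suf) (x + (-l.rise : SignType)) (by omega)
      have h5 : wordHeight (pre ++ [l]) = wordHeight pre + l.rise := by
        clear ih hx h4
        induction pre with
        | nil => simp [wordHeight]
        | cons l' pre ih => simp only [List.cons_append, wordHeight, ih]; ring
      have h6 : x + ((-l.rise : SignType) : ℤ) - wordHeight pre = x - wordHeight (pre ++ [l]) := by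
        rw [h5]; cases l.rise <;> simp <;> ring
      rw [h6] at h4
      simpa [OfflineTM.moveInput] using h4
    · rw [List.length_append, List.length_singleton, List.append_assoc, List.singleton_append,
        inputCell_append_cons]
      simp [machine]

/-- The machine processes one level. -/
theorem reachVia_level (w : List BSLetter) (d : D) (x y z : ℤ) (B : ℕ) (hz0 : z ≠ 0)
    (hx : x.natAbs + 2 * w.length + 1 ≤ B) (hy : y.natAbs + w.length ≤ B)
    (hz : z.natAbs + 1 ≤ B) :
    ReachVia ((machine hq δ d₀ acc).step w) (Bounded hq δ d₀ acc B)
      (snapshot hq δ d₀ acc (.level d) 0 x y 0 z)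
      (snapshot hq δ d₀ acc (.level (δ d ((y + wordCoeff x w) % q).toNat (decide (x = 0))
        (decide (x + wordHeight w = 0)))) 0 (x - 1) ((y + wordCoeff x w) / q) 0 (z - 1)) := by
  have hh := natAbs_wordHeight_le w
  have hc := natAbs_wordCoeff_le w x
  have hdiv := natAbs_ediv_le hq (y + wordCoeff x w)
  have hdiv' := natAbs_ediv_le hq y
  set d' := δ d ((y + wordCoeff x w) % q).toNat (decide (x = 0))
        (decide (x + wordHeight w = 0)) with hd'
  refine .step (bounded_config (by omega) (by omega) (by omega) (by omega)) ?_
  rw [step_config (st' := .transfer d (residue hq 0)) (mv := .stay) (a := 0) (b := 0) (c := 0)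
    (d := 0) _ rfl (by simp [machine, hz0])]
  refine ReachVia.trans (b := snapshot hq δ d₀ acc (.transfer d (residue hq y)) 0 x 0 (y / q) z) ?_ ?_
  · simpa [OfflineTM.moveInput] using reachVia_transfer (hq := hq) (δ := δ) (d₀ := d₀) (acc := acc)
      w d x z 0 B _ (by omega) (by omega) y 0 rfl (by simp; omega)
  refine .step (bounded_config (by omega) (by omega) (by omega) (by omega)) ?_
  rw [step_config (st' := .forward d (residue hq y) (decide (x = 0))) (mv := .right) (a := 0)
    (b := 0) (c := 0) (d := 0) _ rfl (by simp [machine])]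
  have h1 := reachVia_forward (hq := hq) (δ := δ) (d₀ := d₀) (acc := acc) d (decide (x = 0)) 0 z B
    (by omega) (by omega) w [] x y (by omega) (by omega)
  refine ReachVia.trans (b := snapshot hq δ d₀ acc
    (.forward d (residue hq (y + wordCoeff x w)) (decide (x = 0))) (w.length + 1)
    (x + wordHeight w) 0 ((y + wordCoeff x w) / q) z) ?_ ?_
  · simpa [OfflineTM.moveInput] using h1
  refine .step (bounded_config (by omega) (by omega) (by omega) (by omega)) ?_
  rw [step_config (st' := .backward d') (mv := .left) (a := 0)
    (b := 0) (c := 0) (d := 0) _ rfl (by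
      rw [inputCell_end]
      simp [machine, hd', residue])]
  have h2 := reachVia_backward (hq := hq) (δ := δ) (d₀ := d₀) (acc := acc) d' 0
    ((y + wordCoeff x w) / q) z B (by omega) (by omega) (by omega) w [] (x + wordHeight w) (by omega)
  refine ReachVia.trans (b := snapshot hq δ d₀ acc (.backward d') 0 x 0
    ((y + wordCoeff x w) / q) z) ?_ ?_
  · simpa [OfflineTM.moveInput] using h2
  refine .step (bounded_config (by omega) (by omega) (by omega) (by omega)) ?_
  rw [step_config (st' := .move d') (mv := .stay) (a := 0)
    (b := 0) (c := 0) (d := 0) _ rfl (by simp [machine, OfflineTM.inputCell])]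
  have h3 := reachVia_move (hq := hq) (δ := δ) (d₀ := d₀) (acc := acc) w d' x z 0 B _
    (by omega) (by omega) 0 ((y + wordCoeff x w) / q) rfl (by simp only [Int.natAbs_zero]; omega)
  refine ReachVia.trans (b := snapshot hq δ d₀ acc (.move d') 0 x
    ((y + wordCoeff x w) / q) 0 z) ?_ ?_
  · simpa [OfflineTM.moveInput] using h3
  refine .single (bounded_config (by omega) (by omega) (by omega) (by omega)) ?_
    (bounded_config (by omega) (by omega) (by omega) (by omega))
  rw [step_config (st' := .level d') (mv := .stay) (a := -1)
    (b := 0) (c := 0) (d := -1) _ rfl (by simp [machine])]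
  simp [OfflineTM.moveInput, sub_eq_add_neg]

theorem reachVia_count (B : ℕ) (suf : List BSLetter) :
    ∀ (pre : List BSLetter) (x z : ℤ), x.natAbs + suf.length ≤ B → z.natAbs + 3 * suf.length ≤ B →
      ReachVia ((machine hq δ d₀ acc).step (pre ++ suf)) (Bounded hq δ d₀ acc B)
        (snapshot hq δ d₀ acc (.count 0) (pre.length + 1) x 0 0 z)
        (snapshot hq δ d₀ acc (.count 0) ((pre ++ suf).length + 1) (x + suf.length) 0 0
          (z + 3 * suf.length)) := by
  induction suf with
  | nil =>
    intro pre x z hx hz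
    simp only [List.append_nil, List.length_nil, Nat.cast_zero, mul_zero, add_zero] at *
    exact .refl (bounded_config hx (by simp) (by simp) hz)
  | cons l suf ih =>
    intro pre x z hx hz
    simp only [List.length_cons] at hx hz
    refine .step (bounded_config (by omega) (by simp) (by simp) (by omega)) ?_
    rw [step_config (st' := .count 1) (mv := .stay) (a := 1) (b := 0) (c := 0) (d := 1) _ rfl
      (by rw [inputCell_append_cons]; simp [machine])]
    simp only [SignType.coe_one, SignType.coe_zero, add_zero, OfflineTM.moveInput]
    refine .step (bounded_config (by omega) (by simp) (by simp) (by omega)) ?_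
    rw [step_config (st' := .count 2) (mv := .stay) (a := 0) (b := 0) (c := 0) (d := 1) _ rfl
      (by rw [inputCell_append_cons]; simp [machine])]
    simp only [SignType.coe_one, SignType.coe_zero, add_zero, OfflineTM.moveInput]
    refine .step (bounded_config (by omega) (by simp) (by simp) (by omega)) ?_
    rw [step_config (st' := .count 0) (mv := .right) (a := 0) (b := 0) (c := 0) (d := 1) _ rfl
      (by rw [inputCell_append_cons]; simp [machine])]
    have h4 := ih (pre ++ [l]) (x + 1) (z + 1 + 1 + 1) (by omega) (by omega)
    have h7 : OfflineTM.moveInput (pre ++ l :: suf).length (pre.length + 1) .right =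
        (pre ++ [l]).length + 1 := by
      simp [OfflineTM.moveInput]
    have h8 : x + 1 + (suf.length : ℤ) = x + ((l :: suf).length : ℤ) := by
      push_cast [List.length_cons]; ring
    have h9 : z + 1 + 1 + 1 + 3 * (suf.length : ℤ) = z + 3 * ((l :: suf).length : ℤ) := by
      push_cast [List.length_cons]; ring
    rw [h7]
    rw [h8, h9] at h4
    simpa using h4

theorem reachVia_rewind (w : List BSLetter) (x y u z : ℤ) (B : ℕ) (hx : x.natAbs ≤ B)
    (hy : y.natAbs ≤ B) (hu : u.natAbs ≤ B) (hz : z.natAbs ≤ B) (h : ℕ) :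
    ReachVia ((machine hq δ d₀ acc).step w) (Bounded hq δ d₀ acc B)
      (snapshot hq δ d₀ acc .rewind h x y u z) (snapshot hq δ d₀ acc (.level d₀) 0 x y u z) := by
  induction h with
  | zero =>
    refine .single (bounded_config hx hy hu hz) ?_ (bounded_config hx hy hu hz)
    rw [step_config (st' := .level d₀) (mv := .stay) (a := 0) (b := 0) (c := 0) (d := 0) _ rfl
      (by simp [machine, OfflineTM.inputCell])]
    simp [OfflineTM.moveInput]
  | succ h ih =>
    refine .step (bounded_config hx hy hu hz) ?_
    rw [step_config (st' := .rewind) (mv := .left) (a := 0) (b := 0) (c := 0) (d := 0) _ rfl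
      (by
        simp only [OfflineTM.inputCell, machine]
        cases w[h]? <;> rfl)]
    simpa [OfflineTM.moveInput] using ih

end

/-- Carry and coefficient are both at most n in absolute value, and division by q ≥ 2 brings their
sum back to at most n. -/
theorem natAbs_digitRun_le (hq : 2 ≤ q) (δ : D → ℕ → Bool → Bool → D) (d₀ : D)
    (w : List BSLetter) (j : ℕ) : (digitRun q δ d₀ w j).2.natAbs ≤ w.length := by
  induction j with
  | zero => simp [digitRun]
  | succ j ih =>
    simp only [digitRun]
    have h1 := natAbs_wordCoeff_le w (w.length - j)
    generalize (digitRun q δ d₀ w j).2 = k at *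
    generalize wordCoeff (w.length - j) w = c at *
    have hq' : (0 : ℤ) < q := by omega
    have h2 : -(w.length : ℤ) ≤ (k + c) / q := by
      rw [Int.le_ediv_iff_mul_le hq']
      have : (w.length : ℤ) * 2 ≤ w.length * q := by gcongr; exact_mod_cast hq
      rw [neg_mul]
      omega
    have h3 : (k + c) / q ≤ w.length := by
      rw [← Int.lt_add_one_iff, Int.ediv_lt_iff_lt_mul hq']
      have : (w.length : ℤ) * 2 ≤ w.length * q := by gcongr; exact_mod_cast hq
      rw [add_mul]
      omega
    omega

end DigitMachine

open DigitMachine in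
/-- A language is in logarithmic space if membership of a word is decided by a finite automaton
that reads the digits of the number with coefficients `wordCoeff`. -/
theorem inLogSpace_digitRun {D : Type} [Finite D] {q : ℕ} (hq : 2 ≤ q)
    (δ : D → ℕ → Bool → Bool → D) (d₀ : D) (acc : D → Bool → Bool) :
    InLogSpace {w : List BSLetter |
      acc (digitRun q δ d₀ w (3 * w.length + 1)).1
        (decide ((digitRun q δ d₀ w (3 * w.length + 1)).2 < 0)) = true} := by
  -- The factor 6 is generous: counter 0 stays within 2n + 1 apart from the at most n added during a
  -- scan, and counter 3 starts its descent at 3n + 1.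
  refine CounterMachine.inLogSpace (machine hq δ d₀ acc) _ 6 fun w => ?_
  set n := w.length with hn
  set r := digitRun q δ d₀ w with hr
  have hk : ∀ j, (r j).2.natAbs ≤ n := natAbs_digitRun_le hq δ d₀ w
  have hloop : ∀ j ≤ 3 * n + 1, ReachVia ((machine hq δ d₀ acc).step w)
      (Bounded hq δ d₀ acc (6 * (n + 1)))
      (snapshot hq δ d₀ acc (.level d₀) 0 n 0 0 (3 * n + 1))
      (snapshot hq δ d₀ acc (.level (r j).1) 0 (n - j) (r j).2 0 (3 * n + 1 - j)) := by
    intro j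
    induction j with
    | zero =>
      intro _
      simp only [hr, digitRun, Nat.cast_zero, sub_zero]
      exact .refl (bounded_config (by omega) (by omega) (by omega) (by omega))
    | succ j ih =>
      intro hj
      refine (ih (by omega)).trans ?_
      have h1 := hk j
      have h2 := reachVia_level (hq := hq) (δ := δ) (d₀ := d₀) (acc := acc) w (r j).1 (n - j)
        (r j).2 (3 * n + 1 - j) (6 * (n + 1)) (by omega) (by omega) (by omega) (by omega)
      have h3 : (n : ℤ) - j - 1 = n - (j + 1 : ℕ) := by push_cast; ring
      have h4 : (3 * n + 1 : ℤ) - j - 1 = 3 * n + 1 - (j + 1 : ℕ) := by push_cast; ring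
      rw [h3, h4] at h2
      exact h2
  refine ⟨snapshot hq δ d₀ acc (.halt (acc (r (3 * n + 1)).1 (decide ((r (3 * n + 1)).2 < 0)))) 0
    (n - (3 * n + 1 : ℕ)) (r (3 * n + 1)).2 0 0, _, ?_, rfl, by simp [hr, hn]⟩
  have hinit : (machine hq δ d₀ acc).init = snapshot hq δ d₀ acc .start 0 0 0 0 0 := by
    simp only [CounterMachine.init, snapshot]
    congr 1
    funext i
    fin_cases i <;> rfl
  rw [hinit]
  change ReachVia _ (Bounded hq δ d₀ acc (6 * (n + 1))) _ _
  refine .step (bounded_config (by simp) (by simp) (by simp) (by simp)) ?_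
  rw [step_config (st' := .count 0) (mv := .right) (a := 0) (b := 0) (c := 0) (d := 1) _ rfl
    (by simp [machine])]
  have h1 := reachVia_count (hq := hq) (δ := δ) (d₀ := d₀) (acc := acc) (6 * (n + 1)) w [] 0 1
    (by simp; omega) (by simp; omega)
  refine ReachVia.trans (b := snapshot hq δ d₀ acc (.count 0) (n + 1) n 0 0 (3 * n + 1)) ?_ ?_
  · simpa [OfflineTM.moveInput, add_comm] using h1
  refine .step (bounded_config (by omega) (by simp) (by simp) (by omega)) ?_
  rw [step_config (st' := .rewind) (mv := .left) (a := 0) (b := 0) (c := 0) (d := 0) _ rfl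
    (by rw [hn, inputCell_end]; simp [machine])]
  simp only [SignType.coe_zero, add_zero]
  refine (reachVia_rewind w _ _ _ _ _ (by omega) (by omega) (by omega) (by omega) _).trans ?_
  refine (hloop _ le_rfl).trans ?_
  have h2 := hk (3 * n + 1)
  have hz : (3 * n + 1 : ℤ) - (3 * n + 1 : ℕ) = 0 := by push_cast; ring
  rw [hz]
  refine .single (bounded_config (by omega) (by omega) (by omega) (by omega)) ?_
    (bounded_config (by omega) (by omega) (by omega) (by omega))
  rw [step_config (st' := .halt (acc (r (3 * n + 1)).1 (decide ((r (3 * n + 1)).2 < 0))))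
    (mv := .stay) (a := 0) (b := 0) (c := 0) (d := 0) _ rfl (by
      simp [machine, sign_eq_neg_one_iff])]
  simp [OfflineTM.moveInput]

/-! ### Translating membership into walks with a prescribed value. -/

/-! ### The affine action of `BS(1, q)` on the rationals -/

/-- The rational number denoted by a word that is started at height `h`: the sum of the terms
`± q ^ i` over its letters `a ^ (± 1)`, where `i` is the height of the letter. -/
noncomputable def wordVal (q : ℕ) : ℤ → List BSLetter → ℚ
  | _, [] => 0
  | h, l :: w => ((l.shift : ℤ) : ℚ) * (q : ℚ) ^ h + wordVal q (h + l.rise) w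

namespace BS

variable {q : ℕ}

/-- The images of the generators under the affine action. -/
noncomputable def affineGen (hq : 2 ≤ q) : BSGen → Equiv.Perm ℚ
  | .a => Equiv.addRight 1
  | .t => Equiv.mulLeft₀ (q : ℚ) (by positivity)

theorem affineGen_a_pow (hq : 2 ≤ q) (n : ℕ) (x : ℚ) : (affineGen hq .a ^ n) x = x + n := by
  induction n generalizing x with
  | zero => simp
  | succ n ih => rw [pow_succ, Equiv.Perm.mul_apply, ih]; simp [affineGen]; ring

/-- The action of `BS(1, q)` on `ℚ` in which `a` adds one and `t` multiplies by `q`. -/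
noncomputable def affineHom (hq : 2 ≤ q) : BS 1 q →* Equiv.Perm ℚ :=
  PresentedGroup.toGroup (f := affineGen hq) (by
    rintro r rfl
    have hq0 : (q : ℚ) ≠ 0 := by positivity
    simp only [bsRelator, map_mul, map_inv, map_pow, FreeGroup.lift_apply_of]
    rw [mul_inv_eq_one]
    ext x
    rw [affineGen_a_pow]
    simp [affineGen, Equiv.Perm.mul_apply, Equiv.Perm.inv_def, mul_add, hq0])

/-- The factor q^h stands for a prefix of height h that has already been read; it makes the
induction along a word run from left to right although the leftmost map is applied last. -/
theorem affineHom_letter (hq : 2 ≤ q) (l : BSLetter) (h : ℤ) (x : ℚ) :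
    (q : ℚ) ^ h * affineHom hq (l.toGroup 1 q) x =
      (q : ℚ) ^ (h + l.rise) * x + ((l.shift : ℤ) : ℚ) * (q : ℚ) ^ h := by
  have hq0 : (q : ℚ) ≠ 0 := by positivity
  cases l <;> simp [BSLetter.toGroup, affineHom, affineGen, BSLetter.rise, BSLetter.shift,
    Equiv.Perm.inv_def, zpow_add₀ hq0]
  · ring
  · ring
  · ring
  · ring

theorem affineHom_ofWord (hq : 2 ≤ q) (w : List BSLetter) (h : ℤ) (x : ℚ) :
    (q : ℚ) ^ h * affineHom hq (ofWord 1 q w) x =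
      (q : ℚ) ^ (h + wordHeight w) * x + wordVal q h w := by
  induction w generalizing h with
  | nil => simp [ofWord, wordHeight, wordVal]
  | cons l w ih =>
    have h1 : ofWord 1 q (l :: w) = l.toGroup 1 q * ofWord 1 q w := by simp [ofWord]
    rw [h1, map_mul, Equiv.Perm.mul_apply, affineHom_letter, ih, wordHeight, wordVal]
    rw [add_assoc h]
    ring

theorem ofWord_surjective (g : BS 1 q) : ∃ w, ofWord 1 q w = g := by
  induction g using PresentedGroup.induction_on with
  | _ z =>
    induction z using FreeGroup.induction_on with
    | C1 => exact ⟨[], by simp [ofWord]⟩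
    | of x =>
      cases x with
      | a => exact ⟨[.a], by simp [ofWord, BSLetter.toGroup]; rfl⟩
      | t => exact ⟨[.t], by simp [ofWord, BSLetter.toGroup]; rfl⟩
    | inv_of x _ =>
      cases x with
      | a => exact ⟨[.aInv], by simp [ofWord, BSLetter.toGroup]; rfl⟩
      | t => exact ⟨[.tInv], by simp [ofWord, BSLetter.toGroup]; rfl⟩
    | mul x y hx hy =>
      obtain ⟨u, hu⟩ := hx
      obtain ⟨v, hv⟩ := hy
      refine ⟨u ++ v, ?_⟩
      rw [map_mul, ← hu, ← hv]
      simp [ofWord]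

theorem t_mul_a_zpow (k : ℤ) :
    (PresentedGroup.of BSGen.t : BS 1 q) * (PresentedGroup.of BSGen.a : BS 1 q) ^ k =
      (PresentedGroup.of BSGen.a : BS 1 q) ^ (q * k) * PresentedGroup.of BSGen.t := by
  have h : PresentedGroup.mk ({bsRelator 1 q} : Set (FreeGroup BSGen)) (bsRelator 1 q) = 1 :=
    PresentedGroup.one_of_mem (Set.mem_singleton _)
  have h1 : (PresentedGroup.of BSGen.t : BS 1 q) * (PresentedGroup.of BSGen.a : BS 1 q) *
      (PresentedGroup.of BSGen.t : BS 1 q)⁻¹ = (PresentedGroup.of BSGen.a : BS 1 q) ^ q := by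
    rw [← mul_inv_eq_one, ← h]
    simp only [bsRelator, pow_one]
    rfl
  have h2 := congrArg (· ^ k) h1
  simp only [conj_zpow] at h2
  rw [zpow_mul, zpow_natCast, ← h2]
  group

theorem t_pow_mul_a_zpow (j : ℕ) (k : ℤ) :
    (PresentedGroup.of BSGen.t : BS 1 q) ^ j * (PresentedGroup.of BSGen.a : BS 1 q) ^ k =
      (PresentedGroup.of BSGen.a : BS 1 q) ^ (q ^ j * k) * PresentedGroup.of BSGen.t ^ j := by
  induction j generalizing k with
  | zero => simp
  | succ j ih =>
    rw [pow_succ, mul_assoc, t_mul_a_zpow, ← mul_assoc, ih, mul_assoc, ← pow_succ]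
    congr 2
    ring

/-- Left multiplication by a power of `t` clears denominators. When a letter `t⁻¹` is appended, it
cancels against `t ^ j`, or for j = 0 one more `t` on the left turns it into a conjugation of `a ^
k`. -/
theorem exists_normalForm (g : BS 1 q) : ∃ (i j : ℕ) (k : ℤ),
    PresentedGroup.of BSGen.t ^ i * g =
      (PresentedGroup.of BSGen.a : BS 1 q) ^ k * PresentedGroup.of BSGen.t ^ j := by
  obtain ⟨w, rfl⟩ := ofWord_surjective g
  induction w using List.reverseRecOn with
  | nil => exact ⟨0, 0, 0, by simp [ofWord]⟩
  | append_singleton w l ih =>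
    obtain ⟨i, j, k, h⟩ := ih
    have h1 : ofWord 1 q (w ++ [l]) = ofWord 1 q w * l.toGroup 1 q := by simp [ofWord]
    rw [h1]
    set T : BS 1 q := PresentedGroup.of BSGen.t with hT
    set A : BS 1 q := PresentedGroup.of BSGen.a with hA
    cases l with
    | a =>
      refine ⟨i, j, k + q ^ j, ?_⟩
      have h2 := t_pow_mul_a_zpow (q := q) j 1
      rw [zpow_one, mul_one] at h2
      rw [← mul_assoc, h, mul_assoc, BSLetter.toGroup, h2, zpow_add, mul_assoc]
    | aInv =>
      refine ⟨i, j, k - q ^ j, ?_⟩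
      have h2 := t_pow_mul_a_zpow (q := q) j (-1)
      rw [zpow_neg, zpow_one, mul_neg, mul_one] at h2
      rw [← mul_assoc, h, mul_assoc, BSLetter.toGroup, h2, sub_eq_add_neg, zpow_add, mul_assoc]
    | t => exact ⟨i, j + 1, k, by rw [← mul_assoc, h, mul_assoc, BSLetter.toGroup, pow_succ]⟩
    | tInv =>
      cases j with
      | zero =>
        refine ⟨i + 1, 0, q * k, ?_⟩
        rw [pow_succ', mul_assoc, ← mul_assoc (T ^ i), h, BSLetter.toGroup, pow_zero, mul_one,
          ← mul_assoc, t_mul_a_zpow, mul_inv_cancel_right, mul_one]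
      | succ j =>
        refine ⟨i, j, k, ?_⟩
        rw [← mul_assoc, h, mul_assoc, BSLetter.toGroup, pow_succ, mul_inv_cancel_right]

theorem affineHom_t_pow (hq : 2 ≤ q) (j : ℕ) (x : ℚ) :
    affineHom hq (PresentedGroup.of BSGen.t ^ j) x = (q : ℚ) ^ j * x := by
  induction j with
  | zero => simp
  | succ j ih =>
    rw [pow_succ', map_mul, Equiv.Perm.mul_apply, ih]
    simp [affineHom, affineGen, pow_succ']
    ring

theorem affineHom_a_zpow (hq : 2 ≤ q) (k : ℤ) (x : ℚ) :
    affineHom hq (PresentedGroup.of BSGen.a ^ k) x = x + k := by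
  have h1 : affineHom hq (PresentedGroup.of BSGen.a) = affineGen hq .a := by simp [affineHom]
  rw [map_zpow, h1]
  cases k with
  | ofNat n => simpa using affineGen_a_pow hq n x
  | negSucc n =>
    rw [zpow_negSucc, Equiv.Perm.inv_def, Equiv.symm_apply_eq, affineGen_a_pow]
    simp [Int.negSucc_eq]
    ring

/-- For an element of the kernel, the normal form evaluated at 0 forces k = 0, and then at 1 it
forces i = j. -/
theorem affineHom_injective (hq : 2 ≤ q) : Function.Injective (affineHom hq) := by
  rw [injective_iff_map_eq_one]
  intro g hg
  obtain ⟨i, j, k, h⟩ := exists_normalForm g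
  have h1 : ∀ x : ℚ, (q : ℚ) ^ i * x = (q : ℚ) ^ j * x + k := fun x => by
    have := congrArg (fun y => affineHom hq y x) h
    simpa only [map_mul, hg, mul_one, Equiv.Perm.mul_apply, affineHom_t_pow,
      affineHom_a_zpow] using this
  have hk : k = 0 := by have := h1 0; simpa using this.symm
  have hij : i = j := by
    have := h1 1
    rw [hk] at this
    have h2 : q ^ i = q ^ j := by exact_mod_cast (by simpa using this : (q : ℚ) ^ i = (q : ℚ) ^ j)
    exact Nat.pow_right_injective hq h2
  subst hk hij
  simpa using h

theorem eq_iff_affineHom (hq : 2 ≤ q) {g g' : BS 1 q} {m m' : ℤ} {r r' : ℚ}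
    (hg : ∀ x, affineHom hq g x = (q : ℚ) ^ m * x + r)
    (hg' : ∀ x, affineHom hq g' x = (q : ℚ) ^ m' * x + r') : g = g' ↔ m = m' ∧ r = r' := by
  constructor
  · rintro rfl
    have h0 : r = r' := by have := (hg 0).symm.trans (hg' 0); simpa using this
    have h1 := (hg 1).symm.trans (hg' 1)
    rw [h0, add_left_inj, mul_one, mul_one] at h1
    refine ⟨?_, h0⟩
    exact zpow_right_injective₀ (by positivity) (by norm_cast; omega) h1
  · rintro ⟨rfl, rfl⟩
    apply affineHom_injective hq
    ext x
    rw [hg, hg']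

end BS

/-! ### Walks in leveled graphs -/

/-- A graph whose vertices are pairs of a state and a level. An edge stays on its level, where it
contributes a value, or leads one level up or down. -/
structure LevelNet (Q : Type) where
  -- The dependence on the level serves only the extended graph `ext`, where the levels of the two
  -- ends are special.
  flat : ℤ → Q → ℤ → Q → Prop
  up : Q → Q → Prop
  down : Q → Q → Prop

namespace LevelNet

variable {Q : Type} (N : LevelNet Q)

/-- The edges, with source, value and target. -/
def Edge (p : Q) (h v : ℤ) (r : Q) (h' : ℤ) : Prop :=
  (h' = h ∧ N.flat h p v r) ∨ (h' = h + 1 ∧ v = 0 ∧ N.up p r) ∨ (h' = h - 1 ∧ v = 0 ∧ N.down p r)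

/-- Walks, with the multiset of the sources and values of their edges. -/
inductive Walk : Q → ℤ → Q → ℤ → Multiset (Q × ℤ × ℤ) → Prop
  | nil (p : Q) (h : ℤ) : Walk p h p h 0
  | cons {p : Q} {h v : ℤ} {p' : Q} {h' : ℤ} {p'' : Q} {h'' : ℤ} {μ : Multiset (Q × ℤ × ℤ)} :
      N.Edge p h v p' h' → Walk p' h' p'' h'' μ → Walk p h p'' h'' ((p, h, v) ::ₘ μ)

/-- The value of a multiset of edges. -/
noncomputable def val (q : ℕ) (μ : Multiset (Q × ℤ × ℤ)) : ℚ :=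
  (μ.map fun e => (e.2.2 : ℚ) * (q : ℚ) ^ e.2.1).sum

@[simp] theorem val_zero (q : ℕ) : val q (0 : Multiset (Q × ℤ × ℤ)) = 0 := by simp [val]

@[simp] theorem val_cons (q : ℕ) (e : Q × ℤ × ℤ) (μ : Multiset (Q × ℤ × ℤ)) :
    val q (e ::ₘ μ) = (e.2.2 : ℚ) * (q : ℚ) ^ e.2.1 + val q μ := by simp [val]

@[simp] theorem val_add (q : ℕ) (μ ν : Multiset (Q × ℤ × ℤ)) :
    val q (μ + ν) = val q μ + val q ν := by simp [val]

variable {N}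

theorem Walk.trans {p p' p'' : Q} {h h' h'' : ℤ} {μ ν : Multiset (Q × ℤ × ℤ)}
    (hw : N.Walk p h p' h' μ) (hw' : N.Walk p' h' p'' h'' ν) : N.Walk p h p'' h'' (μ + ν) := by
  induction hw with
  | nil => simpa using hw'
  | cons he _ ih => rw [Multiset.cons_add]; exact .cons he (ih hw')

theorem Walk.single {p p' : Q} {h h' v : ℤ} (he : N.Edge p h v p' h') :
    N.Walk p h p' h' {(p, h, v)} := .cons he (.nil _ _)

end LevelNet

/-! ### Automata over `BS(1, q)` as leveled graphs -/

instance : Finite BSLetter := by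
  refine Finite.of_surjective (fun i : Fin 4 => ![BSLetter.a, .aInv, .t, .tInv] i) fun x => ?_
  cases x
  exacts [⟨0, rfl⟩, ⟨1, rfl⟩, ⟨2, rfl⟩, ⟨3, rfl⟩]

namespace MonoidAutomaton

open LevelNet BS

variable {q : ℕ} {S : Set (BS 1 q)} (A : MonoidAutomaton (BS 1 q) S) (word : S → List BSLetter)
  (K : ℕ)

/-- States of an automaton with a buffer for a word of length at most `K`. -/
abbrev BufferState : Type := A.State × {u : List BSLetter // u.length ≤ K}

/-- The leveled graph in which an edge of the automaton fills the buffer with a word for its label,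
and the letters in the buffer are read one by one. -/
def toLevelNet : LevelNet (A.BufferState K) where
  flat _ x v y :=
    (v = 0 ∧ x.2.1 = [] ∧ ∃ s, (x.1, s, y.1) ∈ A.edges ∧ word s = y.2.1) ∨
      (x.1 = y.1 ∧ ∃ l : BSLetter, x.2.1 = l :: y.2.1 ∧ l.rise = 0 ∧ v = l.shift)
  up x y := x.1 = y.1 ∧ x.2.1 = .t :: y.2.1
  down x y := x.1 = y.1 ∧ x.2.1 = .tInv :: y.2.1

variable {A word K}

theorem walk_of_buffer (p : A.State) (u : List BSLetter) (hu : u.length ≤ K) (h : ℤ) :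
    ∃ μ, (A.toLevelNet word K).Walk (p, ⟨u, hu⟩) h (p, ⟨[], by simp⟩) (h + wordHeight u) μ ∧
      val q μ = wordVal q h u := by
  induction u generalizing h with
  | nil => exact ⟨0, by rw [wordHeight, add_zero]; exact .nil _ _, by simp [wordVal]⟩
  | cons l u ih =>
    obtain ⟨μ, hμ, hv⟩ := ih ((Nat.le_succ _).trans hu) (h + l.rise)
    rw [add_assoc] at hμ
    refine ⟨((p, ⟨l :: u, hu⟩), h, (l.shift : ℤ)) ::ₘ μ, .cons ?_ hμ, by simp [wordVal, hv]⟩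
    cases l with
    | a => exact .inl ⟨by simp [BSLetter.rise], .inr ⟨rfl, .a, rfl, rfl, rfl⟩⟩
    | aInv => exact .inl ⟨by simp [BSLetter.rise], .inr ⟨rfl, .aInv, rfl, rfl, rfl⟩⟩
    | t => exact .inr (.inl ⟨by simp [BSLetter.rise], by simp [BSLetter.shift], rfl, rfl⟩)
    | tInv =>
      exact .inr (.inr ⟨by simp [BSLetter.rise, sub_eq_add_neg], by simp [BSLetter.shift], rfl, rfl⟩)

theorem walk_of_isRun (hq : 2 ≤ q) (hword : ∀ s, ofWord 1 q (word s) = s)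
    (hK : ∀ s, (word s).length ≤ K) (ρ : List (A.State × S × A.State)) (p p' : A.State)
    (hρ : A.IsRun p ρ p') (h : ℤ) :
    ∃ h' μ, (A.toLevelNet word K).Walk (p, ⟨[], by simp⟩) h (p', ⟨[], by simp⟩) h' μ ∧
      ∀ x, (q : ℚ) ^ h * affineHom hq (A.production ρ) x = (q : ℚ) ^ h' * x + val q μ := by
  induction ρ generalizing p h with
  | nil =>
    obtain rfl : p = p' := hρ
    exact ⟨h, 0, .nil _ _, fun x => by simp [production]⟩
  | cons e ρ ih =>
    obtain ⟨he, rfl, hρ⟩ := hρ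
    obtain ⟨μ₁, hμ₁, hv₁⟩ := walk_of_buffer (word := word) e.2.2 (word e.2.1) (hK _) h
    obtain ⟨h', μ₂, hμ₂, hv₂⟩ := ih e.2.2 hρ (h + wordHeight (word e.2.1))
    refine ⟨h', _, .cons (v := 0) (.inl ⟨rfl, .inl ⟨rfl, rfl, e.2.1, he, rfl⟩⟩) (hμ₁.trans hμ₂),
      fun x => ?_⟩
    have h1 : A.production (e :: ρ) = ofWord 1 q (word e.2.1) * A.production ρ := by
      rw [hword]; simp [production]
    rw [h1, map_mul, Equiv.Perm.mul_apply, affineHom_ofWord, hv₂]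
    simp [hv₁]
    ring

/-- The letters still in the buffer of `X` belong to an edge whose label was chosen before the walk
starts; they enter as the factor in front of the production. -/
theorem isRun_of_walk (hq : 2 ≤ q) (hword : ∀ s, ofWord 1 q (word s) = s)
    {X Y : A.BufferState K} {h h' : ℤ} {μ : Multiset (A.BufferState K × ℤ × ℤ)}
    (hw : (A.toLevelNet word K).Walk X h Y h' μ) (hY : Y.2.1 = []) :
    ∃ ρ, A.IsRun X.1 ρ Y.1 ∧ ∀ x, (q : ℚ) ^ h *
      affineHom hq (ofWord 1 q X.2.1 * A.production ρ) x = (q : ℚ) ^ h' * x + val q μ := by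
  induction hw with
  | nil p h => exact ⟨[], rfl, fun x => by simp [hY, ofWord, production]⟩
  | @cons X h v Z h₁ Y h' μ he _ ih =>
    obtain ⟨ρ, hρ, hv⟩ := ih hY
    have hletter : ∀ l : BSLetter, X.1 = Z.1 → X.2.1 = l :: Z.2.1 → h₁ = h + l.rise →
        v = l.shift → ∃ ρ, A.IsRun X.1 ρ Y.1 ∧ ∀ x, (q : ℚ) ^ h *
          affineHom hq (ofWord 1 q X.2.1 * A.production ρ) x =
            (q : ℚ) ^ h' * x + val q ((X, h, v) ::ₘ μ) := by
      rintro l h1 h2 rfl rfl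
      refine ⟨ρ, h1 ▸ hρ, fun x => ?_⟩
      have h3 : ofWord 1 q X.2.1 = l.toGroup 1 q * ofWord 1 q Z.2.1 := by simp [h2, ofWord]
      rw [h3, mul_assoc, map_mul, Equiv.Perm.mul_apply, affineHom_letter, hv]
      simp
      ring
    rcases he with ⟨rfl, ⟨rfl, h1, s, h2, h3⟩ | ⟨h1, l, h2, h3, h4⟩⟩ | ⟨rfl, rfl, h1, h2⟩ |
      ⟨rfl, rfl, h1, h2⟩
    · refine ⟨(X.1, s, Z.1) :: ρ, ⟨h2, rfl, hρ⟩, fun x => ?_⟩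
      have h4 : A.production ((X.1, s, Z.1) :: ρ) = ofWord 1 q Z.2.1 * A.production ρ := by
        rw [← h3, hword]; simp [production]
      rw [h4, h1, show ofWord 1 q [] = 1 by simp [ofWord], one_mul, hv]
      simp
    · exact hletter l h1 h2 (by simp [h3]) h4
    · exact hletter .t h1 h2 (by simp [BSLetter.rise]) (by simp [BSLetter.shift])
    · exact hletter .tInv h1 h2 (by simp [BSLetter.rise, sub_eq_add_neg]) (by simp [BSLetter.shift])

end MonoidAutomaton

open LevelNet in
/-- Rational subsets of `BS(1, q)` are described by walks in a homogeneous leveled graph. -/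
theorem IsRationalSubset.exists_levelNet {q : ℕ} (hq : 2 ≤ q) {R : Set (BS 1 q)}
    (hR : IsRationalSubset R) :
    ∃ (Q : Type) (_ : Finite Q) (N : LevelNet Q) (s f : Q),
      (∀ h h', N.flat h = N.flat h') ∧ (∀ h p v p', N.flat h p v p' → v.natAbs ≤ 1) ∧
      ∀ w : List BSLetter, BS.ofWord 1 q w ∈ R ↔
        ∃ μ, N.Walk s 0 f (wordHeight w) μ ∧ val q μ = wordVal q 0 w := by
  obtain ⟨S, hS, -, A, rfl⟩ := hR
  have := hS.to_subtype
  choose word hword using fun s : S => BS.ofWord_surjective (s : BS 1 q)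
  obtain ⟨K, hK⟩ : ∃ K, ∀ s, (word s).length ≤ K := by
    obtain ⟨K, hK⟩ := (Set.finite_range fun s => (word s).length).bddAbove
    exact ⟨K, fun s => hK ⟨s, rfl⟩⟩
  have hfin : Finite {u : List BSLetter // u.length ≤ K} :=
    (List.finite_length_le BSLetter K).to_subtype
  have := A.finite_state
  refine ⟨A.BufferState K, inferInstance, A.toLevelNet word K, (A.start, ⟨[], by simp⟩),
    (A.final, ⟨[], by simp⟩), fun _ _ => rfl, ?_, fun w => ?_⟩
  · rintro h p v p' (⟨rfl, -⟩ | ⟨-, l, -, -, rfl⟩)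
    · simp
    · exact SignType.natAbs_coe_le _
  · have hw : ∀ x, BS.affineHom hq (BS.ofWord 1 q w) x =
        (q : ℚ) ^ wordHeight w * x + wordVal q 0 w := fun x => by
      simpa using BS.affineHom_ofWord hq w 0 x
    constructor
    · rintro ⟨ρ, hρ, hprod⟩
      obtain ⟨h', μ, hμ, hv⟩ := MonoidAutomaton.walk_of_isRun hq hword hK ρ _ _ hρ 0
      obtain ⟨rfl, h2⟩ := (BS.eq_iff_affineHom hq (fun x => by simpa using hv x) hw).mp hprod
      exact ⟨μ, hμ, h2⟩
    · rintro ⟨μ, hμ, hv⟩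
      obtain ⟨ρ, hρ, h1⟩ := MonoidAutomaton.isRun_of_walk hq hword hμ rfl
      refine ⟨ρ, hρ, (BS.eq_iff_affineHom hq (m := wordHeight w) (r := val q μ) (fun x => ?_)
        hw).mpr ⟨rfl, hv⟩⟩
      simpa [BS.ofWord] using h1 x

/-! ### Closed walks: bounded expansions of their values, and their removal. -/

/-! ### Submonoids of the integers -/

theorem AddSubmonoid.fg_of_forall_nonneg (M : AddSubmonoid ℤ) (hM : ∀ x ∈ M, 0 ≤ x) : M.FG := by
  have h := (Nat.addSubmonoid_fg (M.comap (Nat.castAddMonoidHom ℤ))).map (Nat.castAddMonoidHom ℤ)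
  have h1 : (M.comap (Nat.castAddMonoidHom ℤ)).map (Nat.castAddMonoidHom ℤ) = M := by
    ext x
    constructor
    · rintro ⟨n, hn, rfl⟩
      exact hn
    · intro hx
      refine ⟨x.toNat, ?_, ?_⟩
      · simpa [Int.toNat_of_nonneg (hM x hx)] using hx
      · simpa using hM x hx
  rwa [h1] at h

/-- If all elements have one sign, this is a statement about submonoids of ℕ. With elements of both
signs the submonoid is a group, generated as a monoid by some g and -g. -/
theorem AddSubmonoid.int_fg (M : AddSubmonoid ℤ) : M.FG := by
  by_cases hpos : ∀ x ∈ M, 0 ≤ x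
  · exact M.fg_of_forall_nonneg hpos
  by_cases hneg : ∀ x ∈ M, x ≤ 0
  · have h := ((M.comap (negAddMonoidHom : ℤ →+ ℤ)).fg_of_forall_nonneg fun x hx => by
      have := hneg (-x) hx
      omega).map (negAddMonoidHom : ℤ →+ ℤ)
    have h1 : (M.comap (negAddMonoidHom : ℤ →+ ℤ)).map (negAddMonoidHom : ℤ →+ ℤ) = M := by
      ext x
      constructor
      · rintro ⟨n, hn, rfl⟩
        exact hn
      · intro hx
        exact ⟨-x, by simpa using hx, by simp⟩
    rwa [h1] at h
  push Not at hpos hneg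
  obtain ⟨b, hb, hb0⟩ := hpos
  obtain ⟨a, ha, ha0⟩ := hneg
  have hnegmem : ∀ x ∈ M, -x ∈ M := by
    intro x hx
    rcases le_total 0 x with h | h
    -- As b is negative and x is not, both coefficients are natural numbers and the sum is |b|x - x
    -- + xb = -x.
    · have : -x = (b.natAbs - 1) • x + x.natAbs • b := by
        obtain ⟨n, rfl⟩ := Int.eq_ofNat_of_zero_le h
        obtain ⟨m, rfl⟩ : ∃ m : ℕ, b = -(m + 1) := ⟨b.natAbs - 1, by omega⟩
        have : (-(m + 1 : ℤ)).natAbs - 1 = m := by omega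
        rw [this]
        simp only [nsmul_eq_mul, Int.natAbs_natCast]
        ring
      rw [this]
      exact M.add_mem (M.nsmul_mem hx _) (M.nsmul_mem hb _)
    · have : -x = (a.natAbs - 1) • x + x.natAbs • a := by
        obtain ⟨n, rfl⟩ : ∃ n : ℕ, x = -n := ⟨x.natAbs, by omega⟩
        obtain ⟨m, rfl⟩ : ∃ m : ℕ, a = (m + 1) := ⟨a.natAbs - 1, by omega⟩
        have : ((m + 1 : ℤ)).natAbs - 1 = m := by omega
        rw [this]
        simp only [nsmul_eq_mul, Int.natAbs_neg, Int.natAbs_natCast]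
        ring
      rw [this]
      exact M.add_mem (M.nsmul_mem hx _) (M.nsmul_mem ha _)
  let H : AddSubgroup ℤ := { M with neg_mem' := fun {x} hx => hnegmem x hx }
  obtain ⟨g, hg⟩ := Int.subgroup_cyclic H
  have hgM : g ∈ M := by
    change g ∈ H
    rw [hg]
    exact AddSubgroup.subset_closure rfl
  refine ⟨{g, -g}, le_antisymm ?_ ?_⟩
  · rw [AddSubmonoid.closure_le]
    intro x hx
    simp only [Finset.coe_insert, Finset.coe_singleton, Set.mem_insert_iff,
      Set.mem_singleton_iff] at hx
    rcases hx with rfl | rfl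
    exacts [hgM, hnegmem _ hgM]
  · intro x hx
    have hx' : x ∈ H := hx
    rw [hg, AddSubgroup.mem_closure_singleton] at hx'
    obtain ⟨n, rfl⟩ := hx'
    rcases le_total 0 n with h | h
    · obtain ⟨k, rfl⟩ := Int.eq_ofNat_of_zero_le h
      rw [natCast_zsmul]
      exact AddSubmonoid.nsmul_mem _ (AddSubmonoid.subset_closure (by simp)) _
    · obtain ⟨k, rfl⟩ : ∃ k : ℕ, n = -k := ⟨n.natAbs, by omega⟩
      rw [neg_zsmul, ← zsmul_neg, natCast_zsmul]
      exact AddSubmonoid.nsmul_mem _ (AddSubmonoid.subset_closure (by simp)) _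

/-- The elements of a submonoid of `ℤ` have expansions in base `q` with digits from a finite subset
of the submonoid. -/
theorem AddSubmonoid.exists_bounded_expansion (M : AddSubmonoid ℤ) {q : ℕ} (hq : 2 ≤ q) :
    ∃ K : ℕ, ∀ z ∈ M, ∃ (ζ : ℕ → ℤ) (I : ℕ), (∀ i, ζ i ∈ M ∧ (ζ i).natAbs ≤ K) ∧
      (∀ i, I ≤ i → ζ i = 0) ∧ z = ∑ i ∈ Finset.range I, ζ i * (q : ℤ) ^ i := by
  obtain ⟨S, hS⟩ := M.int_fg
  refine ⟨∑ s ∈ S, q * s.natAbs, fun z hz => ?_⟩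
  rw [← hS, AddSubmonoid.mem_closure_finset] at hz
  obtain ⟨f, -, hf⟩ := hz
  obtain ⟨N, hN⟩ : ∃ N, ∑ s ∈ S, f s ≤ N := ⟨_, le_rfl⟩
  induction N generalizing f z with
  | zero =>
    have h0 : ∀ s ∈ S, f s = 0 := by simpa using hN
    refine ⟨fun _ => 0, 0, fun i => ⟨M.zero_mem, by simp⟩, fun _ _ => rfl, ?_⟩
    rw [← hf, Finset.sum_eq_zero fun s hs => by rw [h0 s hs, zero_nsmul]]
    simp
  | succ N ih =>
    by_cases h0 : ∑ s ∈ S, f s = 0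
    · exact ih z f hf (by omega)
    have hlt : ∑ s ∈ S, f s / q ≤ N := by
      have h1 : ∑ s ∈ S, f s / q < ∑ s ∈ S, f s := by
        obtain ⟨s, hs, hs0⟩ := Finset.exists_ne_zero_of_sum_ne_zero h0
        exact Finset.sum_lt_sum (fun s _ => Nat.div_le_self _ _)
          ⟨s, hs, Nat.div_lt_self (Nat.pos_of_ne_zero hs0) (by omega)⟩
      omega
    -- The coefficients of the generators are divided by q, not z itself: the remainders are natural
    -- numbers below q, so the lowest digit stays in `M` and is bounded.
    obtain ⟨ζ, I, h1, h2, h3⟩ := ih _ (fun s => f s / q) rfl hlt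
    refine ⟨fun i => Nat.casesOn i (∑ s ∈ S, (f s % q) • s) ζ, I + 1, fun i => ?_, fun i hi => ?_,
      ?_⟩
    · cases i with
      | zero =>
        refine ⟨M.sum_mem fun s hs => M.nsmul_mem (hS ▸ AddSubmonoid.subset_closure hs) _, ?_⟩
        refine (Int.natAbs_sum_le _ _).trans (Finset.sum_le_sum fun s _ => ?_)
        rw [nsmul_eq_mul, Int.natAbs_mul, Int.natAbs_natCast]
        exact Nat.mul_le_mul_right _ (Nat.mod_lt _ (by omega)).le
      | succ i => exact h1 i
    · cases i with
      | zero => omega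
      | succ i => exact h2 i (by omega)
    · rw [Finset.sum_range_succ']
      simp only [pow_succ, pow_zero, mul_one, ← mul_assoc]
      rw [← Finset.sum_mul, ← h3, ← hf, Finset.sum_mul]
      change _ = _ + ∑ s ∈ S, (f s % q) • s
      rw [← Finset.sum_add_distrib]
      refine Finset.sum_congr rfl fun s _ => ?_
      simp only [nsmul_eq_mul]
      have : (f s : ℤ) = q * (f s / q : ℕ) + (f s % q : ℕ) := by
        exact_mod_cast (Nat.div_add_mod (f s) q).symm
      rw [this]
      ring

/-! ### Erasing cycles from walks -/

namespace LevelNet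

variable {Q : Type} {N : LevelNet Q}

/-- The source of an edge. -/
def vertex (e : Q × ℤ × ℤ) : Q × ℤ := (e.1, e.2.1)

/-- The graph looks the same on all levels. -/
def Homogeneous (N : LevelNet Q) : Prop := ∀ h h', N.flat h = N.flat h'

theorem Walk.shift (hN : N.Homogeneous) {p p' : Q} {h h' : ℤ} {μ : Multiset (Q × ℤ × ℤ)}
    (hw : N.Walk p h p' h' μ) (k : ℤ) :
    N.Walk p (h + k) p' (h' + k) (μ.map fun e => (e.1, e.2.1 + k, e.2.2)) := by
  induction hw with
  | nil => exact .nil _ _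
  | cons he _ ih =>
    rw [Multiset.map_cons]
    refine .cons ?_ ih
    rcases he with ⟨rfl, h1⟩ | ⟨rfl, h1⟩ | ⟨rfl, h1⟩
    · exact .inl ⟨rfl, by rwa [hN _ _] ⟩
    · exact .inr (.inl ⟨by ring, h1⟩)
    · exact .inr (.inr ⟨by ring, h1⟩)

theorem val_shift {q : ℕ} (hq : 2 ≤ q) (μ : Multiset (Q × ℤ × ℤ)) (k : ℤ) :
    val q (μ.map fun e => (e.1, e.2.1 + k, e.2.2)) = (q : ℚ) ^ k * val q μ := by
  have hq0 : (q : ℚ) ≠ 0 := by positivity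
  induction μ using Multiset.induction_on with
  | empty => simp
  | cons e μ ih => rw [Multiset.map_cons, val_cons, val_cons, ih, zpow_add₀ hq0]; ring

theorem Walk.split {p p' p₁ : Q} {h h' h₁ v₁ : ℤ} {μ : Multiset (Q × ℤ × ℤ)}
    (hw : N.Walk p h p' h' μ) (hmem : (p₁, h₁, v₁) ∈ μ) :
    ∃ α β, μ = α + β ∧ N.Walk p h p₁ h₁ α ∧ N.Walk p₁ h₁ p' h' β := by
  induction hw with
  | nil => simp at hmem
  | @cons p h v p' h' p'' h'' μ he hw ih =>
    rcases Multiset.mem_cons.mp hmem with heq | hmem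
    · simp only [Prod.mk.injEq] at heq
      obtain ⟨rfl, rfl, rfl⟩ := heq
      exact ⟨0, _, (zero_add _).symm, .nil _ _, .cons he hw⟩
    · obtain ⟨α, β, rfl, h1, h2⟩ := ih hmem
      exact ⟨(p, h, v) ::ₘ α, β, by simp, .cons he h1, h2⟩

/-- The integers that are values of closed walks at the vertex `(p, 0)`. -/
def loopValues (N : LevelNet Q) (q : ℕ) (p : Q) : AddSubmonoid ℤ where
  -- A closed walk may dip below level 0 and have a fractional value; only those with integer value
  -- count.
  carrier := {z | ∃ γ, N.Walk p 0 p 0 γ ∧ val q γ = z}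
  zero_mem' := ⟨0, .nil _ _, by simp⟩
  add_mem' := by
    rintro x y ⟨γ, hγ, hx⟩ ⟨γ', hγ', hy⟩
    exact ⟨γ + γ', hγ.trans hγ', by simp [hx, hy]⟩

/-- Sums of values of closed walks at the vertices `(p, hm p)`, for `p ∈ A`. -/
def loopSums [Fintype Q] (N : LevelNet Q) (q : ℕ) (hm : Q → ℤ) (A : Set Q) : AddSubmonoid ℚ where
  carrier := {r | ∃ z : Q → ℤ, (∀ p, z p ∈ N.loopValues q p) ∧ (∀ p, z p ≠ 0 → p ∈ A) ∧
    r = ∑ p, (z p : ℚ) * (q : ℚ) ^ hm p}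
  zero_mem' := ⟨0, fun _ => zero_mem _, by simp, by simp⟩
  add_mem' := by
    rintro x y ⟨z, h1, h2, rfl⟩ ⟨z', h1', h2', rfl⟩
    refine ⟨z + z', fun p => add_mem (h1 p) (h1' p), fun p hp => ?_, ?_⟩
    · by_contra hA
      have h3 := not_imp_comm.mp (h2 p) hA
      have h4 := not_imp_comm.mp (h2' p) hA
      simp [h3, h4] at hp
    · simp [add_mul, Finset.sum_add_distrib]

theorem exists_int_val {q : ℕ} (μ : Multiset (Q × ℤ × ℤ)) (hμ : ∀ e ∈ μ, 0 ≤ e.2.1) :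
    ∃ z : ℤ, val q μ = z := by
  induction μ using Multiset.induction_on with
  | empty => exact ⟨0, by simp⟩
  | cons e μ ih =>
    obtain ⟨z, hz⟩ := ih fun e he => hμ e (Multiset.mem_cons_of_mem he)
    obtain ⟨n, hn⟩ := Int.eq_ofNat_of_zero_le (hμ e (Multiset.mem_cons_self _ _))
    exact ⟨e.2.2 * q ^ n + z, by rw [val_cons, hz, hn]; simp⟩

/-- A closed walk is a closed walk at its lowest vertex. -/
theorem Walk.val_mem_loopSums [Fintype Q] (hN : N.Homogeneous) {q : ℕ} (hq : 2 ≤ q)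
    {hm : Q → ℤ} {A : Set Q} {p : Q} {h : ℤ} {γ : Multiset (Q × ℤ × ℤ)} (hw : N.Walk p h p h γ)
    (hA : ∀ e ∈ γ, e.1 ∈ A ∧ hm e.1 ≤ e.2.1) : val q γ ∈ N.loopSums q hm A := by
  classical
  have hq0 : (q : ℚ) ≠ 0 := by positivity
  by_cases hγ : γ = 0
  · rw [hγ, val_zero]; exact zero_mem _
  -- The walk is rotated to start at one of its lowest vertices. Shifted to level 0 it then has only
  -- nonnegative powers of q, hence an integer value.
  obtain ⟨e, he, hmin⟩ := Finset.exists_min_image γ.toFinset (fun e => e.2.1) (by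
    obtain ⟨e, he⟩ := Multiset.exists_mem_of_ne_zero hγ
    exact ⟨e, by simpa using he⟩)
  rw [Multiset.mem_toFinset] at he
  obtain ⟨y, l, v⟩ := e
  obtain ⟨α, β, rfl, h1, h2⟩ := hw.split he
  have h3 := (h2.trans h1).shift hN (-l)
  rw [add_neg_cancel] at h3
  obtain ⟨z, hz⟩ := exists_int_val (q := q) ((β + α).map fun e => (e.1, e.2.1 + -l, e.2.2)) (by
    intro e he
    obtain ⟨e', he', rfl⟩ := Multiset.mem_map.mp he
    have := hmin e' (by simpa [or_comm] using he')
    simp only at this ⊢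
    omega)
  have hzmem : z ∈ N.loopValues q y := ⟨_, h3, hz⟩
  rw [val_shift hq] at hz
  obtain ⟨hyA, hyl⟩ := hA _ he
  obtain ⟨n, hn⟩ : ∃ n : ℕ, l = hm y + n := ⟨(l - hm y).toNat, by simp only at hyl; omega⟩
  -- One closed walk on level `hm y + n` is worth q^n copies on level `hm y`.
  refine ⟨Function.update 0 y ((q ^ n) • z), fun x => ?_, fun x hx => ?_, ?_⟩
  · by_cases hx : x = y
    · subst hx; simpa using AddSubmonoid.nsmul_mem _ hzmem (q ^ n)
    · rw [Function.update_of_ne hx]; exact zero_mem _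
  · by_cases hxy : x = y
    · subst hxy; exact hyA
    · rw [Function.update_of_ne hxy] at hx; simp at hx
  · rw [Finset.sum_eq_single y (fun x _ hx => by rw [Function.update_of_ne hx]; simp) (by simp)]
    rw [Function.update_self]
    have h4 : val q (α + β) = (q : ℚ) ^ l * z := by
      rw [← hz, ← mul_assoc, ← zpow_add₀ hq0, add_neg_cancel, zpow_zero, one_mul]
      simp [add_comm]
    rw [h4, hn, zpow_add₀ hq0]
    simp
    ring

/-- Erasing cycles from a walk in such a way that prescribed vertices are still visited. -/
theorem Walk.exists_reduced [Fintype Q] [DecidableEq Q] (hN : N.Homogeneous) {q : ℕ}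
    (hq : 2 ≤ q) {hm : Q → ℤ} {A : Set Q} {p p' : Q} {h h' : ℤ} {μ : Multiset (Q × ℤ × ℤ)}
    (hw : N.Walk p h p' h' μ) (hA : ∀ e ∈ μ, e.1 ∈ A ∧ hm e.1 ≤ e.2.1) :
    ∀ P : Finset (Q × ℤ), (∀ x ∈ P, x ∈ μ.map vertex) →
      ∃ (s : Q) (k : ℤ) (μ₁ μ₂ : Multiset (Q × ℤ × ℤ)) (r : ℚ),
        N.Walk p h s k μ₁ ∧ N.Walk s k p' h' μ₂ ∧ (μ₁.map vertex).Nodup ∧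
        (∀ x, (μ₂.map vertex).count x ≤ 2 * P.card) ∧ (∀ x ∈ P, x ∈ μ₂.map vertex) ∧
        μ₁ + μ₂ ≤ μ ∧ r ∈ N.loopSums q hm A ∧ val q μ = val q (μ₁ + μ₂) + r := by
  induction hw with
  | nil p h =>
    intro P hP
    refine ⟨p, h, 0, 0, 0, .nil _ _, .nil _ _, by simp, by simp, hP, by simp, zero_mem _, by simp⟩
  | @cons p h v p' h' p'' h'' μ he hw ih =>
    intro P hP
    have hA' : ∀ e ∈ μ, e.1 ∈ A ∧ hm e.1 ≤ e.2.1 := fun e he => hA e (Multiset.mem_cons_of_mem he)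
    by_cases hpP : (p, h) ∈ P
    · obtain ⟨s, k, μ₁, μ₂, r, h1, h2, h3, h4, h5, h6, h7, h8⟩ := ih hA' (P.erase (p, h)) (by
        intro x hx
        rw [Finset.mem_erase] at hx
        have := hP x hx.2
        rw [Multiset.map_cons, Multiset.mem_cons] at this
        exact this.resolve_left hx.1)
      -- At a prescribed vertex everything collected so far is frozen into the second part. Visits
      -- to a vertex grow by at most two, one from the new edge and one from the repetition-free
      -- `μ₁`, while `P` loses an element.
      refine ⟨p, h, 0, (p, h, v) ::ₘ (μ₁ + μ₂), r, .nil _ _, .cons he (h1.trans h2), by simp,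
        fun x => ?_, fun x hx => ?_, by simpa using h6, h7, ?_⟩
      · rw [Multiset.map_cons, Multiset.map_add]
        have h9 := Multiset.count_cons x (vertex (p, h, v)) (μ₁.map vertex + μ₂.map vertex)
        rw [Multiset.count_add] at h9
        have h10 := Multiset.nodup_iff_count_le_one.mp h3 x
        have h11 := h4 x
        have h12 := Finset.card_erase_of_mem hpP
        have h13 := Finset.card_pos.mpr ⟨_, hpP⟩
        rw [h9]
        split_ifs <;> omega
      · by_cases hx' : x = (p, h)
        · subst hx'; simp [vertex]
        · rw [Multiset.map_cons, Multiset.map_add]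
          exact Multiset.mem_cons_of_mem
            (Multiset.mem_add.mpr (.inr (h5 x (Finset.mem_erase.mpr ⟨hx', hx⟩))))
      · rw [zero_add, val_cons, val_cons, h8]
        ring
    · obtain ⟨s, k, μ₁, μ₂, r, h1, h2, h3, h4, h5, h6, h7, h8⟩ := ih hA' P (by
        intro x hx
        have := hP x hx
        rw [Multiset.map_cons, Multiset.mem_cons] at this
        exact this.resolve_left fun h => hpP (by rw [h] at hx; exact hx))
      -- Only the first part is ever shortened, so no prescribed visit is lost. If the new vertex
      -- occurs there, the loop it closes is cut out and its value goes into `r`.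
      by_cases hmem : (p, h) ∈ μ₁.map vertex
      · obtain ⟨⟨p₁, k₁, v₁⟩, he₁, heq⟩ := Multiset.mem_map.mp hmem
        simp only [vertex, Prod.mk.injEq] at heq
        obtain ⟨rfl, rfl⟩ := heq
        obtain ⟨α, β, rfl, h9, h10⟩ := h1.split he₁
        rw [Multiset.map_add, Multiset.nodup_add] at h3
        have hle : α ≤ μ := le_trans (by
          rw [add_assoc]; exact Multiset.le_add_right _ _) h6
        refine ⟨s, k, β, μ₂, r + val q ((p₁, k₁, v) ::ₘ α), h10, h2, h3.2.1, h4, h5, ?_,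
          add_mem h7 ((Walk.cons he h9).val_mem_loopSums hN hq ?_), ?_⟩
        · refine le_trans ?_ (h6.trans (Multiset.le_cons_self _ _))
          rw [add_assoc]
          exact Multiset.le_add_left _ _
        · intro e he
          refine hA e ?_
          rcases Multiset.mem_cons.mp he with rfl | he
          · exact Multiset.mem_cons_self _ _
          · exact Multiset.mem_cons_of_mem (Multiset.mem_of_le hle he)
        · rw [val_cons, h8, val_cons]
          simp only [val_add]
          ring
      · refine ⟨s, k, (p, h, v) ::ₘ μ₁, μ₂, r, .cons he h1, h2, ?_, h4, h5, ?_, h7, ?_⟩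
        · rw [Multiset.map_cons, Multiset.nodup_cons]
          exact ⟨hmem, h3⟩
        · rw [Multiset.cons_add]
          exact Multiset.cons_le_cons _ h6
        · rw [Multiset.cons_add, val_cons, val_cons, h8]
          ring

/-- Every walk has the same value as a walk that visits every vertex a bounded number of times
together with closed walks at vertices of that walk. -/
theorem Walk.exists_skeleton [Fintype Q] [DecidableEq Q] (hN : N.Homogeneous) {q : ℕ}
    (hq : 2 ≤ q) {p p' : Q} {h h' : ℤ} {μ : Multiset (Q × ℤ × ℤ)} (hw : N.Walk p h p' h' μ) :
    ∃ (μ' : Multiset (Q × ℤ × ℤ)) (hm z : Q → ℤ), N.Walk p h p' h' μ' ∧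
      (∀ x, (μ'.map vertex).count x ≤ 2 * Fintype.card Q + 1) ∧
      (∀ y, z y ∈ N.loopValues q y) ∧ (∀ y, z y ≠ 0 → ∃ v, (y, hm y, v) ∈ μ') ∧
      val q μ = val q μ' + ∑ y, (z y : ℚ) * (q : ℚ) ^ hm y := by
  -- `hm y` will be the lowest level on which the state y occurs. Keeping the visits to (y, hm y)
  -- leaves a place for every erased closed walk, at the price of at most |Q| prescribed vertices.
  have hmin : ∀ y, ∃ k : ℤ, (∀ e ∈ μ, e.1 = y → k ≤ e.2.1) ∧
      ((∃ e ∈ μ, e.1 = y) → ∃ v, (y, k, v) ∈ μ) := by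
    intro y
    by_cases hy : ∃ e ∈ μ, e.1 = y
    · obtain ⟨e, he, hey⟩ := hy
      obtain ⟨e', he', hmin⟩ := Finset.exists_min_image (μ.toFinset.filter fun e => e.1 = y)
        (fun e => e.2.1) ⟨e, by simp [he, hey]⟩
      simp only [Finset.mem_filter, Multiset.mem_toFinset] at he' hmin
      obtain ⟨he', rfl⟩ := he'
      exact ⟨e'.2.1, fun e h1 h2 => hmin e ⟨h1, h2⟩, fun _ => ⟨e'.2.2, he'⟩⟩
    · exact ⟨0, fun e h1 h2 => absurd ⟨e, h1, h2⟩ hy, fun h => absurd h hy⟩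
  choose hm hm1 hm2 using hmin
  set A : Set Q := {y | ∃ e ∈ μ, e.1 = y} with hA
  classical
  obtain ⟨s, k, μ₁, μ₂, r, h1, h2, h3, h4, h5, h6, ⟨z, hz1, hz2, rfl⟩, h8⟩ :=
    hw.exists_reduced hN hq (hm := hm) (A := A) (fun e he => ⟨⟨e, he, rfl⟩, hm1 _ e he rfl⟩)
      ((Finset.univ.filter fun y => y ∈ A).image fun y => (y, hm y)) (by
        intro x hx
        obtain ⟨y, hy, rfl⟩ := Finset.mem_image.mp hx
        obtain ⟨v, hv⟩ := hm2 y (Finset.mem_filter.mp hy).2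
        exact Multiset.mem_map.mpr ⟨_, hv, rfl⟩)
  refine ⟨μ₁ + μ₂, hm, z, h1.trans h2, fun x => ?_, hz1, fun y hy => ?_, h8⟩
  · rw [Multiset.map_add, Multiset.count_add]
    have h9 := Multiset.nodup_iff_count_le_one.mp h3 x
    have h10 := h4 x
    have h11 : ((Finset.univ.filter fun y => y ∈ A).image fun y => (y, hm y)).card ≤
        Fintype.card Q := Finset.card_image_le.trans (Finset.card_filter_le _ _)
    omega
  · have := h5 (y, hm y) (Finset.mem_image.mpr ⟨y, by simpa using hz2 y hy, rfl⟩)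
    obtain ⟨⟨y', k', v⟩, hv, heq⟩ := Multiset.mem_map.mp this
    simp only [vertex, Prod.mk.injEq] at heq
    obtain ⟨rfl, hk⟩ := heq
    exact ⟨v, Multiset.mem_add.mpr (.inr (hk ▸ hv))⟩

end LevelNet

/-! ### The finite automaton of crossing segments, its soundness and its completeness. -/

/-! ### Crossing segments -/

namespace LevelNet

variable {Q : Type}

/-- A walk on one level, from which segments below this level have been cut out: `X` lists the ends
of the segments, `v` is the sum of the values on the level, and `S` is the set of states visited on
the level. -/
inductive Chain (F : Q → ℤ → Q → Prop) : Q → List (Q × Q) → ℤ → Set Q → Q → Prop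
  | nil (p : Q) : Chain F p [] 0 {p} p
  | flat {p p' p'' : Q} {X : List (Q × Q)} {v v' : ℤ} {S : Set Q} :
      F p v p' → Chain F p' X v' S p'' → Chain F p X (v + v') (insert p S) p''
  | seg {p p' r : Q} {X : List (Q × Q)} {v : ℤ} {S : Set Q} :
      Chain F p' X v S r → Chain F p ((p, p') :: X) v (insert p S) r

/-- Segments below a level and their decomposition one level further down. -/
inductive Groups (F : Q → ℤ → Q → Prop) (up down : Q → Q → Prop) :
    List (Q × Q) → ℤ → Set Q → List (Q × Q) → Prop
  | nil : Groups F up down [] 0 ∅ []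
  | cons {p p₀ p₁ r : Q} {X X' Y : List (Q × Q)} {v v' : ℤ} {S S' : Set Q} :
      down p p₀ → Chain F p₀ X v S p₁ → up p₁ r → Groups F up down X' v' S' Y →
      Groups F up down (X ++ X') (v + v') (S ∪ S') ((p, r) :: Y)

/-- The pairs in a list are the ends of walks. -/
inductive Real (N : LevelNet Q) (h : ℤ) : List (Q × Q) → Multiset (Q × ℤ × ℤ) → Prop
  | nil : Real N h [] 0
  | cons {p p' : Q} {X : List (Q × Q)} {α β : Multiset (Q × ℤ × ℤ)} :
      N.Walk p h p' h α → Real N h X β → Real N h ((p, p') :: X) (α + β)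

/-- The pairs in a list are the ends of walks below a level. -/
inductive BelowReal (N : LevelNet Q) (h : ℤ) : List (Q × Q) → Multiset (Q × ℤ × ℤ) → Prop
  | nil : BelowReal N h [] 0
  | cons {p p₀ p₁ p' : Q} {X : List (Q × Q)} {α β : Multiset (Q × ℤ × ℤ)} :
      N.down p p₀ → N.Walk p₀ (h - 1) p₁ (h - 1) α → (∀ e ∈ α, e.2.1 ≤ h - 1) → N.up p₁ p' →
      BelowReal N h X β →
      BelowReal N h ((p, p') :: X) ((p, h, 0) ::ₘ (p₁, h - 1, 0) ::ₘ (α + β))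

variable {N : LevelNet Q}

/-! #### From segments to walks -/

theorem Real.exists_of_append {h : ℤ} {X X' : List (Q × Q)} {μ : Multiset (Q × ℤ × ℤ)}
    (hr : N.Real h (X ++ X') μ) : ∃ α β, N.Real h X α ∧ N.Real h X' β ∧ μ = α + β := by
  induction X generalizing μ with
  | nil => exact ⟨0, μ, .nil, hr, by simp⟩
  | cons x X ih =>
    rw [List.cons_append] at hr
    cases hr with
    | cons hw hr =>
      obtain ⟨α, β, h1, h2, rfl⟩ := ih hr
      exact ⟨_, β, .cons hw h1, h2, by rw [add_assoc]⟩

/-- The multiset records only sources of edges, so an empty walk leaves no trace of its vertex. -/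
theorem Walk.eq_or_source_mem {p p' : Q} {h h' : ℤ} {μ : Multiset (Q × ℤ × ℤ)}
    (hw : N.Walk p h p' h' μ) : p = p' ∨ ∃ v, (p, h, v) ∈ μ := by
  cases hw with
  | nil => exact .inl rfl
  | cons he hw => exact .inr ⟨_, Multiset.mem_cons_self _ _⟩

/-- The end `p'` is set apart because it need not be the source of an edge; in `Groups.exists_real`
the ascent that follows supplies one. -/
theorem Chain.exists_walk {q : ℕ} {h : ℤ} {p p' : Q} {X : List (Q × Q)} {v : ℤ} {S : Set Q}
    (hc : Chain (N.flat h) p X v S p') {μ : Multiset (Q × ℤ × ℤ)} (hr : N.Real h X μ) :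
    ∃ ν, N.Walk p h p' h ν ∧ val q ν = v * (q : ℚ) ^ h + val q μ ∧ μ ≤ ν ∧
      ∀ y ∈ S, y = p' ∨ ∃ u, (y, h, u) ∈ ν := by
  induction hc generalizing μ with
  | nil p =>
    cases hr
    exact ⟨0, .nil _ _, by simp, le_rfl, fun y hy => .inl hy⟩
  | @flat p p' p'' X v v' S hf _ ih =>
    obtain ⟨ν, h1, h2, h3, h4⟩ := ih hr
    refine ⟨(p, h, v) ::ₘ ν, .cons (.inl ⟨rfl, hf⟩) h1, ?_,
      h3.trans (Multiset.le_cons_self _ _), fun y hy => ?_⟩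
    · rw [val_cons, h2]; push_cast; ring
    · rcases hy with rfl | hy
      · exact .inr ⟨v, Multiset.mem_cons_self _ _⟩
      · exact (h4 y hy).imp_right fun ⟨u, hu⟩ => ⟨u, Multiset.mem_cons_of_mem hu⟩
  | @seg p p' p'' X v S _ ih =>
    cases hr with
    | @cons _ _ _ α β hw hr =>
      obtain ⟨ν, h1, h2, h3, h4⟩ := ih hr
      refine ⟨α + ν, hw.trans h1, ?_, add_le_add le_rfl h3, fun y hy => ?_⟩
      · rw [val_add, val_add, h2]; ring
      · rcases hy with rfl | hy
        · rcases hw.eq_or_source_mem with rfl | ⟨u, hu⟩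
          · rcases h1.eq_or_source_mem with rfl | ⟨u, hu⟩
            · exact .inl rfl
            · exact .inr ⟨u, Multiset.mem_add.mpr (.inr hu)⟩
          · exact .inr ⟨u, Multiset.mem_add.mpr (.inl hu)⟩
        · exact (h4 y hy).imp_right fun ⟨u, hu⟩ => ⟨u, Multiset.mem_add.mpr (.inr hu)⟩

theorem Groups.exists_real {q : ℕ} {h : ℤ} {X Y : List (Q × Q)} {v : ℤ} {S : Set Q}
    (hg : Groups (N.flat h) N.up N.down X v S Y) {μ : Multiset (Q × ℤ × ℤ)} (hr : N.Real h X μ) :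
    ∃ ν, N.Real (h + 1) Y ν ∧ val q ν = v * (q : ℚ) ^ h + val q μ ∧ μ ≤ ν ∧
      ∀ y ∈ S, ∃ u, (y, h, u) ∈ ν := by
  induction hg generalizing μ with
  | nil =>
    cases hr
    exact ⟨0, .nil, by simp, le_rfl, fun y hy => hy.elim⟩
  | @cons p p₀ p₁ p' X X' Y v v' S S' hd hc hu _ ih =>
    obtain ⟨α, β, h1, h2, rfl⟩ := hr.exists_of_append
    obtain ⟨ν, h3, h4, h5, h6⟩ := ih h2
    obtain ⟨κ, h7, h8, h9, h10⟩ := hc.exists_walk (q := q) h1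
    have hw : N.Walk p (h + 1) p' (h + 1) ((p, h + 1, 0) ::ₘ (κ + {(p₁, h, 0)})) :=
      .cons (.inr (.inr ⟨by ring, rfl, hd⟩)) (h7.trans (.single (.inr (.inl ⟨rfl, rfl, hu⟩))))
    refine ⟨_, .cons hw h3, ?_, add_le_add ?_ h5, fun y hy => ?_⟩
    · rw [val_add, val_cons, val_add, h4, h8, ← Multiset.cons_zero, val_cons, val_zero, val_add]
      push_cast
      ring
    · exact h9.trans ((Multiset.le_add_right _ _).trans (Multiset.le_cons_self _ _))
    · rcases hy with hy | hy
      · rcases h10 y hy with rfl | ⟨u, hu⟩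
        · exact ⟨0, by simp⟩
        · exact ⟨u, by simp [hu]⟩
      · obtain ⟨u, hu⟩ := h6 y hy
        exact ⟨u, Multiset.mem_add.mpr (.inr hu)⟩

theorem Real.insert {h k : ℤ} {X : List (Q × Q)} {μ γ : Multiset (Q × ℤ × ℤ)} {y : Q} {u : ℤ}
    (hr : N.Real h X μ) (hy : (y, k, u) ∈ μ) (hγ : N.Walk y k y k γ) : N.Real h X (μ + γ) := by
  induction hr with
  | nil => simp at hy
  | @cons p p' X α β hw hr ih =>
    rcases Multiset.mem_add.mp hy with hy | hy
    · obtain ⟨α₁, α₂, rfl, h1, h2⟩ := hw.split hy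
      have := Real.cons ((h1.trans hγ).trans h2) hr
      have heq : α₁ + γ + α₂ + β = α₁ + α₂ + β + γ := by abel
      rwa [heq] at this
    · rw [add_assoc]
      exact .cons hw (ih hy)

/-- A contribution z on level l at a state visited on a level k ≤ l is realized by a closed walk on
level k worth q^(l - k) times z. -/
theorem Real.insert_sum [Fintype Q] {q : ℕ} (hq : 2 ≤ q) {M : Q → AddSubmonoid ℤ}
    (hM : ∀ y, ∀ z ∈ M y, ∀ k, ∃ γ, N.Walk y k y k γ ∧ val q γ = z * (q : ℚ) ^ k) {h : ℤ}
    {X : List (Q × Q)} {μ : Multiset (Q × ℤ × ℤ)} (hr : N.Real h X μ) (l : ℤ) (z : Q → ℤ)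
    (hz : ∀ y, z y ∈ M y) (hvis : ∀ y, z y ≠ 0 → ∃ k ≤ l, ∃ u, (y, k, u) ∈ μ) (T : Finset Q) :
    ∃ ν, N.Real h X ν ∧ μ ≤ ν ∧ val q ν = val q μ + (∑ y ∈ T, z y : ℤ) * (q : ℚ) ^ l := by
  classical
  have hq0 : (q : ℚ) ≠ 0 := by positivity
  induction T using Finset.induction_on with
  | empty => exact ⟨μ, hr, le_rfl, by simp⟩
  | insert y T hy ih =>
    obtain ⟨ν, h1, h2, h3⟩ := ih
    rw [Finset.sum_insert hy]
    by_cases h0 : z y = 0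
    · exact ⟨ν, h1, h2, by rw [h0, zero_add, h3]⟩
    · obtain ⟨k, hk, u, hu⟩ := hvis y h0
      obtain ⟨n, rfl⟩ : ∃ n : ℕ, l = k + n := ⟨(l - k).toNat, by omega⟩
      obtain ⟨γ, hγ, hv⟩ := hM y _ (AddSubmonoid.nsmul_mem _ (hz y) (q ^ n)) k
      refine ⟨ν + γ, h1.insert (Multiset.mem_of_le h2 hu) hγ,
        h2.trans (Multiset.le_add_right _ _), ?_⟩
      rw [val_add, h3, hv, zpow_add₀ hq0]
      push_cast [nsmul_eq_mul]
      rw [zpow_natCast]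
      ring

/-! #### From walks to segments -/

/-- The sum of the values on a level. -/
def levelSum (k : ℤ) (μ : Multiset (Q × ℤ × ℤ)) : ℤ :=
  (μ.map fun e => if e.2.1 = k then e.2.2 else 0).sum

/-- The number of edges that start on a level. -/
def levelCount (k : ℤ) (μ : Multiset (Q × ℤ × ℤ)) : ℕ :=
  (μ.map fun e => if e.2.1 = k then 1 else 0).sum

/-- The edges that start below a level. -/
def low (k : ℤ) (μ : Multiset (Q × ℤ × ℤ)) : Multiset (Q × ℤ × ℤ) := μ.filter fun e => e.2.1 < k

theorem levelSum_zero (k : ℤ) : levelSum k (0 : Multiset (Q × ℤ × ℤ)) = 0 := by simp [levelSum]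

theorem levelSum_cons (k : ℤ) (e : Q × ℤ × ℤ) (μ : Multiset (Q × ℤ × ℤ)) :
    levelSum k (e ::ₘ μ) = (if e.2.1 = k then e.2.2 else 0) + levelSum k μ := by simp [levelSum]

theorem levelSum_add (k : ℤ) (μ ν : Multiset (Q × ℤ × ℤ)) :
    levelSum k (μ + ν) = levelSum k μ + levelSum k ν := by simp [levelSum]

theorem levelCount_zero (k : ℤ) : levelCount k (0 : Multiset (Q × ℤ × ℤ)) = 0 := by
  simp [levelCount]

theorem levelCount_cons (k : ℤ) (e : Q × ℤ × ℤ) (μ : Multiset (Q × ℤ × ℤ)) :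
    levelCount k (e ::ₘ μ) = (if e.2.1 = k then 1 else 0) + levelCount k μ := by
  simp [levelCount]

theorem levelCount_add (k : ℤ) (μ ν : Multiset (Q × ℤ × ℤ)) :
    levelCount k (μ + ν) = levelCount k μ + levelCount k ν := by simp [levelCount]

theorem low_cons_of_lt {k : ℤ} {e : Q × ℤ × ℤ} (μ : Multiset (Q × ℤ × ℤ)) (he : e.2.1 < k) :
    low k (e ::ₘ μ) = e ::ₘ low k μ := Multiset.filter_cons_of_pos _ he

theorem low_cons_of_not_lt {k : ℤ} {e : Q × ℤ × ℤ} (μ : Multiset (Q × ℤ × ℤ)) (he : ¬e.2.1 < k) :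
    low k (e ::ₘ μ) = low k μ := Multiset.filter_cons_of_neg _ he

theorem low_add (k : ℤ) (μ ν : Multiset (Q × ℤ × ℤ)) : low k (μ + ν) = low k μ + low k ν :=
  Multiset.filter_add _ _ _

theorem low_low {k l : ℤ} (hkl : k ≤ l) (μ : Multiset (Q × ℤ × ℤ)) : low k (low l μ) = low k μ := by
  simp only [low, Multiset.filter_filter]
  refine Multiset.filter_congr fun e _ => ?_
  constructor
  · exact fun h => h.1
  · exact fun h => ⟨h, by omega⟩

theorem levelSum_low {k l : ℤ} (hkl : k < l) (μ : Multiset (Q × ℤ × ℤ)) :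
    levelSum k (low l μ) = levelSum k μ := by
  induction μ using Multiset.induction_on with
  | empty => rfl
  | cons e μ ih =>
    by_cases he : e.2.1 < l
    · rw [low_cons_of_lt _ he, levelSum_cons, levelSum_cons, ih]
    · rw [low_cons_of_not_lt _ he, levelSum_cons, ih, if_neg (by omega), zero_add]

theorem levelCount_low {k l : ℤ} (hkl : k < l) (μ : Multiset (Q × ℤ × ℤ)) :
    levelCount k (low l μ) = levelCount k μ := by
  induction μ using Multiset.induction_on with
  | empty => rfl
  | cons e μ ih =>
    by_cases he : e.2.1 < l
    · rw [low_cons_of_lt _ he, levelCount_cons, levelCount_cons, ih]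
    · rw [low_cons_of_not_lt _ he, levelCount_cons, ih, if_neg (by omega), zero_add]

theorem levelSum_of_forall_lt {k : ℤ} {μ : Multiset (Q × ℤ × ℤ)} (h : ∀ e ∈ μ, e.2.1 < k) :
    levelSum k μ = 0 := by
  induction μ using Multiset.induction_on with
  | empty => rfl
  | cons e μ ih =>
    have := h e (Multiset.mem_cons_self _ _)
    rw [levelSum_cons, if_neg (by omega), ih fun e he => h e (Multiset.mem_cons_of_mem he), zero_add]

/-- A walk to a higher level has a first step that leads above its initial level. -/
theorem Walk.exists_first_rise {p' : Q} {h : ℤ} (n : ℕ) :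
    ∀ {p : Q} {k : ℤ} {μ : Multiset (Q × ℤ × ℤ)}, μ.card ≤ n → N.Walk p k p' h μ → k < h →
      ∃ p₁ p₂ α β, N.Walk p k p₁ k α ∧ (∀ e ∈ α, e.2.1 ≤ k) ∧ N.up p₁ p₂ ∧
        N.Walk p₂ (k + 1) p' h β ∧ μ = α + (p₁, k, 0) ::ₘ β := by
  induction n with
  | zero =>
    intro p k μ hn hw hk
    cases hw with
    | nil => omega
    | cons => simp at hn
  | succ n ih =>
    intro p k μ hn hw hk
    cases hw with
    | nil => omega
    | @cons _ _ v p'' h'' _ _ μ he hw =>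
      rw [Multiset.card_cons] at hn
      rcases he with ⟨rfl, hf⟩ | ⟨rfl, rfl, hu⟩ | ⟨rfl, rfl, hd⟩
      · obtain ⟨p₁, p₂, α, β, h1, h2, h3, h4, rfl⟩ := ih (by omega) hw hk
        refine ⟨p₁, p₂, (p, h'', v) ::ₘ α, β, .cons (.inl ⟨rfl, hf⟩) h1, ?_, h3, h4,
          by simp only [← Multiset.singleton_add]; abel⟩
        intro e he
        rcases Multiset.mem_cons.mp he with rfl | he
        exacts [le_rfl, h2 e he]
      · exact ⟨p, p'', 0, μ, .nil _ _, by simp, hu, hw, by simp⟩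
      -- After a descent, the first rise from level k - 1 leads back to level k. What remains is
      -- again shorter, so the induction hypothesis applies a second time.
      · obtain ⟨p₁, p₂, α, β, h1, h2, h3, h4, rfl⟩ := ih (by omega) hw (by omega)
        rw [sub_add_cancel] at h4
        rw [Multiset.card_add, Multiset.card_cons] at hn
        obtain ⟨p₃, p₄, α', β', h1', hle, h3', h4', rfl⟩ := ih (by omega) h4 hk
        refine ⟨p₃, p₄, (p, k, 0) ::ₘ (α + (p₁, k - 1, 0) ::ₘ α'), β',
          .cons (.inr (.inr ⟨rfl, rfl, hd⟩))
            (h1.trans (.cons (.inr (.inl ⟨by ring, rfl, h3⟩)) h1')), ?_, h3', h4',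
          by simp only [← Multiset.singleton_add]; abel⟩
        intro e he
        simp only [Multiset.mem_cons, Multiset.mem_add] at he
        rcases he with rfl | he | rfl | he
        · exact le_rfl
        · have := h2 e he; omega
        · simp
        · exact hle e he

/-- A walk that does not rise above the level of its ends is a chain of edges on this level and
of segments below it. -/
theorem Walk.exists_chain {p' : Q} {k : ℤ} (n : ℕ) :
    ∀ {p : Q} {μ : Multiset (Q × ℤ × ℤ)}, μ.card ≤ n → N.Walk p k p' k μ →
      (∀ e ∈ μ, e.2.1 ≤ k) → ∃ X S ν, Chain (N.flat k) p X (levelSum k μ) S p' ∧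
        N.BelowReal k X ν ∧ (∀ e ∈ μ, e.2.1 = k → e.1 ∈ S) ∧ p' ∈ S ∧ low k μ = low k ν ∧
        X.length ≤ levelCount k μ := by
  induction n with
  | zero =>
    intro p μ hn hw _
    cases hw with
    | nil => exact ⟨[], {p'}, 0, .nil p', .nil, by simp, rfl, rfl, by simp⟩
    | cons => simp at hn
  | succ n ih =>
    intro p μ hn hw hle
    cases hw with
    | nil => exact ⟨[], {p'}, 0, .nil p', .nil, by simp, rfl, rfl, by simp⟩
    | @cons _ _ v p'' h'' _ _ μ he hw =>
      rw [Multiset.card_cons] at hn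
      have hle' : ∀ e ∈ μ, e.2.1 ≤ k := fun e he => hle e (Multiset.mem_cons_of_mem he)
      rcases he with ⟨rfl, hf⟩ | ⟨rfl, rfl, hu⟩ | ⟨rfl, rfl, hd⟩
      · obtain ⟨X, S, ν, h1, h2, h3, h4, h5, h6⟩ := ih (by omega) hw hle'
        refine ⟨X, insert p S, ν, ?_, h2, ?_, .inr h4, ?_, ?_⟩
        · rw [levelSum_cons, if_pos rfl]; exact .flat hf h1
        · intro e he hek
          rcases Multiset.mem_cons.mp he with rfl | he
          exacts [.inl rfl, .inr (h3 e he hek)]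
        · rw [low_cons_of_not_lt _ (by simp), h5]
        · rw [levelCount_cons]; omega
      -- After a step up, the walk either ends above level k or has an edge starting there; both are
      -- excluded.
      · exfalso
        obtain ⟨l, hl⟩ : ∃ l, l = k + 1 := ⟨_, rfl⟩
        rw [← hl] at hw
        cases hw with
        | nil => omega
        | cons he hw =>
          have := hle' _ (Multiset.mem_cons_self _ _)
          simp only at this
          omega
      -- The first rise from level k - 1 closes the segment opened by the step down.
      · obtain ⟨p₁, p₂, α, β, h1, h2, h3, h4, rfl⟩ :=
          Walk.exists_first_rise (μ.card) le_rfl hw (by omega)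
        rw [sub_add_cancel] at h4
        rw [Multiset.card_add, Multiset.card_cons] at hn
        obtain ⟨X, S, ν, h5, h6, h7, h8, h9, h10⟩ := ih (by omega) h4 fun e he =>
          hle' e (by simp [he])
        refine ⟨(p, p₂) :: X, insert p S, _, ?_, .cons hd h1 h2 h3 h6, ?_, .inr h8, ?_, ?_⟩
        · have : levelSum k ((p, k, 0) ::ₘ (α + (p₁, k - 1, 0) ::ₘ β)) = levelSum k β := by
            rw [levelSum_cons, levelSum_add, levelSum_cons, levelSum_of_forall_lt fun e he => ?_]
            · simp
            · have := h2 e he; omega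
          rw [this]
          exact .seg h5
        · intro e he hek
          simp only [Multiset.mem_cons, Multiset.mem_add] at he
          rcases he with rfl | he | rfl | he
          · exact .inl rfl
          · have := h2 e he; omega
          · simp at hek
          · exact .inr (h7 e he hek)
        · rw [low_cons_of_not_lt _ (by simp), low_cons_of_not_lt _ (by simp), low_add,
            low_cons_of_lt _ (by simp), low_cons_of_lt _ (by simp), low_add, h9]
          simp
        · rw [levelCount_cons, levelCount_add, levelCount_cons, List.length_cons]
          simp
          omega

/-- Without its first and last edge a segment does not rise above level h - 1, so it is a chain
there. Comparing the edges below the level lets later levels be counted in the original multiset. -/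
theorem BelowReal.exists_groups {h : ℤ} {Y : List (Q × Q)} {μ : Multiset (Q × ℤ × ℤ)}
    (hb : N.BelowReal h Y μ) : ∃ X S ν,
      Groups (N.flat (h - 1)) N.up N.down X (levelSum (h - 1) μ) S Y ∧ N.BelowReal (h - 1) X ν ∧
      (∀ e ∈ μ, e.2.1 = h - 1 → e.1 ∈ S) ∧ low (h - 1) μ = low (h - 1) ν ∧
      X.length ≤ levelCount (h - 1) μ := by
  induction hb with
  | nil => exact ⟨[], ∅, 0, .nil, .nil, by simp, rfl, by simp⟩
  | @cons p p₀ p₁ p' Y α β hd hw hle hu _ ih =>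
    obtain ⟨X', S', ν', h1, h2, h3, h4, h5⟩ := ih
    obtain ⟨X, S, ν, g1, g2, g3, g4, g5, g6⟩ := Walk.exists_chain α.card le_rfl hw hle
    have happ : N.BelowReal (h - 1) (X ++ X') (ν + ν') := by
      clear g1 g3 g4 g5 g6
      induction g2 with
      | nil => simpa using h2
      | cons a1 a2 a3 a4 _ ih =>
        rw [Multiset.cons_add, Multiset.cons_add, add_assoc]
        exact .cons a1 a2 a3 a4 ih
    refine ⟨X ++ X', S ∪ S', ν + ν', ?_, happ, ?_, ?_, ?_⟩
    · have : levelSum (h - 1) ((p, h, 0) ::ₘ (p₁, h - 1, 0) ::ₘ (α + β)) =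
          levelSum (h - 1) α + levelSum (h - 1) β := by
        rw [levelSum_cons, levelSum_cons, levelSum_add]
        simp
      rw [this]
      exact .cons hd g1 hu h1
    · intro e he hek
      simp only [Multiset.mem_cons, Multiset.mem_add] at he
      rcases he with rfl | rfl | he | he
      · simp only at hek
        omega
      · exact .inl g4
      · exact .inl (g3 e he hek)
      · exact .inr (h3 e he hek)
    · rw [low_cons_of_not_lt _ (by simp), low_cons_of_not_lt _ (by simp), low_add, low_add, g5, h4]
    · rw [levelCount_cons, levelCount_cons, levelCount_add, List.length_append]
      omega

/-! ### A finite automaton that reads digits -/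

/-- The states of the automaton: the segments that cross the current level, a carry, and the states
at which closed walks may be inserted. -/
abbrev CrossState (Q : Type) : Type := List (Q × Q) × ℤ × Set Q

/-- One step of the automaton, on reading the digit `d`. -/
def CrossStep [Fintype Q] (F : Q → ℤ → Q → Prop) (up down : Q → Q → Prop) (M : Q → AddSubmonoid ℤ)
    (q d : ℕ) (σ τ : CrossState Q) : Prop :=
  ∃ (v : ℤ) (S : Set Q) (z : Q → ℤ), Groups F up down σ.1 v S τ.1 ∧
    -- One inclusion suffices: the automaton may forget visited states but cannot invent any.
    (∀ y ∈ τ.2.2, y ∈ σ.2.2 ∨ y ∈ S) ∧ (∀ y, z y ∈ M y) ∧ (∀ y, z y ≠ 0 → y ∈ τ.2.2) ∧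
    σ.2.1 + d = v + ∑ y, z y + q * τ.2.1

/-- The states with at most `B` segments and a carry of at most `K`. -/
def CrossState.Bounded (B K : ℕ) (σ : CrossState Q) : Prop := σ.1.length ≤ B ∧ σ.2.1.natAbs ≤ K

theorem CrossState.finite_bounded [Finite Q] (B K : ℕ) :
    Finite {σ : CrossState Q // σ.Bounded B K} := by
  have h1 : {X : List (Q × Q) | X.length ≤ B}.Finite := List.finite_length_le _ _
  have h2 : {e : ℤ | e.natAbs ≤ K}.Finite := by
    refine (Set.finite_Icc (-(K : ℤ)) K).subset fun e he => ?_
    simp only [Set.mem_ofPred_eq, Set.mem_Icc] at he ⊢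
    omega
  refine Set.Finite.to_subtype ((h1.prod (h2.prod (Set.finite_univ (α := Set Q)))).subset ?_)
  rintro ⟨X, e, A⟩ ⟨hX, he⟩
  exact ⟨hX, he, trivial⟩

/-- The states reached by reading the digits `dig` from level `a` upwards. -/
inductive CrossReach [Fintype Q] (N : LevelNet Q) (M : Q → AddSubmonoid ℤ) (q B K : ℕ) (a : ℤ)
    (dig : ℕ → ℕ) : ℕ → CrossState Q → Prop
  | init : CrossReach N M q B K a dig 0 ([], 0, ∅)
  | step {i : ℕ} {σ σ' : CrossState Q} : CrossReach N M q B K a dig i σ →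
      CrossStep (N.flat (a + i)) N.up N.down M q (dig i) σ σ' → σ'.Bounded B K →
      CrossReach N M q B K a dig (i + 1) σ'

/-- Soundness. Along a run, the carry times the current power of q plus the value of the walks built
so far equals the number read so far. -/
theorem CrossReach.exists_real [Fintype Q] {M : Q → AddSubmonoid ℤ} {q B K : ℕ} (hq : 2 ≤ q)
    (hM : ∀ y, ∀ z ∈ M y, ∀ k, ∃ γ, N.Walk y k y k γ ∧ val q γ = z * (q : ℚ) ^ k) {a : ℤ}
    {dig : ℕ → ℕ} {i : ℕ} {σ : CrossState Q} (hσ : CrossReach N M q B K a dig i σ) :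
    ∃ μ, N.Real (a + i) σ.1 μ ∧ (∀ y ∈ σ.2.2, ∃ k ≤ a + i, ∃ u, (y, k, u) ∈ μ) ∧
      σ.2.1 * (q : ℚ) ^ (a + i) + val q μ =
        ∑ j ∈ Finset.range i, (dig j : ℚ) * (q : ℚ) ^ (a + j) := by
  have hq0 : (q : ℚ) ≠ 0 := by positivity
  induction hσ with
  | init => exact ⟨0, .nil, by simp, by simp⟩
  | @step i σ σ' _ hstep _ ih =>
    obtain ⟨μ, h1, h2, h3⟩ := ih
    obtain ⟨v, S, z, g1, g2, g3, g4, g5⟩ := hstep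
    obtain ⟨ν, k1, k2, k3, k4⟩ := g1.exists_real (q := q) h1
    have hvis : ∀ y ∈ σ'.2.2, ∃ k ≤ a + i, ∃ u, (y, k, u) ∈ ν := by
      intro y hy
      rcases g2 y hy with hy | hy
      · obtain ⟨k, hk, u, hu⟩ := h2 y hy
        exact ⟨k, hk, u, Multiset.mem_of_le k3 hu⟩
      · obtain ⟨u, hu⟩ := k4 y hy
        exact ⟨a + i, le_rfl, u, hu⟩
    obtain ⟨ν', l1, l2, l3⟩ := k1.insert_sum hq hM (a + i) z g3 (fun y hy => hvis y (g4 y hy))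
      Finset.univ
    refine ⟨ν', ?_, fun y hy => ?_, ?_⟩
    · push_cast; rw [← add_assoc]; exact l1
    · obtain ⟨k, hk, u, hu⟩ := hvis y hy
      exact ⟨k, by push_cast; omega, u, Multiset.mem_of_le l2 hu⟩
    · rw [Finset.sum_range_succ, ← h3, l3, k2]
      have g6 : (σ.2.1 : ℚ) + dig i = v + (∑ y, z y : ℤ) + q * σ'.2.1 := by exact_mod_cast g5
      have : (q : ℚ) ^ (a + (i + 1 : ℕ)) = q * (q : ℚ) ^ (a + i) := by
        push_cast
        rw [← add_assoc, zpow_add_one₀ hq0, mul_comm]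
      rw [this]
      linear_combination (-(q : ℚ) ^ (a + (i : ℤ))) * g6

/-- Completeness. The walk `μ` is taken apart from the top: each step peels one level off the
segments, whose edges below the current level remain those of `μ`, so the level counts of `μ` bound
the number of segments. Carries, insertions and visited sets are prescribed beforehand. -/
theorem CrossReach.of_belowReal [Fintype Q] {M : Q → AddSubmonoid ℤ} {q B K : ℕ} {a : ℤ}
    {dig : ℕ → ℕ} {μ : Multiset (Q × ℤ × ℤ)} {I : ℕ} {e : ℕ → ℤ} {A : ℕ → Set Q}
    {z : ℕ → Q → ℤ} (ha : ∀ x ∈ μ, a ≤ x.2.1) (hB : ∀ k, levelCount k μ ≤ B)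
    (he0 : e 0 = 0) (hA0 : A 0 = ∅) (heK : ∀ i ≤ I, (e i).natAbs ≤ K)
    (hA : ∀ i < I, ∀ y ∈ A (i + 1), y ∈ A i ∨ ∃ u, (y, a + i, u) ∈ μ)
    (hz : ∀ i y, z i y ∈ M y) (hzA : ∀ i < I, ∀ y, z i y ≠ 0 → y ∈ A (i + 1))
    (he : ∀ i < I, e i + dig i = levelSum (a + i) μ + ∑ y, z i y + q * e (i + 1)) :
    ∀ i ≤ I, ∀ X ν, N.BelowReal (a + i) X ν → low (a + i) ν = low (a + i) μ → X.length ≤ B →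
      CrossReach N M q B K a dig i (X, e i, A i) := by
  intro i
  induction i with
  | zero =>
    intro _ X ν hX hlow _
    have : X = [] := by
      -- A segment below the lowest level would have an edge starting on level a - 1.
      cases hX with
      | nil => rfl
      | @cons p p₀ p₁ p' X α β _ _ _ _ _ =>
        exfalso
        have h1 : (p₁, a + (0 : ℕ) - 1, (0 : ℤ)) ∈
            low (a + (0 : ℕ)) ((p, a + ((0 : ℕ) : ℤ), (0 : ℤ)) ::ₘ (p₁, a + (0 : ℕ) - 1, 0) ::ₘ (α + β)) := by
          simp [low]
        rw [hlow, low, Multiset.mem_filter] at h1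
        have := ha _ h1.1
        simp at this
    rw [this, he0, hA0]
    exact .init
  | succ i ih =>
    intro hi X ν hX hlow hXB
    obtain ⟨X', S, ν', h1, h2, h3, h4, h5⟩ := hX.exists_groups
    have hlev : a + ((i + 1 : ℕ) : ℤ) - 1 = a + i := by push_cast; ring
    rw [hlev] at h1 h2 h3 h4 h5
    have hlt : a + (i : ℤ) < a + ((i + 1 : ℕ) : ℤ) := by push_cast; omega
    have hsum : levelSum (a + i) ν = levelSum (a + i) μ := by
      rw [← levelSum_low hlt, hlow, levelSum_low hlt]
    have hcount : levelCount (a + i) ν = levelCount (a + i) μ := by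
      rw [← levelCount_low hlt, hlow, levelCount_low hlt]
    refine .step (ih (by omega) X' ν' h2 ?_ ?_) ⟨_, S, z i, h1, fun y hy => ?_, hz i,
      hzA i (by omega), ?_⟩ ⟨hXB, heK _ hi⟩
    · rw [← h4, ← low_low hlt.le, hlow, low_low hlt.le]
    · exact h5.trans (hcount ▸ hB _)
    · rcases hA i (by omega) y hy with hy | ⟨u, hu⟩
      · exact .inl hy
      · refine .inr (h3 (y, a + i, u) ?_ rfl)
        have h6 : (y, a + (i : ℤ), u) ∈ low (a + ((i + 1 : ℕ) : ℤ)) μ :=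
          Multiset.mem_filter.mpr ⟨hu, hlt⟩
        rw [← hlow] at h6
        exact (Multiset.mem_filter.mp h6).1
    · rw [hsum]
      exact he i (by omega)

end LevelNet

/-! ### Walks between two vertices as segments below all levels -/

namespace LevelNet

variable {Q : Type}

/-- The edges within a level of the extended graph. Its additional state `inr false` descends to
level `0` and turns into `s` there, and on level `m` the state `f` may turn into the additional
state `inr true`, which ascends. The flags tell whether the level is `0` and whether it is `m`. -/
def extFlat (F : Q → ℤ → Q → Prop) (s f : Q) (b b' : Bool) : Q ⊕ Bool → ℤ → Q ⊕ Bool → Prop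
  | .inl p, v, .inl p' => F p v p'
  | .inr false, v, .inl p => b = true ∧ v = 0 ∧ p = s
  | .inl p, v, .inr true => b' = true ∧ v = 0 ∧ p = f
  | _, _, _ => False

/-- The edges of the extended graph that lead one level up. -/
def extUp (up : Q → Q → Prop) : Q ⊕ Bool → Q ⊕ Bool → Prop
  | .inl p, .inl p' => up p p'
  | .inr true, .inr true => True
  | _, _ => False

/-- The edges of the extended graph that lead one level down. -/
def extDown (down : Q → Q → Prop) : Q ⊕ Bool → Q ⊕ Bool → Prop
  | .inl p, .inl p' => down p p'
  | .inr false, .inr false => True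
  | _, _ => False

/-- The extended graph. -/
def ext (N : LevelNet Q) (s f : Q) (m : ℤ) : LevelNet (Q ⊕ Bool) where
  -- The additional states turn a walk with ends on levels 0 and m into one segment below a high
  -- level, so that the automaton starts without segments and ends with exactly this one.
  flat h := extFlat (N.flat 0) s f (decide (h = 0)) (decide (h = m))
  up := extUp N.up
  down := extDown N.down

/-- The closed walks that may be inserted into walks in the extended graph. -/
def extLoops (N : LevelNet Q) (q : ℕ) : Q ⊕ Bool → AddSubmonoid ℤ :=
  Sum.elim (N.loopValues q) fun _ => ⊥

/-- Edges as edges of the extended graph. -/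
def liftEdge (e : Q × ℤ × ℤ) : (Q ⊕ Bool) × ℤ × ℤ := (.inl e.1, e.2)

variable {N : LevelNet Q} {s f : Q} {m : ℤ}

theorem val_lift (q : ℕ) (μ : Multiset (Q × ℤ × ℤ)) : val q (μ.map liftEdge) = val q μ := by
  simp only [val, Multiset.map_map]
  rfl

theorem levelSum_lift (k : ℤ) (μ : Multiset (Q × ℤ × ℤ)) :
    levelSum k (μ.map liftEdge) = levelSum k μ := by
  simp only [levelSum, Multiset.map_map]
  rfl

theorem levelCount_lift (k : ℤ) (μ : Multiset (Q × ℤ × ℤ)) :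
    levelCount k (μ.map liftEdge) = levelCount k μ := by
  simp only [levelCount, Multiset.map_map]
  rfl

theorem Walk.lift (hN : N.Homogeneous) {p p' : Q} {h h' : ℤ} {μ : Multiset (Q × ℤ × ℤ)}
    (hw : N.Walk p h p' h' μ) :
    (N.ext s f m).Walk (.inl p) h (.inl p') h' (μ.map liftEdge) := by
  induction hw with
  | nil => exact .nil _ _
  | cons he _ ih =>
    rw [Multiset.map_cons]
    refine .cons ?_ ih
    rcases he with ⟨rfl, h1⟩ | ⟨rfl, h1⟩ | ⟨rfl, h1⟩
    · exact .inl ⟨rfl, by rw [hN _ 0] at h1; exact h1⟩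
    · exact .inr (.inl ⟨rfl, h1⟩)
    · exact .inr (.inr ⟨rfl, h1⟩)

theorem exists_walk_of_mem_extLoops (hN : N.Homogeneous) {q : ℕ} (hq : 2 ≤ q) (y : Q ⊕ Bool)
    (z : ℤ) (hz : z ∈ N.extLoops q y) (k : ℤ) :
    ∃ γ, (N.ext s f m).Walk y k y k γ ∧ val q γ = z * (q : ℚ) ^ k := by
  cases y with
  | inl p =>
    obtain ⟨γ, hγ, hv⟩ := hz
    have h1 := (hγ.shift hN k).lift (s := s) (f := f) (m := m) hN
    rw [zero_add] at h1
    exact ⟨_, h1, by rw [val_lift, val_shift hq, hv, mul_comm]⟩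
  | inr b =>
    obtain rfl : z = 0 := hz
    exact ⟨0, .nil _ _, by simp⟩

/-- A walk between the additional states contains a walk from `(s, 0)` to `(f, m)` with the same
value. -/
theorem Walk.of_ext (hN : N.Homogeneous) {q : ℕ} {x y : Q ⊕ Bool} {h h' : ℤ}
    {μ : Multiset ((Q ⊕ Bool) × ℤ × ℤ)} (hw : (N.ext s f m).Walk x h y h' μ) (hy : y = .inr true) :
    (∀ p, x = .inl p → ∃ ν, N.Walk p h f m ν ∧ val q ν = val q μ) ∧
    (x = .inr false → ∃ ν, N.Walk s 0 f m ν ∧ val q ν = val q μ) ∧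
    (x = .inr true → val q μ = 0) := by
  induction hw with
  | nil x h => subst hy; simp
  | @cons x h v x' h₁ y h' μ he _ ih =>
    obtain ⟨ih1, ih2, ih3⟩ := ih hy
    refine ⟨?_, ?_, ?_⟩
    · rintro p rfl
      rcases x' with p' | _ | _
      · obtain ⟨ν, h1, h2⟩ := ih1 p' rfl
        refine ⟨(p, h, v) ::ₘ ν, .cons ?_ h1, by simp [h2]⟩
        rcases he with ⟨rfl, h3⟩ | ⟨rfl, h3⟩ | ⟨rfl, h3⟩
        · exact .inl ⟨rfl, by rw [hN _ 0]; exact h3⟩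
        · exact .inr (.inl ⟨rfl, h3⟩)
        · exact .inr (.inr ⟨rfl, h3⟩)
      · rcases he with ⟨_, h3⟩ | ⟨_, _, h3⟩ | ⟨_, _, h3⟩ <;> exact h3.elim
      · rcases he with ⟨rfl, h3, rfl, rfl⟩ | ⟨_, _, h3⟩ | ⟨_, _, h3⟩
        · obtain rfl : h₁ = m := of_decide_eq_true h3
          exact ⟨0, .nil _ _, by simp [ih3 rfl]⟩
        · exact h3.elim
        · exact h3.elim
    · rintro rfl
      rcases x' with p' | _ | _
      · rcases he with ⟨rfl, h3, rfl, rfl⟩ | ⟨_, _, h3⟩ | ⟨_, _, h3⟩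
        · obtain rfl : h₁ = 0 := of_decide_eq_true h3
          obtain ⟨ν, h1, h2⟩ := ih1 _ rfl
          exact ⟨ν, h1, by simp [h2]⟩
        · exact h3.elim
        · exact h3.elim
      · obtain ⟨ν, h1, h2⟩ := ih2 rfl
        rcases he with ⟨_, h3⟩ | ⟨_, _, h3⟩ | ⟨_, rfl, h3⟩
        · exact h3.elim
        · exact h3.elim
        · exact ⟨ν, h1, by simp [h2]⟩
      · rcases he with ⟨_, h3⟩ | ⟨_, _, h3⟩ | ⟨_, _, h3⟩ <;> exact h3.elim
    · rintro rfl
      rcases x' with p' | _ | _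
      · rcases he with ⟨_, h3⟩ | ⟨_, _, h3⟩ | ⟨_, _, h3⟩ <;> exact h3.elim
      · rcases he with ⟨_, h3⟩ | ⟨_, _, h3⟩ | ⟨_, _, h3⟩ <;> exact h3.elim
      · rcases he with ⟨_, h3⟩ | ⟨_, rfl, h3⟩ | ⟨_, _, h3⟩
        · exact h3.elim
        · simp [ih3 rfl]
        · exact h3.elim

theorem levelSum_of_forall_eq_zero {k : ℤ} {μ : Multiset (Q × ℤ × ℤ)} (h : ∀ e ∈ μ, e.2.2 = 0) :
    levelSum k μ = 0 := by
  induction μ using Multiset.induction_on with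
  | empty => rfl
  | cons e μ ih =>
    rw [levelSum_cons, h e (Multiset.mem_cons_self _ _),
      ih fun e he => h e (Multiset.mem_cons_of_mem he)]
    simp

theorem levelCount_of_forall_ne {k : ℤ} {μ : Multiset (Q × ℤ × ℤ)} (h : ∀ e ∈ μ, e.2.1 ≠ k) :
    levelCount k μ = 0 := by
  induction μ using Multiset.induction_on with
  | empty => rfl
  | cons e μ ih =>
    rw [levelCount_cons, if_neg (h e (Multiset.mem_cons_self _ _)),
      ih fun e he => h e (Multiset.mem_cons_of_mem he)]

theorem ext_down : (N.ext s f m).down (.inr false) (.inr false) := by simp [ext, extDown]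

theorem ext_up : (N.ext s f m).up (.inr true) (.inr true) := by simp [ext, extUp]

theorem exists_descent (N : LevelNet Q) (s f : Q) (m h : ℤ) (n : ℕ) :
    ∃ δ, (N.ext s f m).Walk (.inr false) (h + n) (.inr false) h δ ∧
      (∀ e ∈ δ, h < e.2.1 ∧ e.2.1 ≤ h + n ∧ e.2.2 = 0) ∧ ∀ k, levelCount k δ ≤ 1 := by
  induction n with
  | zero => exact ⟨0, by simpa using Walk.nil _ _, by simp, by simp [levelCount_zero]⟩
  | succ n ih =>
    obtain ⟨δ, h1, h2, h3⟩ := ih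
    refine ⟨(.inr false, h + (n + 1 : ℕ), 0) ::ₘ δ,
      .cons (.inr (.inr ⟨by push_cast; ring, rfl, ext_down⟩)) h1, fun e he => ?_, fun k => ?_⟩
    · rcases Multiset.mem_cons.mp he with rfl | he
      · simp only [and_true]; omega
      · obtain ⟨g1, g2, g3⟩ := h2 e he
        exact ⟨g1, by push_cast; omega, g3⟩
    · rw [levelCount_cons]
      split_ifs with hk
      · rw [levelCount_of_forall_ne]
        intro e he
        have := h2 e he
        push_cast at hk
        omega
      · simpa using h3 k

theorem exists_ascent (N : LevelNet Q) (s f : Q) (m h : ℤ) (n : ℕ) :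
    ∃ δ, (N.ext s f m).Walk (.inr true) h (.inr true) (h + n) δ ∧
      (∀ e ∈ δ, h ≤ e.2.1 ∧ e.2.1 < h + n ∧ e.2.2 = 0) ∧ ∀ k, levelCount k δ ≤ 1 := by
  induction n with
  | zero => exact ⟨0, by simpa using Walk.nil _ _, by simp, by simp [levelCount_zero]⟩
  | succ n ih =>
    obtain ⟨δ, h1, h2, h3⟩ := ih
    have hw := h1.trans (.single (v := 0) (p' := .inr true) (h' := h + (n + 1 : ℕ))
      (.inr (.inl ⟨by push_cast; ring, rfl, ext_up⟩)))
    rw [add_comm δ, Multiset.singleton_add] at hw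
    refine ⟨_, hw, fun e he => ?_, fun k => ?_⟩
    · rcases Multiset.mem_cons.mp he with rfl | he
      · simp only [and_true]; omega
      · obtain ⟨g1, g2, g3⟩ := h2 e he
        exact ⟨g1, by push_cast; omega, g3⟩
    · rw [levelCount_cons]
      split_ifs with hk
      · rw [levelCount_of_forall_ne]
        intro e he
        have := h2 e he
        simp only at hk
        omega
      · simpa using h3 k

/-- A walk from `(s, 0)` to `(f, m)` extends to a segment below a high level. -/
theorem Walk.exists_belowReal (hN : N.Homogeneous) {μ : Multiset (Q × ℤ × ℤ)}
    (hw : N.Walk s 0 f m μ) {H : ℤ} (h0 : 0 < H) (hm : m < H) (hμ : ∀ e ∈ μ, e.2.1 < H) :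
    ∃ ν, (N.ext s f m).BelowReal H [(.inr false, .inr true)] ν ∧
      (∀ e ∈ μ, liftEdge e ∈ ν) ∧ (∀ k, levelSum k ν = levelSum k μ) ∧
      (∀ k, levelCount k ν ≤ levelCount k μ + 6) ∧
      ∀ k, k ≤ 0 → k ≤ m → (∀ e ∈ μ, k ≤ e.2.1) → ∀ e ∈ ν, k ≤ e.2.1 := by
  obtain ⟨δ, d1, d2, d3⟩ := exists_descent N s f m 0 (H - 1).toNat
  obtain ⟨ε, a1, a2, a3⟩ := exists_ascent N s f m m (H - 1 - m).toNat
  have e1 : (0 : ℤ) + (H - 1).toNat = H - 1 := by omega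
  have e2 : m + ((H - 1 - m).toNat : ℤ) = H - 1 := by omega
  rw [e1] at d1 d2
  rw [e2] at a1 a2
  have hmid := hw.lift (s := s) (f := f) (m := m) hN
  have hwalk : (N.ext s f m).Walk (.inr false) (H - 1) (.inr true) (H - 1)
      (δ + (.inr false, 0, 0) ::ₘ (μ.map liftEdge + (.inl f, m, 0) ::ₘ ε)) :=
    d1.trans (.cons (.inl ⟨rfl, by simp [ext, extFlat]⟩)
      (hmid.trans (.cons (.inl ⟨rfl, by simp [ext, extFlat]⟩) a1)))
  refine ⟨_, .cons (p₀ := .inr false) (p₁ := .inr true) ext_down hwalk ?_ ext_up .nil,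
    fun e he => ?_, fun k => ?_, fun k => ?_, fun k hk hkm hk' e he => ?_⟩
  · intro e he
    simp only [Multiset.mem_add, Multiset.mem_cons, Multiset.mem_map] at he
    rcases he with he | rfl | ⟨e, he, rfl⟩ | rfl | he
    · exact (d2 e he).2.1
    · simp only; omega
    · have := hμ e he
      simp only [liftEdge]
      omega
    · simp only; omega
    · have := a2 e he
      omega
  · simp only [Multiset.mem_add, Multiset.mem_cons, Multiset.mem_map]
    exact .inr (.inr (.inl (.inr (.inr (.inl ⟨e, he, rfl⟩)))))
  · simp only [levelSum_cons, levelSum_add, levelSum_lift, levelSum_zero,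
      levelSum_of_forall_eq_zero (fun e he => (d2 e he).2.2),
      levelSum_of_forall_eq_zero (fun e he => (a2 e he).2.2)]
    simp
  -- At most one edge of `δ`, one of `ε` and the four single edges start on a given level, which
  -- makes 6.
  · have h1 := d3 k
    have h2 := a3 k
    simp only [levelCount_cons, levelCount_add, levelCount_lift, levelCount_zero]
    split_ifs <;> omega
  · simp only [Multiset.mem_add, Multiset.mem_cons, Multiset.mem_map, Multiset.notMem_zero,
      or_false] at he
    rcases he with rfl | rfl | he | rfl | ⟨e, he, rfl⟩ | rfl | he
    · simp only; omega
    · simp only; omega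
    · have := d2 e he; omega
    · simp only; omega
    · exact hk' e he
    · exact hkm
    · have := a2 e he; omega

theorem levelCount_eq_sum [Fintype Q] [DecidableEq Q] (k : ℤ) (μ : Multiset (Q × ℤ × ℤ)) :
    levelCount k μ = ∑ p, (μ.map vertex).count (p, k) := by
  induction μ using Multiset.induction_on with
  | empty => simp [levelCount_zero]
  | cons e μ ih =>
    rw [levelCount_cons, ih]
    simp only [Multiset.map_cons, Multiset.count_cons, Finset.sum_add_distrib, vertex,
      Prod.mk.injEq]
    rw [add_comm]
    congr 1
    by_cases hk : e.2.1 = k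
    · simp [hk]
    · simp [hk, Ne.symm hk]

theorem Walk.natAbs_value_le (hv : ∀ h p v p', N.flat h p v p' → v.natAbs ≤ 1) {p p' : Q}
    {h h' : ℤ} {μ : Multiset (Q × ℤ × ℤ)} (hw : N.Walk p h p' h' μ) :
    ∀ e ∈ μ, e.2.2.natAbs ≤ 1 := by
  induction hw with
  | nil => simp
  | cons he _ ih =>
    intro e he'
    rcases Multiset.mem_cons.mp he' with rfl | he'
    · rcases he with ⟨_, h1⟩ | ⟨_, rfl, _⟩ | ⟨_, rfl, _⟩
      · exact hv _ _ _ _ h1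
      · simp
      · simp
    · exact ih e he'

theorem natAbs_levelSum_le {k : ℤ} {μ : Multiset (Q × ℤ × ℤ)} (h : ∀ e ∈ μ, e.2.2.natAbs ≤ 1) :
    (levelSum k μ).natAbs ≤ levelCount k μ := by
  induction μ using Multiset.induction_on with
  | empty => simp [levelSum_zero, levelCount_zero]
  | cons e μ ih =>
    have h1 := ih fun e he => h e (Multiset.mem_cons_of_mem he)
    have h2 := h e (Multiset.mem_cons_self _ _)
    rw [levelSum_cons, levelCount_cons]
    split_ifs <;> omega

theorem val_eq_sum_levelSum {q : ℕ} {a : ℤ} {I : ℕ} {μ : Multiset (Q × ℤ × ℤ)}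
    (h : ∀ e ∈ μ, a ≤ e.2.1 ∧ e.2.1 < a + I) :
    val q μ = ∑ i ∈ Finset.range I, (levelSum (a + i) μ : ℚ) * (q : ℚ) ^ (a + i) := by
  induction μ using Multiset.induction_on with
  | empty => simp [levelSum_zero]
  | cons e μ ih =>
    rw [val_cons, ih fun e he => h e (Multiset.mem_cons_of_mem he)]
    obtain ⟨h1, h2⟩ := h e (Multiset.mem_cons_self _ _)
    simp only [levelSum_cons, Int.cast_add, add_mul, Finset.sum_add_distrib]
    congr 1
    obtain ⟨n, hn⟩ : ∃ n : ℕ, e.2.1 = a + n := ⟨(e.2.1 - a).toNat, by omega⟩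
    rw [Finset.sum_eq_single n]
    · simp [hn]
    · intro j _ hj
      rw [if_neg (by omega)]
      simp
    · intro hn'
      rw [Finset.mem_range] at hn'
      omega

end LevelNet

/-! ### Carries -/

/-- Backwards from the top, a carry c must be preceded by qc - b. Forwards, |q e (i + 1)| ≤ 2K and q
≥ 2 preserve the bound K. -/
theorem exists_carries {q K : ℕ} (hq : 2 ≤ q) (b : ℕ → ℤ) (I : ℕ) (hb : ∀ i < I, (b i).natAbs ≤ K)
    (c : ℤ) (hc : ∑ i ∈ Finset.range I, b i * (q : ℤ) ^ i = c * (q : ℤ) ^ I) :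
    ∃ e : ℕ → ℤ, e 0 = 0 ∧ e I = c ∧ (∀ i < I, e i + b i = q * e (i + 1)) ∧
      ∀ i ≤ I, (e i).natAbs ≤ K := by
  induction I generalizing c with
  | zero =>
    have : c = 0 := by simpa using hc.symm
    exact ⟨0, rfl, this.symm, by simp, by simp⟩
  | succ I ih =>
    obtain ⟨e, h1, h2, h3, h4⟩ := ih (fun i hi => hb i (by omega)) (q * c - b I) (by
      rw [Finset.sum_range_succ] at hc
      rw [eq_sub_of_add_eq hc]
      ring)
    have hcK : c.natAbs ≤ K := by
      have h5 := h4 I le_rfl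
      have h6 := hb I (by omega)
      rw [h2] at h5
      have h7 : (q * c).natAbs ≤ 2 * K := by omega
      rw [Int.natAbs_mul, Int.natAbs_natCast] at h7
      nlinarith
    refine ⟨fun i => if i ≤ I then e i else c, by simp [h1], by simp, fun i hi => ?_, fun i hi => ?_⟩
    · rcases Nat.lt_succ_iff_lt_or_eq.mp hi with hi' | rfl
      · simp only [show i ≤ I by omega, show i + 1 ≤ I by omega, if_true]
        exact h3 i hi'
      · simp [h2]
    · by_cases hi' : i ≤ I
      · simpa [hi'] using h4 i hi'
      · simpa [hi'] using hcK

/-! ### The digits on all levels -/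

/-- Digits on the levels `L, …, L + J - 1`, continued by `0` downwards and by the digits of `0` or
`-1` upwards. -/
def fullDigit (q : ℕ) (L : ℤ) (J : ℕ) (dig : ℕ → ℕ) (neg : Bool) (h : ℤ) : ℕ :=
  if h < L then 0 else if h < L + J then dig (h - L).toNat else if neg then q - 1 else 0

/-- Padding does not change the number: for a negative one, -q^h = (q - 1) q^h - q^(h + 1) as in
complement notation. -/
theorem sum_fullDigit {q : ℕ} (hq : 2 ≤ q) (L : ℤ) (J : ℕ) (dig : ℕ → ℕ) (neg : Bool)
    (n n' : ℕ) :
    ∑ i ∈ Finset.range (n + J + n'),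
        (fullDigit q L J dig neg (L - n + i) : ℚ) * (q : ℚ) ^ (L - n + (i : ℤ)) -
      (if neg then (q : ℚ) ^ (L - n + ((n + J + n' : ℕ) : ℤ)) else 0) =
    ∑ j ∈ Finset.range J, (dig j : ℚ) * (q : ℚ) ^ (L + (j : ℤ)) -
      (if neg then (q : ℚ) ^ (L + (J : ℤ)) else 0) := by
  have hq0 : (q : ℚ) ≠ 0 := by positivity
  induction n' with
  | zero =>
    rw [add_zero, Finset.sum_range_add]
    have h1 : ∑ i ∈ Finset.range n,
        (fullDigit q L J dig neg (L - n + i) : ℚ) * (q : ℚ) ^ (L - n + (i : ℤ)) = 0 := by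
      refine Finset.sum_eq_zero fun i hi => ?_
      rw [Finset.mem_range] at hi
      rw [fullDigit, if_pos (by omega)]
      simp
    rw [h1, zero_add]
    congr 1
    · refine Finset.sum_congr rfl fun j hj => ?_
      rw [Finset.mem_range] at hj
      have h2 : L - n + ((n + j : ℕ) : ℤ) = L + j := by push_cast; ring
      rw [h2, fullDigit, if_neg (by omega), if_pos (by omega)]
      simp
    · have h2 : L - n + ((n + J : ℕ) : ℤ) = L + J := by push_cast; ring
      rw [h2]
  | succ n' ih =>
    rw [← ih, ← add_assoc, Finset.sum_range_succ]
    have h1 : L - n + ((n + J + n' + 1 : ℕ) : ℤ) = L - n + ((n + J + n' : ℕ) : ℤ) + 1 := by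
      push_cast; ring
    rw [h1, zpow_add_one₀ hq0, fullDigit, if_neg (by push_cast; omega),
      if_neg (by push_cast; omega)]
    cases neg
    · simp
    · simp only [if_true]
      rw [Nat.cast_sub (by omega)]
      push_cast
      ring

namespace LevelNet

variable {Q : Type} {N : LevelNet Q} {s f : Q}

theorem sum_shifted_expansion {q : ℕ} {a h : ℤ} {I I' : ℕ} {ζ : ℕ → ℤ} (ha : a ≤ h)
    (hI : h + I' ≤ a + I) (hζ : ∀ i, I' ≤ i → ζ i = 0) (hq : 2 ≤ q) :
    ∑ i ∈ Finset.range I, ((if h ≤ a + i then ζ (a + i - h).toNat else 0 : ℤ) : ℚ) *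
      (q : ℚ) ^ (a + (i : ℤ)) =
    ((∑ i ∈ Finset.range I', ζ i * (q : ℤ) ^ i : ℤ) : ℚ) * (q : ℚ) ^ h := by
  have hq0 : (q : ℚ) ≠ 0 := by positivity
  obtain ⟨n, rfl⟩ : ∃ n : ℕ, h = a + n := ⟨(h - a).toNat, by omega⟩
  obtain ⟨n', rfl⟩ : ∃ n' : ℕ, I = n + (I' + n') := ⟨I - (n + I'), by omega⟩
  rw [Finset.sum_range_add, Finset.sum_range_add, Finset.sum_eq_zero, zero_add]
  · have h1 : ∀ j : ℕ, (a + ((n + j : ℕ) : ℤ) - (a + n)).toNat = j := fun j => by omega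
    simp only [h1]
    rw [Finset.sum_eq_zero (s := Finset.range n')]
    · rw [add_zero]
      push_cast
      rw [Finset.sum_mul]
      refine Finset.sum_congr rfl fun j _ => ?_
      rw [if_pos (by omega), ← add_assoc, zpow_add₀ hq0 _ (j : ℤ), zpow_natCast]
      ring
    · intro j _
      rw [hζ _ (by omega)]
      simp
  · intro i hi
    rw [Finset.mem_range] at hi
    rw [if_neg (by omega)]
    simp

/-- The states in which the automaton accepts. -/
def CrossState.IsFinal (neg : Bool) (σ : CrossState (Q ⊕ Bool)) : Prop :=
  -- A remaining carry 1 is the power of q to be subtracted for a negative number.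
  σ.1 = [(.inr false, .inr true)] ∧ σ.2.1 = if neg then 1 else 0

theorem exists_walk_of_crossReach [Fintype Q] (hN : N.Homogeneous) {q : ℕ} (hq : 2 ≤ q) {m : ℤ}
    {B K : ℕ} {L : ℤ} {J : ℕ} {dig : ℕ → ℕ} {neg : Bool} {n n' : ℕ} {σ : CrossState (Q ⊕ Bool)}
    (hσ : CrossReach (N.ext s f m) (N.extLoops q) q B K (L - n)
      (fun i => fullDigit q L J dig neg (L - n + i)) (n + J + n') σ) (hfin : σ.IsFinal neg) :
    ∃ μ, N.Walk s 0 f m μ ∧ val q μ =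
      ∑ j ∈ Finset.range J, (dig j : ℚ) * (q : ℚ) ^ (L + (j : ℤ)) -
        (if neg then (q : ℚ) ^ (L + (J : ℤ)) else 0) := by
  obtain ⟨μ, h1, -, h2⟩ := hσ.exists_real hq (exists_walk_of_mem_extLoops hN hq)
  rw [hfin.1] at h1
  cases h1 with
  | @cons _ _ _ α β hw hnil =>
    cases hnil
    obtain ⟨ν, h3, h4⟩ := (hw.of_ext hN (q := q) rfl).2.1 rfl
    refine ⟨ν, h3, ?_⟩
    rw [← sum_fullDigit hq L J dig neg n n', h4, ← h2, hfin.2, add_zero]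
    cases neg <;> simp

/-- The skeleton has at most `B₀` edges on each level and the extension adds 6, which bounds the
segments. A digit, a level sum and the inserted digits together are at most `K` in absolute value,
hence so are the carries. -/
theorem exists_crossReach [Fintype Q] (hN : N.Homogeneous)
    (hv : ∀ h p v p', N.flat h p v p' → v.natAbs ≤ 1) {q : ℕ} (hq : 2 ≤ q) :
    ∃ B K : ℕ, ∀ (m L : ℤ) (J : ℕ) (dig : ℕ → ℕ) (neg : Bool) (μ : Multiset (Q × ℤ × ℤ)),
      (∀ j < J, dig j < q) → N.Walk s 0 f m μ → val q μ =
        ∑ j ∈ Finset.range J, (dig j : ℚ) * (q : ℚ) ^ (L + (j : ℤ)) -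
          (if neg then (q : ℚ) ^ (L + (J : ℤ)) else 0) →
      ∃ (n n' : ℕ) (σ : CrossState (Q ⊕ Bool)),
        CrossReach (N.ext s f m) (N.extLoops q) q B K (L - n)
          (fun i => fullDigit q L J dig neg (L - n + i)) (n + J + n') σ ∧ σ.IsFinal neg := by
  classical
  have hq0 : (q : ℚ) ≠ 0 := by positivity
  choose κ hκ using fun p => (N.loopValues q p).exists_bounded_expansion hq
  set B₀ := Fintype.card Q * (2 * Fintype.card Q + 1) with hB₀
  refine ⟨B₀ + 6, q + B₀ + ∑ p, κ p, fun m L J dig neg μ₀ hdig hw₀ hval => ?_⟩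
  obtain ⟨μ, hm, z, hw, hcount, hz, hzm, hsum⟩ := hw₀.exists_skeleton hN hq
  choose ζ I' hζ1 hζ2 hζ3 using fun p => hκ p (z p) (hz p)
  have hlevel : ∀ k, levelCount k μ ≤ B₀ := fun k => by
    rw [levelCount_eq_sum, hB₀]
    refine (Finset.sum_le_card_nsmul _ _ _ fun p _ => hcount (p, k)).trans ?_
    simp
  have habs := hw.natAbs_value_le hv
  -- a range of levels that contains everything
  obtain ⟨C, hC⟩ : ∃ C : ℕ, L.natAbs ≤ C ∧ m.natAbs ≤ C ∧ J ≤ C ∧ (∀ e ∈ μ, e.2.1.natAbs ≤ C) ∧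
      ∀ p, (hm p).natAbs ≤ C ∧ I' p ≤ C := by
    refine ⟨L.natAbs + m.natAbs + J + (μ.map fun e => e.2.1.natAbs).sum +
      ∑ p, ((hm p).natAbs + I' p), by omega, by omega, by omega, fun e he => ?_, fun p => ?_⟩
    · have := Multiset.single_le_sum (by simp) _
        (Multiset.mem_map_of_mem (fun e : Q × ℤ × ℤ => e.2.1.natAbs) he)
      omega
    · have := Finset.single_le_sum (f := fun p => (hm p).natAbs + I' p) (by simp)
        (Finset.mem_univ p)
      omega
  obtain ⟨hCL, hCm, hCJ, hCμ, hCp⟩ := hC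
  -- As `L` and the skeleton lie within distance C of 0, reading starts below -C and ends above 3C,
  -- while the expansions of the closed walks end by level 2C.
  set n := 2 * C + 1 with hn
  set n' := 4 * C + 1 with hn'
  set a : ℤ := L - n with ha
  set I := n + J + n' with hI
  set D : ℕ → ℕ := fun i => fullDigit q L J dig neg (a + i) with hD
  have hHl : C < a + I := by rw [ha, hI]; push_cast; omega
  have haC : a ≤ -C := by rw [ha, hn]; push_cast; omega
  have hDq : ∀ i, D i ≤ q := fun i => by
    simp only [hD, fullDigit]
    split_ifs with h1 h2
    · omega
    · exact (hdig _ (by omega)).le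
    · omega
    · omega
  obtain ⟨ν, hν, hν1, hν2, hν3, hν4⟩ := hw.exists_belowReal (H := a + I) hN (by omega) (by omega)
    (fun e he => by have := hCμ e he; omega)
  -- the closed walks that are inserted on the levels
  set Z : ℕ → Q ⊕ Bool → ℤ := fun i => Sum.elim (fun p => if z p = 0 then 0 else
    -- For z p = 0 the chosen expansion is discarded, since then no visit at (p, hm p) is
    -- guaranteed.
    if hm p ≤ a + i then ζ p (a + i - hm p).toNat else 0) fun _ => 0 with hZ
  have hZabs : ∀ i, (∑ y, Z i y).natAbs ≤ ∑ p, κ p := fun i => by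
    rw [Fintype.sum_sum_type]
    simp only [hZ, Sum.elim_inl, Sum.elim_inr, Finset.sum_const_zero, add_zero]
    refine (Int.natAbs_sum_le _ _).trans (Finset.sum_le_sum fun p _ => ?_)
    split_ifs
    · simp
    · exact (hζ1 p _).2
    · simp
  have hZsum : ∑ i ∈ Finset.range I, ((∑ y, Z i y : ℤ) : ℚ) * (q : ℚ) ^ (a + (i : ℤ)) =
      ∑ p, (z p : ℚ) * (q : ℚ) ^ hm p := by
    simp only [Fintype.sum_sum_type, hZ, Sum.elim_inl, Sum.elim_inr, Finset.sum_const_zero,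
      add_zero, Int.cast_sum, Finset.sum_mul]
    rw [Finset.sum_comm]
    refine Finset.sum_congr rfl fun p _ => ?_
    by_cases h0 : z p = 0
    · simp [h0]
    · simp only [h0, if_false]
      have := hCp p
      rw [sum_shifted_expansion (by omega) (by omega) (hζ2 p) hq, ← hζ3 p]
  obtain ⟨e, he0, heI, hestep, heK⟩ := exists_carries (K := q + B₀ + ∑ p, κ p) hq
    (fun i => (D i : ℤ) - levelSum (a + i) μ - ∑ y, Z i y) I (fun i _ => by
      have h1 := hDq i
      have h2 := (natAbs_levelSum_le (k := a + i) habs).trans (hlevel _)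
      have h3 := hZabs i
      omega) (if neg then 1 else 0) (by
      have h1 := val_eq_sum_levelSum (q := q) (a := a) (I := I) (μ := μ) (fun e he => by
        have := hCμ e he; omega)
      have h2 := sum_fullDigit hq L J dig neg n n'
      rw [← hval, hsum, h1, ← hZsum] at h2
      have h3 : ((∑ i ∈ Finset.range I, ((D i : ℤ) - levelSum (a + i) μ - ∑ y, Z i y) *
          (q : ℤ) ^ i : ℤ) : ℚ) * (q : ℚ) ^ a =
          (((if neg then 1 else 0) * (q : ℤ) ^ I : ℤ) : ℚ) * (q : ℚ) ^ a := by
        have h4 : ∀ i : ℕ, (q : ℚ) ^ i * (q : ℚ) ^ a = (q : ℚ) ^ (a + (i : ℤ)) := fun i => by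
          rw [zpow_add₀ hq0, zpow_natCast, mul_comm]
        have h5 : (((if neg then 1 else 0) * (q : ℤ) ^ I : ℤ) : ℚ) * (q : ℚ) ^ a =
            if neg then (q : ℚ) ^ (a + (I : ℤ)) else 0 := by
          cases neg <;> simp [h4]
        rw [h5, Int.cast_sum, Finset.sum_mul]
        have h6 : ∀ i ∈ Finset.range I, (((((D i : ℤ) - levelSum (a + i) μ - ∑ y, Z i y) *
            (q : ℤ) ^ i : ℤ)) : ℚ) * (q : ℚ) ^ a = (D i : ℚ) * (q : ℚ) ^ (a + (i : ℤ)) -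
            ((levelSum (a + i) μ : ℚ) * (q : ℚ) ^ (a + (i : ℤ)) +
              ((∑ y, Z i y : ℤ) : ℚ) * (q : ℚ) ^ (a + (i : ℤ))) := fun i _ => by
          rw [← h4]
          push_cast
          ring
        rw [Finset.sum_congr rfl h6, Finset.sum_sub_distrib, Finset.sum_add_distrib, ← h2]
        ring
      exact_mod_cast mul_right_cancel₀ (zpow_ne_zero a hq0) h3)
  refine ⟨n, n', _, CrossReach.of_belowReal (μ := ν) (I := I) (e := e)
    (A := fun i => {y | ∃ p, y = .inl p ∧ z p ≠ 0 ∧ hm p < a + i}) (z := Z)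
    ?_ ?_ he0 ?_ heK ?_ ?_ ?_ ?_ I le_rfl _ ν hν rfl (by simp), rfl, heI⟩
  · exact hν4 a (by omega) (by omega) fun e he => by have := hCμ e he; omega
  · exact fun k => (hν3 k).trans (by have := hlevel k; omega)
  · ext y
    simp only [Set.mem_ofPred_eq, Set.mem_empty_iff_false, iff_false]
    rintro ⟨p, -, -, h1⟩
    have := hCp p
    simp only [Nat.cast_zero] at h1
    omega
  · rintro i - y ⟨p, rfl, h1, h2⟩
    by_cases h3 : hm p < a + i
    · exact .inl ⟨p, rfl, h1, h3⟩
    · have h4 : hm p = a + i := by push_cast at h2; omega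
      obtain ⟨u, hu⟩ := hzm p h1
      refine .inr ⟨u, ?_⟩
      rw [← h4]
      exact hν1 _ hu
  · intro i y
    rcases y with p | b
    · simp only [hZ, Sum.elim_inl, extLoops]
      split_ifs
      · exact zero_mem _
      · exact (hζ1 p _).1
      · exact zero_mem _
    · exact zero_mem _
  · rintro i - y hy
    rcases y with p | b
    · simp only [hZ, Sum.elim_inl] at hy
      split_ifs at hy with h1 h2
      · exact absurd rfl hy
      · exact ⟨p, rfl, h1, by push_cast; omega⟩
      · exact absurd rfl hy
    · exact absurd rfl hy
  · intro i hi
    rw [hν2, ← hestep i hi]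
    ring

end LevelNet

/-! ### Determinization and the digits of the input word. -/

/-! ### The subset automaton -/

/-- The run of an automaton on a sequence of digits with two flags. -/
def dfaRun {D : Type*} (δ : D → ℕ → Bool → Bool → D) (d : D) (c : ℕ → ℕ × Bool × Bool) : ℕ → D
  | 0 => d
  | i + 1 => δ (dfaRun δ d c i) (c i).1 (c i).2.1 (c i).2.2

theorem dfaRun_add {D : Type*} (δ : D → ℕ → Bool → Bool → D) (d : D) (c : ℕ → ℕ × Bool × Bool)
    (n i : ℕ) : dfaRun δ d c (n + i) = dfaRun δ (dfaRun δ d c n) (fun j => c (n + j)) i := by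
  induction i with
  | zero => rfl
  | succ i ih => rw [← add_assoc, dfaRun, ih, dfaRun]

theorem dfaRun_congr {D : Type*} (δ : D → ℕ → Bool → Bool → D) (d : D)
    {c c' : ℕ → ℕ × Bool × Bool} {n : ℕ} (h : ∀ i < n, c i = c' i) :
    dfaRun δ d c n = dfaRun δ d c' n := by
  induction n with
  | zero => rfl
  | succ n ih => rw [dfaRun, dfaRun, ih fun i hi => h i (by omega), h n (by omega)]

namespace LevelNet

variable {Q : Type} [Fintype Q] (N : LevelNet Q) (s f : Q) (q B K : ℕ)

/-- The transition function of the subset automaton. -/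
def subsetStep (D : Set {σ : CrossState (Q ⊕ Bool) // σ.Bounded B K}) (d : ℕ) (b b' : Bool) :
    Set {σ : CrossState (Q ⊕ Bool) // σ.Bounded B K} :=
  {τ | ∃ σ ∈ D, CrossStep (extFlat (N.flat 0) s f b b') (extUp N.up) (extDown N.down)
    (N.extLoops q) q d σ.1 τ.1}

/-- The initial state of the automaton of crossing segments. -/
def crossInit : {σ : CrossState (Q ⊕ Bool) // σ.Bounded B K} :=
  ⟨([], 0, ∅), by simp [CrossState.Bounded]⟩

variable {N s f q B K}

theorem mem_dfaRun_iff_exists (D : Set {σ : CrossState (Q ⊕ Bool) // σ.Bounded B K})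
    (c : ℕ → ℕ × Bool × Bool) (i : ℕ) (σ : {σ : CrossState (Q ⊕ Bool) // σ.Bounded B K}) :
    σ ∈ dfaRun (N.subsetStep s f q B K) D c i ↔
      ∃ σ₀ ∈ D, σ ∈ dfaRun (N.subsetStep s f q B K) {σ₀} c i := by
  induction i generalizing σ with
  | zero => simp [dfaRun]
  | succ i ih =>
    simp only [dfaRun, subsetStep, Set.mem_ofPred_eq]
    constructor
    · rintro ⟨τ, hτ, hs⟩
      obtain ⟨σ₀, h1, h2⟩ := (ih τ).mp hτ
      exact ⟨σ₀, h1, τ, h2, hs⟩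
    · rintro ⟨σ₀, h1, τ, h2, hs⟩
      exact ⟨τ, (ih τ).mpr ⟨σ₀, h1, h2⟩, hs⟩

theorem CrossReach.bounded {Q : Type} [Fintype Q] {N : LevelNet Q} {M : Q → AddSubmonoid ℤ} {a : ℤ}
    {dig : ℕ → ℕ} {i : ℕ} {σ : CrossState Q} (hσ : CrossReach N M q B K a dig i σ) :
    σ.Bounded B K := by
  cases hσ with
  | init => simp [CrossState.Bounded]
  | step _ _ hb => exact hb

theorem mem_dfaRun_iff_crossReach (m a : ℤ) (dig : ℕ → ℕ) (i : ℕ)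
    (σ : {σ : CrossState (Q ⊕ Bool) // σ.Bounded B K}) :
    σ ∈ dfaRun (N.subsetStep s f q B K) {crossInit B K}
      (fun i => (dig i, decide (a + i = 0), decide (a + i = m))) i ↔
    CrossReach (N.ext s f m) (N.extLoops q) q B K a dig i σ.1 := by
  induction i generalizing σ with
  | zero =>
    constructor
    · intro h
      obtain rfl : σ = crossInit B K := h
      exact .init
    · intro h
      obtain ⟨σ, hσ⟩ := σ
      simp only at h
      cases h
      rfl
  | succ i ih =>
    constructor
    · rintro ⟨τ, hτ, hs⟩
      exact .step ((ih τ).mp hτ) hs σ.2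
    · intro h
      obtain ⟨σ, hσ⟩ := σ
      simp only at h
      cases h with
      | @step _ τ _ hτ hs hb =>
        have hτb := hτ.bounded
        exact ⟨⟨τ, hτb⟩, (ih ⟨τ, hτb⟩).mpr hτ, hs⟩

/-- The values of the walks from `(s, 0)` to `(f, m)` are recognized by a finite automaton that
reads their base `q` expansions. -/
theorem exists_automaton (hN : N.Homogeneous)
    (hv : ∀ h p v p', N.flat h p v p' → v.natAbs ≤ 1) (hq : 2 ≤ q) :
    ∃ (D : Type) (_ : Finite D) (δ : D → ℕ → Bool → Bool → D) (d₀ : D) (acc : D → Bool → Bool),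
      ∀ (m L : ℤ) (J : ℕ) (dig : ℕ → ℕ) (neg : Bool), L ≤ 0 → L ≤ m → 0 < L + J → m < L + J →
        (∀ j < J, dig j < q) →
        (acc (dfaRun δ d₀ (fun j => (dig j, decide (L + j = 0), decide (L + j = m))) J) neg = true ↔
          ∃ μ, N.Walk s 0 f m μ ∧ val q μ =
            ∑ j ∈ Finset.range J, (dig j : ℚ) * (q : ℚ) ^ (L + (j : ℤ)) -
              (if neg then (q : ℚ) ^ (L + (J : ℤ)) else 0)) := by
  classical
  obtain ⟨B, K, hBK⟩ := exists_crossReach (s := s) (f := f) hN hv hq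
  have hfin := CrossState.finite_bounded (Q := Q ⊕ Bool) B K
  refine ⟨Set {σ : CrossState (Q ⊕ Bool) // σ.Bounded B K}, inferInstance,
    N.subsetStep s f q B K,
    -- Padding digits carry no flags, because levels 0 and m lie in [L, L + J). Zeros below L are
    -- therefore absorbed into the initial set, and the digits 0 or q - 1 above into the acceptance
    -- condition.
    {σ | ∃ n, σ ∈ dfaRun (N.subsetStep s f q B K) {crossInit B K} (fun _ => (0, false, false)) n},
    fun D neg => decide (∃ n, ∃ σ ∈ dfaRun (N.subsetStep s f q B K) D
      (fun _ => (if neg then q - 1 else 0, false, false)) n, σ.1.IsFinal neg),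
    fun m L J dig neg hL hLm hJ hJm hdig => ?_⟩
  have key : ∀ n n' : ℕ, dfaRun (N.subsetStep s f q B K) {crossInit B K}
      (fun i => (fullDigit q L J dig neg (L - n + i), decide (L - n + i = 0),
        decide (L - n + i = m))) (n + J + n') =
      dfaRun (N.subsetStep s f q B K) (dfaRun (N.subsetStep s f q B K)
        (dfaRun (N.subsetStep s f q B K) {crossInit B K} (fun _ => (0, false, false)) n)
        (fun j => (dig j, decide (L + j = 0), decide (L + j = m))) J)
        (fun _ => (if neg then q - 1 else 0, false, false)) n' := by
    intro n n'
    rw [dfaRun_add, dfaRun_add]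
    have h1 : dfaRun (N.subsetStep s f q B K) {crossInit B K}
        (fun i => (fullDigit q L J dig neg (L - n + i), decide (L - n + i = 0),
        decide (L - n + i = m))) n =
        dfaRun (N.subsetStep s f q B K) {crossInit B K} (fun _ => (0, false, false)) n := by
      refine dfaRun_congr _ _ fun i hi => ?_
      rw [fullDigit, if_pos (by omega), decide_eq_false (by omega), decide_eq_false (by omega)]
    rw [h1]
    have h2 : ∀ D, dfaRun (N.subsetStep s f q B K) D
        (fun j => (fullDigit q L J dig neg (L - n + (n + j : ℕ)),
          decide (L - n + (n + j : ℕ) = 0), decide (L - n + (n + j : ℕ) = m))) J =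
        dfaRun (N.subsetStep s f q B K) D
          (fun j => (dig j, decide (L + j = 0), decide (L + j = m))) J := by
      refine fun D => dfaRun_congr _ _ fun j hj => ?_
      have h3 : L - n + ((n + j : ℕ) : ℤ) = L + j := by push_cast; ring
      rw [h3, fullDigit, if_neg (by omega), if_pos (by omega)]
      simp
    rw [h2]
    refine dfaRun_congr _ _ fun i _ => ?_
    rw [fullDigit, if_neg (by push_cast; omega), if_neg (by push_cast; omega),
      decide_eq_false (by push_cast; omega), decide_eq_false (by push_cast; omega)]
  rw [decide_eq_true_iff]
  constructor
  · rintro ⟨n', σ, hσ, hfinal⟩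
    obtain ⟨σ₁, h1, h2⟩ := (mem_dfaRun_iff_exists _ _ _ _).mp hσ
    obtain ⟨σ₀, ⟨n, h3⟩, h4⟩ := (mem_dfaRun_iff_exists _ _ _ _).mp h1
    refine exists_walk_of_crossReach hN hq (n := n) (n' := n') (σ := σ.1) (B := B) (K := K) ?_ hfinal
    rw [← mem_dfaRun_iff_crossReach, key]
    exact (mem_dfaRun_iff_exists _ _ _ _).mpr
      ⟨σ₁, (mem_dfaRun_iff_exists _ _ _ _).mpr ⟨σ₀, h3, h4⟩, h2⟩
  · rintro ⟨μ, hw, hval⟩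
    obtain ⟨n, n', σ, hσ, hfinal⟩ := hBK m L J dig neg μ hdig hw hval
    have hb := hσ.bounded
    have h1 := (mem_dfaRun_iff_crossReach m (L - n) _ (n + J + n') ⟨σ, hb⟩).mpr hσ
    rw [key] at h1
    obtain ⟨σ₁, h2, h3⟩ := (mem_dfaRun_iff_exists _ _ _ _).mp h1
    obtain ⟨σ₀, h4, h5⟩ := (mem_dfaRun_iff_exists _ _ _ _).mp h2
    exact ⟨n', ⟨σ, hb⟩, (mem_dfaRun_iff_exists _ _ _ _).mpr
      ⟨σ₁, (mem_dfaRun_iff_exists _ _ _ _).mpr ⟨σ₀, ⟨n, h4⟩, h5⟩, h3⟩, hfinal⟩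

end LevelNet

/-! ### The expansion of the number denoted by a word -/

/-- The digit that is computed on a level. -/
def runDigit {D : Type*} (q : ℕ) (δ : D → ℕ → Bool → Bool → D) (d₀ : D) (w : List BSLetter)
    (j : ℕ) : ℕ :=
  (((digitRun q δ d₀ w j).2 + wordCoeff (w.length - j) w) % q).toNat

theorem digitRun_fst {D : Type*} (q : ℕ) (δ : D → ℕ → Bool → Bool → D) (d₀ : D)
    (w : List BSLetter) (j : ℕ) :
    (digitRun q δ d₀ w j).1 = dfaRun δ d₀ (fun j => (runDigit q δ d₀ w j,
      decide (-(w.length : ℤ) + j = 0), decide (-(w.length : ℤ) + j = wordHeight w))) j := by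
  induction j with
  | zero => rfl
  | succ j ih =>
    rw [dfaRun, ← ih]
    simp only [digitRun, runDigit]
    congr 1
    · congr 1
      simp only [eq_iff_iff]
      constructor <;> intro h <;> omega
    · congr 1
      simp only [eq_iff_iff]
      constructor <;> intro h <;> omega

theorem sum_runDigit {D : Type*} {q : ℕ} (hq : 2 ≤ q) (δ : D → ℕ → Bool → Bool → D) (d₀ : D)
    (w : List BSLetter) (J : ℕ) (L : ℤ) :
    ∑ j ∈ Finset.range J, (runDigit q δ d₀ w j : ℚ) * (q : ℚ) ^ (L + (j : ℤ)) +
        ((digitRun q δ d₀ w J).2 : ℚ) * (q : ℚ) ^ (L + (J : ℤ)) =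
      ∑ j ∈ Finset.range J, (wordCoeff (w.length - j) w : ℚ) * (q : ℚ) ^ (L + (j : ℤ)) := by
  have hq0 : (q : ℚ) ≠ 0 := by positivity
  induction J with
  | zero => simp [digitRun]
  | succ J ih =>
    rw [Finset.sum_range_succ, Finset.sum_range_succ, ← ih]
    simp only [digitRun, runDigit]
    set c := (digitRun q δ d₀ w J).2 + wordCoeff (w.length - J) w with hc
    have h1 : (((c % q).toNat : ℕ) : ℤ) = c % q := Int.toNat_of_nonneg (Int.emod_nonneg _ (by omega))
    have h2 : (((c % q).toNat : ℕ) : ℚ) + q * ((c / q : ℤ) : ℚ) = c := by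
      have := Int.emod_add_mul_ediv c q
      rw [← h1] at this
      exact_mod_cast this
    have h3 : (q : ℚ) ^ (L + ((J + 1 : ℕ) : ℤ)) = q * (q : ℚ) ^ (L + (J : ℤ)) := by
      push_cast
      rw [← add_assoc, zpow_add_one₀ hq0, mul_comm]
    rw [h3]
    have h4 : (c : ℚ) = (digitRun q δ d₀ w J).2 + wordCoeff (w.length - J) w := by
      rw [hc]; push_cast; ring
    linear_combination (q : ℚ) ^ (L + (J : ℤ)) * (h2 + h4)

/-- The letters are regrouped by their height; the bounds make the range contain every height that
occurs. -/
theorem wordVal_eq_sum {q : ℕ} (w : List BSLetter) (h L : ℤ) (J : ℕ) (hL : L ≤ h - w.length)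
    (hJ : h + w.length < L + J) :
    wordVal q h w =
      ∑ j ∈ Finset.range J, (wordCoeff (h - (L + j)) w : ℚ) * (q : ℚ) ^ (L + (j : ℤ)) := by
  induction w generalizing h with
  | nil => simp [wordVal, wordCoeff]
  | cons l w ih =>
    have h1 := SignType.natAbs_coe_le l.rise
    rw [List.length_cons] at hL hJ
    push_cast at hL hJ
    rw [wordVal, ih (h + l.rise) (by omega) (by omega)]
    simp only [wordCoeff, Int.cast_add, add_mul, Finset.sum_add_distrib]
    congr 1
    · obtain ⟨n, rfl⟩ : ∃ n : ℕ, h = L + n := ⟨(h - L).toNat, by omega⟩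
      rw [Finset.sum_eq_single n]
      · simp
      · intro j _ hj
        rw [if_neg (by omega)]
        simp
      · intro hn
        rw [Finset.mem_range] at hn
        omega
    · refine Finset.sum_congr rfl fun j _ => ?_
      rw [show h + (l.rise : ℤ) - (L + j) = h - (L + j) + l.rise by ring]

/-- After the 2n + 1 levels from -n to n all coefficients vanish and the carry, at most n in
absolute value, is only divided by q. The interval confining it shrinks by one at both ends each
time, until after n levels only -1 and 0 are left. -/
theorem digitRun_snd_final {D : Type} {q : ℕ} (hq : 2 ≤ q) (δ : D → ℕ → Bool → Bool → D) (d₀ : D)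
    (w : List BSLetter) :
    (digitRun q δ d₀ w (3 * w.length + 1)).2 = 0 ∨
      (digitRun q δ d₀ w (3 * w.length + 1)).2 = -1 := by
  have hq' : (0 : ℤ) < q := by omega
  have main : ∀ t ≤ w.length,
      -((w.length : ℤ) - t) - 1 ≤ (digitRun q δ d₀ w (2 * w.length + 1 + t)).2 ∧
        (digitRun q δ d₀ w (2 * w.length + 1 + t)).2 ≤ (w.length : ℤ) - t := by
    intro t
    induction t with
    | zero =>
      intro _
      have := DigitMachine.natAbs_digitRun_le hq δ d₀ w (2 * w.length + 1)
      simp only [add_zero, Nat.cast_zero]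
      omega
    | succ t ih =>
      intro ht
      obtain ⟨h1, h2⟩ := ih (by omega)
      have h3 : (digitRun q δ d₀ w (2 * w.length + 1 + (t + 1))).2 =
          (digitRun q δ d₀ w (2 * w.length + 1 + t)).2 / q := by
        rw [← add_assoc, digitRun]
        simp only
        rw [wordCoeff_eq_zero _ _ (by push_cast; omega), add_zero]
      rw [h3]
      generalize (digitRun q δ d₀ w (2 * w.length + 1 + t)).2 = k at h1 h2
      push_cast
      constructor
      · rw [Int.le_ediv_iff_mul_le hq']
        nlinarith
      · rw [← Int.lt_add_one_iff, Int.ediv_lt_iff_lt_mul hq']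
        nlinarith
  have := main w.length le_rfl
  rw [show 2 * w.length + 1 + w.length = 3 * w.length + 1 by ring] at this
  omega

theorem mainTheorem6 (q : ℕ) (hq : 2 ≤ q) (R : Set (BS 1 q)) (hR : IsRationalSubset R) :
    InLogSpace {w : List BSLetter | BS.ofWord 1 q w ∈ R} := by
  obtain ⟨Q, hQ, N, s, f, hN, hv, hR⟩ := hR.exists_levelNet hq
  have := Fintype.ofFinite Q
  obtain ⟨D, hD, δ, d₀, acc, h⟩ := LevelNet.exists_automaton (s := s) (f := f) hN hv hq
  convert inLogSpace_digitRun hq δ d₀ acc using 1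
  ext w
  simp only [Set.mem_ofPred_eq]
  have hh := natAbs_wordHeight_le w
  -- The automaton reads the levels -n, …, 2n, which include 0 and the height of the word; a final
  -- carry of -1 is the flag for a negative number.
  rw [hR, digitRun_fst, h _ _ _ _ _ (by omega) (by omega) (by push_cast; omega)
    (by push_cast; omega)]
  · refine exists_congr fun μ => and_congr_right fun _ => ?_
    have h1 : wordVal q 0 w = ∑ j ∈ Finset.range (3 * w.length + 1),
        (runDigit q δ d₀ w j : ℚ) * (q : ℚ) ^ (-(w.length : ℤ) + (j : ℤ)) -
        (if decide ((digitRun q δ d₀ w (3 * w.length + 1)).2 < 0) then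
          (q : ℚ) ^ (-(w.length : ℤ) + ((3 * w.length + 1 : ℕ) : ℤ)) else 0) := by
      rw [wordVal_eq_sum w 0 (-w.length) (3 * w.length + 1) (by omega) (by push_cast; omega)]
      have h2 : ∀ j : ℕ, (0 : ℤ) - (-(w.length : ℤ) + j) = w.length - j := fun j => by ring
      simp only [h2]
      rw [← sum_runDigit hq δ d₀]
      rcases digitRun_snd_final hq δ d₀ w with h3 | h3
      · simp [h3]
      · simp [h3]
        ring
    rw [h1]
  · intro j _
    have := Int.emod_lt_of_pos ((digitRun q δ d₀ w j).2 + wordCoeff (w.length - j) w)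
      (show (0 : ℤ) < q by omega)
    rw [runDigit]
    omega
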